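/- **Definitions.** A *polygon* in Euclidean space $\mathbb{E}^3$ is either an $n$-gon ($n\ge 3$), with distinct vertices $v_1,\dots,v_n$ and the line segments $v_iv_{i+1}$ (indices mod $n$) as edges, or an infinite polygon, with distinct vertices $v_i$ ($i\in\mathbb{Z}$) and the segments $v_iv_{i+1}$ as edges, such that every compact set meets only finitely many of these segments. A *polygonal complex* $\mathcal{K}$ in $\mathbb{E}^3$ consists of a set of points (vertices), a set of line segments joining pairs of distinct vertices (edges) and a set of polygons (faces) whose edges are edges of $\mathcal{K}$, such that: (a) the edge graph is connected; (b) for each vertex $v$ the vertex-figure is a non-empty connected graph, its vertices being the neighbours of $v$, and $u,w$ being joined whenever $uv$ and $vw$ are edges of a common face; (c) for some fixed integer $r\ge 2$, every edge lies in exactly $r$ faces; (d) every compact set meets only finitely many faces. A *flag* is a mutually incident triple (vertex, edge, face). The symmetry group $G(\mathcal{K})$ consists of all isometries of the affine hull of $\mathcal{K}$ that map $\mathcal{K}$ to itself; $\mathcal{K}$ is *regular* if $G(\mathcal{K})$ is transitive on the flags, and it has *non-trivial flag stabilizer* if some (equivalently, for regular $\mathcal{K}$, every) flag is fixed by a non-identity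 element of $G(\mathcal{K})$. A *regular $4$-apeirotope* in $\mathbb{E}^3$ is an infinite discrete faithful realization $\mathcal{P}$ of an abstract polytope of rank $4$ in $\mathbb{E}^3$ (vertices are points forming a locally finite set, edges are determined by their two end points, $2$-faces by their sets of edges, facets by their sets of $2$-faces; every edge, $2$-face and facet contains a face of the next lower rank, and every vertex, edge and $2$-face lies in one of the next higher rank; every flag has exactly one $i$-adjacent flag for $i=0,\dots,3$; the structure is strongly flag-connected) whose group of isometric symmetries is transitive on the flags (vertex, edge, $2$-face, facet). Its distinguished generators with respect to a base flag are symmetries $T_0,\dots,T_3$, where $T_i$ maps the base flag to its $i$-adjacent flag. A regular $4$-apeirotope is the *Petrie dual* of $\mathcal{P}$ if, with respect to a suitable base flag with the same base vertex, its distinguished generators are $T_0,\,T_1T_3,\,T_2,\,T_3$. The *$2$-skeleton* of $\mathcal{P}$ consists of its vertices, edges and $2$-faces. **Theorem.** Up to similarity, there are precisely four regular polygonal complexes in $\mathbb{E}^3$ with non-trivial flag stabilizer. Moreover, each regular polygonal complex in $\mathbb{E}^3$ with non-trivial flag stabilizer is the common $2$-skeleton of two distinct regular $4$-apeirotopes in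 $\mathbb{E}^3$ which are Petrie duals of each other. -/

import Mathlib

open Set

/-- Euclidean 3-space. -/
abbrev E3 : Type := EuclideanSpace ℝ (Fin 3)

/-- The line segment of an edge. An edge (a line segment together with its end points) is
recorded by the unordered pair of its end points. -/
def edgeSegment (e : Sym2 E3) : Set E3 :=
  Sym2.lift ⟨fun a b => segment ℝ a b, fun a b => segment_symm ℝ a b⟩ e

/-- The point set covered by a polygon; a polygon is recorded by the set of its edges, which
determines its vertices and line segments. -/
def polygonBody (F : Set (Sym2 E3)) : Set E3 := ⋃ e ∈ F, edgeSegment e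

/-- `F` is the edge set of a finite polygon `(v_1, …, v_n)` with distinct vertices. -/
def IsFinitePolygon (F : Set (Sym2 E3)) : Prop :=
  ∃ n : ℕ, 3 ≤ n ∧ ∃ v : ZMod n → E3, Function.Injective v ∧
    F = range fun i : ZMod n => s(v i, v (i + 1))

/-- `F` is the edge set of an infinite polygon `(…, v_{-1}, v_0, v_1, …)` with distinct vertices,
each compact set meeting only finitely many of its line segments. -/
def IsInfinitePolygon (F : Set (Sym2 E3)) : Prop :=
  ∃ v : ℤ → E3, Function.Injective v ∧
    F = (range fun i : ℤ => s(v i, v (i + 1))) ∧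
    ∀ C : Set E3, IsCompact C → {e | e ∈ F ∧ (edgeSegment e ∩ C).Nonempty}.Finite

/-- Finite or infinite polygons. -/
def IsPolygon (F : Set (Sym2 E3)) : Prop := IsFinitePolygon F ∨ IsInfinitePolygon F

/-- A family of vertices, edges and faces in `E3`. -/
@[ext]
structure CellData where
  verts : Set E3
  edges : Set (Sym2 E3)
  faces : Set (Set (Sym2 E3))

namespace CellData

/-- The edge graph. -/
def edgeGraph (K : CellData) : SimpleGraph K.verts where
  Adj u w := u ≠ w ∧ s((u : E3), (w : E3)) ∈ K.edges
  symm := ⟨fun _ _ h => ⟨h.1.symm, by rw [Sym2.eq_swap]; exact h.2⟩⟩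
  loopless := ⟨fun _ h => h.1 rfl⟩

/-- The vertex-figure at `v`, up to multiplicity of edges (which is irrelevant for
connectedness): its vertices are the neighbours of `v`, and `u`, `w` are joined when `(u, v)` and
`(v, w)` are edges of a common face. -/
def vertexFigure (K : CellData) (v : E3) : SimpleGraph {u : E3 // s(u, v) ∈ K.edges} where
  Adj u w := u ≠ w ∧ ∃ F ∈ K.faces, s((u : E3), v) ∈ F ∧ s(v, (w : E3)) ∈ F
  symm := ⟨fun _ _ h => by
    obtain ⟨hne, F, hF, h1, h2⟩ := h
    refine ⟨hne.symm, F, hF, ?_, ?_⟩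
    · rw [Sym2.eq_swap]; exact h2
    · rw [Sym2.eq_swap]; exact h1⟩
  loopless := ⟨fun _ h => h.1 rfl⟩

/-- Polygonal complexes in `E3`. -/
structure IsPolygonalComplex (K : CellData) : Prop where
  not_isDiag : ∀ e ∈ K.edges, ¬ e.IsDiag
  mem_verts : ∀ e ∈ K.edges, ∀ v ∈ e, v ∈ K.verts
  isPolygon : ∀ F ∈ K.faces, IsPolygon F
  mem_edges : ∀ F ∈ K.faces, F ⊆ K.edges
  connected : K.edgeGraph.Connected
  vertexFigure_connected : ∀ v ∈ K.verts, (K.vertexFigure v).Connected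
  faces_on_edge : ∃ r : ℕ, 2 ≤ r ∧ ∀ e ∈ K.edges, {F | F ∈ K.faces ∧ e ∈ F}.encard = r
  discrete : ∀ C : Set E3, IsCompact C →
    {F | F ∈ K.faces ∧ (polygonBody F ∩ C).Nonempty}.Finite

/-- The image of a family of cells under a map of the ambient space. -/
def map (f : E3 → E3) (K : CellData) : CellData where
  verts := f '' K.verts
  edges := Sym2.map f '' K.edges
  faces := (fun F => Sym2.map f '' F) '' K.faces

theorem map_id (K : CellData) : K.map id = K := by
  ext <;> simp [map]

theorem map_map (f g : E3 → E3) (K : CellData) : (K.map f).map g = K.map (g ∘ f) := by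
  ext <;> simp [map, Sym2.map_map, image_image]

/-- The affine hull. -/
noncomputable def hull (K : CellData) : AffineSubspace ℝ E3 := affineSpan ℝ K.verts

open Classical in
/-- An isometry of the affine hull of `K`, as a permutation of `E3` (fixing all points outside the
hull), so that it can be applied to vertices, edges and faces of `K`. -/
noncomputable def hullAct (K : CellData) (g : K.hull ≃ᵢ K.hull) : Equiv.Perm E3 :=
  Equiv.Perm.ofSubtype (p := fun x => x ∈ K.hull) g.toEquiv

open Classical in
theorem hullAct_one (K : CellData) : K.hullAct 1 = 1 :=
  map_one (Equiv.Perm.ofSubtype (p := fun x => x ∈ K.hull))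

open Classical in
theorem hullAct_mul (K : CellData) (g h : K.hull ≃ᵢ K.hull) :
    K.hullAct (g * h) = K.hullAct g * K.hullAct h :=
  map_mul (Equiv.Perm.ofSubtype (p := fun x => x ∈ K.hull)) g.toEquiv h.toEquiv

/-- The symmetry group `G(K)`: all isometries of the affine hull of `K` that map `K` to itself. -/
def symmetryGroup (K : CellData) : Subgroup (K.hull ≃ᵢ K.hull) where
  carrier := {g | K.map (K.hullAct g) = K}
  one_mem' := by
    change K.map (K.hullAct 1) = K
    rw [hullAct_one]
    exact K.map_id
  mul_mem' := by
    intro g h hg hh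
    change K.map (K.hullAct (g * h)) = K
    rw [hullAct_mul, Equiv.Perm.coe_mul, ← map_map]
    change K.map (K.hullAct g) = K at hg
    change K.map (K.hullAct h) = K at hh
    rw [hh, hg]
  inv_mem' := by
    intro g hg
    change K.map (K.hullAct g⁻¹) = K
    change K.map (K.hullAct g) = K at hg
    have h1 : K.hullAct g⁻¹ * K.hullAct g = 1 := by
      rw [← hullAct_mul, inv_mul_cancel, hullAct_one]
    have h2 : (K.map (K.hullAct g)).map (K.hullAct g⁻¹) = K := by
      rw [map_map, ← Equiv.Perm.coe_mul, h1]
      exact K.map_id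
    rwa [hg] at h2

/-- A triple of a vertex, an edge and a face. -/
@[ext]
structure Triple where
  vert : E3
  edge : Sym2 E3
  face : Set (Sym2 E3)

/-- The image of a triple under a map of the ambient space. -/
def Triple.map (f : E3 → E3) (Φ : Triple) : Triple :=
  ⟨f Φ.vert, Sym2.map f Φ.edge, Sym2.map f '' Φ.face⟩

/-- A flag: a vertex, an edge and a face of `K`, mutually incident. -/
structure IsFlag (K : CellData) (Φ : Triple) : Prop where
  vert_mem : Φ.vert ∈ K.verts
  edge_mem : Φ.edge ∈ K.edges
  face_mem : Φ.face ∈ K.faces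
  vert_edge : Φ.vert ∈ Φ.edge
  edge_face : Φ.edge ∈ Φ.face

/-- A regular polygonal complex: the symmetry group is transitive on the flags. -/
def IsRegularComplex (K : CellData) : Prop :=
  K.IsPolygonalComplex ∧ ∀ Φ Ψ : Triple, K.IsFlag Φ → K.IsFlag Ψ →
    ∃ g ∈ K.symmetryGroup, Φ.map (K.hullAct g) = Ψ

/-- There is a flag whose stabilizer in `G(K)` is non-trivial. (If `K` is regular, all flag
stabilizers are conjugate in `G(K)`.) -/
def HasNontrivialFlagStabilizer (K : CellData) : Prop :=
  ∃ Φ : Triple, K.IsFlag Φ ∧ ∃ g ∈ K.symmetryGroup, g ≠ 1 ∧ Φ.map (K.hullAct g) = Φ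

/-- Similarity: some similarity transformation of `E3` maps `K` onto `L`. -/
def Similar (K L : CellData) : Prop := ∃ f : E3 ≃ᵈ E3, K.map f = L

end CellData

/-- A family of vertices, edges, 2-faces and facets (3-faces) in `E3`. Each face of positive rank
is recorded by the set of faces of the next lower rank that it contains, as in a faithful
realization of an abstract polytope, where a face is determined by these. Incidence is the
partial order generated by membership. -/
@[ext]
structure RankFourData where
  verts : Set E3
  edges : Set (Sym2 E3)
  faces : Set (Set (Sym2 E3))
  facets : Set (Set (Set (Sym2 E3)))

namespace RankFourData

/-- The image under a map of the ambient space. -/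
def map (f : E3 → E3) (P : RankFourData) : RankFourData where
  verts := f '' P.verts
  edges := Sym2.map f '' P.edges
  faces := (fun F => Sym2.map f '' F) '' P.faces
  facets := (fun C => (fun F => Sym2.map f '' F) '' C) '' P.facets

/-- A quadruple of a vertex, an edge, a 2-face and a facet. -/
@[ext]
structure Quad where
  vert : E3
  edge : Sym2 E3
  face : Set (Sym2 E3)
  facet : Set (Set (Sym2 E3))

namespace Quad

/-- The image under a map of the ambient space. -/
def map (f : E3 → E3) (Φ : Quad) : Quad :=
  ⟨f Φ.vert, Sym2.map f Φ.edge, Sym2.map f '' Φ.face,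
    (fun F => Sym2.map f '' F) '' Φ.facet⟩

/-- `Φ` and `Ψ` have the same element of rank `i`. -/
def Agree (Φ Ψ : Quad) (i : Fin 4) : Prop :=
  match i with
  | 0 => Φ.vert = Ψ.vert
  | 1 => Φ.edge = Ψ.edge
  | 2 => Φ.face = Ψ.face
  | 3 => Φ.facet = Ψ.facet

/-- `Φ` and `Ψ` differ precisely in their element of rank `i`. -/
def Adjacent (i : Fin 4) (Φ Ψ : Quad) : Prop := ∀ j : Fin 4, Φ.Agree Ψ j ↔ j ≠ i

end Quad

/-- Flags, without the improper faces. -/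
structure IsFlag (P : RankFourData) (Φ : Quad) : Prop where
  vert_mem : Φ.vert ∈ P.verts
  edge_mem : Φ.edge ∈ P.edges
  face_mem : Φ.face ∈ P.faces
  facet_mem : Φ.facet ∈ P.facets
  vert_edge : Φ.vert ∈ Φ.edge
  edge_face : Φ.edge ∈ Φ.face
  face_facet : Φ.face ∈ Φ.facet

/-- The axioms of an abstract polytope of rank 4: every maximal chain has a face of each rank,
the diamond condition holds (for every flag and every rank `i` there is exactly one `i`-adjacent
flag), and the poset is strongly flag-connected (any two flags are joined by a sequence of
successively adjacent flags, all of which contain the faces common to the two). -/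
structure IsPolytope (P : RankFourData) : Prop where
  not_isDiag : ∀ e ∈ P.edges, ¬ e.IsDiag
  edge_below : ∀ e ∈ P.edges, ∀ v ∈ e, v ∈ P.verts
  face_below : ∀ F ∈ P.faces, F.Nonempty ∧ F ⊆ P.edges
  facet_below : ∀ C ∈ P.facets, C.Nonempty ∧ C ⊆ P.faces
  vert_above : ∀ v ∈ P.verts, ∃ e ∈ P.edges, v ∈ e
  edge_above : ∀ e ∈ P.edges, ∃ F ∈ P.faces, e ∈ F
  face_above : ∀ F ∈ P.faces, ∃ C ∈ P.facets, F ∈ C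
  diamond : ∀ Φ : Quad, P.IsFlag Φ → ∀ i : Fin 4, ∃! Ψ : Quad, P.IsFlag Ψ ∧ Φ.Adjacent i Ψ
  strongly_flag_connected : ∀ Φ Ψ : Quad, P.IsFlag Φ → P.IsFlag Ψ →
    Relation.ReflTransGen
      (fun A B : Quad => P.IsFlag B ∧ (∃ i, A.Adjacent i B) ∧ ∀ j, Φ.Agree Ψ j → Φ.Agree B j) Φ Ψ

/-- `g` is a symmetry of `P`. -/
def IsSymmetry (P : RankFourData) (g : E3 ≃ᵢ E3) : Prop := P.map g = P

/-- Regular 4-apeirotopes in `E3`: infinite, discrete, faithfully realized polytopes of rank 4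
whose group of symmetries is transitive on the flags. -/
structure IsRegularApeirotope (P : RankFourData) : Prop where
  isPolytope : P.IsPolytope
  infinite : P.verts.Infinite
  discrete : ∀ C : Set E3, IsCompact C → (P.verts ∩ C).Finite
  flag_transitive : ∀ Φ Ψ : Quad, P.IsFlag Φ → P.IsFlag Ψ →
    ∃ g : E3 ≃ᵢ E3, P.IsSymmetry g ∧ Φ.map g = Ψ

/-- `T 0, …, T 3` are the distinguished generators of the symmetry group of `P` with respect to
the base flag `Φ`: the symmetry `T i` maps `Φ` to the `i`-adjacent flag. -/
def IsDistinguished (P : RankFourData) (Φ : Quad) (T : Fin 4 → (E3 ≃ᵢ E3)) : Prop :=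
  P.IsFlag Φ ∧ ∀ i, P.IsSymmetry (T i) ∧ Φ.Adjacent i (Φ.map (T i))

/-- The regular apeirotope `Q` is the Petrie dual of the regular apeirotope `P`: for suitable base
flags with the same base vertex, the distinguished generators of `Q` arise from those of `P` by
the Petrie operation `(T₀, T₁, T₂, T₃) ↦ (T₀, T₁T₃, T₂, T₃)`. -/
def IsPetrieDual (P Q : RankFourData) : Prop :=
  ∃ (Φ Ψ : Quad) (T : Fin 4 → (E3 ≃ᵢ E3)), P.IsDistinguished Φ T ∧
    Q.IsDistinguished Ψ ![T 0, T 1 * T 3, T 2, T 3] ∧ Φ.vert = Ψ.vert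

/-- The 2-skeleton. -/
def twoSkeleton (P : RankFourData) : CellData := ⟨P.verts, P.edges, P.faces⟩

end RankFourData

/-! Classification. A flag (vertex `v`, edge `vu`, face `F`) is the same as a corner: `F` with `v`
and its neighbours `u`, `w` in `F`. A symmetry fixing a flag fixes `v`, `u`, `w`. If corners were
straight the complex would lie on a line, and if it were planar it would lie in the plane of a
corner; either way such a symmetry would be trivial. So the complex spans space, and the stabilizer
of a corner contains the reflection in its plane. Consequently every linear isometry that matches
two corners is the linear part of a symmetry (`IsMirrored.map_moveIso`). The mirror fixes the face
pointwise, so faces are planar, and comparing the corners at the two ends of an edge leaves two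
cases (`IsMirrored.flip_cases`): either the inversions in the midpoints of edges are symmetries
(zigzag case), or the reflections in the perpendicular bisectors of edges are (convex case).

Next, there is a non-trivial translation. In the zigzag case it is a product of two inversions. In
the convex case the vertex set is relatively dense and uniformly separated; two distinct bisectors
with almost parallel normals are found by compactness, and their product is a translation, because a
rotation through such a small angle would move some vertex by less than the separation. The mirrors
at a vertex meet only in that vertex, so the translations span space and form a lattice
(`IsMirrored.span_periods`). Linear parts of symmetries have integral trace, which makes `4 cos²` of
the angle between two reflection roots an integer (`IsMirrored.four_cos_sq`).

For adjacent edge vectors `a`, `b` and a further `b'` adjacent to `a` off their plane, the roots are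
the normal of the plane, `a - b` and `b - b'`. The restriction leaves only the cosines 0, 1/3, -1/3
between `a` and `b` (`IsMirrored.angle_cases`), so that the edges at a vertex point to the vertices
of an octahedron, a cube or a tetrahedron. In the convex case the edge vectors are themselves roots
and only 0 survives. The edges at one vertex together with the flips determine the complex
(`Pattern.eq_complex`), which gives four possibilities.

Existence. On the integer lattice join `x` to `x + s x * d`, where `d` runs through the vertices of
one of these solids and `s` is a homomorphism to sign vectors. The rule `s = ±(1,1,1)` yields
zigzags, and `s x i = (-1) ^ x i` yields squares. The maps `x ↦ t + s t * x` move the base vertex,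
and signed permutations act at the origin. To obtain facets, choose polygons on the star: either the
faces of the solid or its Petrie polygons. Both families form polyhedra with the same vertices and
edges, so both apeirotopes have the same 2-skeleton, and the Petrie relation of the solids becomes
the Petrie relation in rank 4. The generator `T₃` fixes vertex, edge and 2-face, so the flag
stabilizers are non-trivial. The degrees 4, 6, 8 and the finiteness of faces tell the four complexes
apart. -/

open scoped InnerProductSpace

/-- The integer lattice points. -/
abbrev Z3 : Type := Fin 3 → ℤ

theorem reflTransGen_map {α β : Type*} {r : α → α → Prop} {q : β → β → Prop} (f : α → β)
    (h : ∀ a b, r a b → q (f a) (f b)) {a b : α} (hab : Relation.ReflTransGen r a b) :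
    Relation.ReflTransGen q (f a) (f b) := by
  induction hab with
  | refl => exact Relation.ReflTransGen.refl
  | tail _ hbc ih => exact ih.tail (h _ _ hbc)

/-! ### Sign-twisted lattice graphs and their complexes -/

/-- A coloured graph on the integer lattice points: the neighbour of `x` along the colour `a` is
`x + s x * dir a`, where `s x` is a vector of signs. The relation `X` tells which pairs of colours
bound the faces. -/
structure Pattern (n : ℕ) where
  s : Z3 → Z3
  dir : Fin n → Z3
  X : Fin n → Fin n → Bool
  s_add : ∀ x y, s (x + y) = s x * s y
  s_sq : ∀ x, s x * s x = 1
  s_twist : ∀ x y, s (s x * y) = s y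
  s_dir : ∀ a, s (dir a) * dir a = - dir a
  dir_ne_zero : ∀ a, dir a ≠ 0
  dir_inj : Function.Injective dir
  X_symm : ∀ a b, X a b → X b a
  X_irrefl : ∀ a, X a a = false
  base : Fin n
  X_exists : ∀ a, ∃ b, X a b
  X_conn : ∀ a b, Relation.ReflTransGen (fun c d => X c d = true) a b

namespace Pattern

variable {n : ℕ} (P : Pattern n)

/-- The neighbour along a colour. -/
def step (x : Z3) (a : Fin n) : Z3 := x + P.s x * P.dir a

theorem s_zero : P.s 0 = 1 := by
  have h := P.s_add 0 0
  rw [P.s_sq, add_zero] at h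
  exact h

theorem s_mul_cancel (x y : Z3) : P.s x * (P.s x * y) = y := by
  rw [← mul_assoc, P.s_sq, one_mul]

/-- By `s_twist` the twist of the direction is invisible to `s`, so the sign vector changes along an
edge by a factor that depends on the colour alone. -/
theorem s_step (x : Z3) (a : Fin n) : P.s (P.step x a) = P.s x * P.s (P.dir a) := by
  rw [step, P.s_add, P.s_twist]

/-- Crossing an edge of colour `a` reverses the direction `dir a`, by `s_dir`; the same colour
therefore leads back, and edges are undirected. -/
theorem step_step (x : Z3) (a : Fin n) : P.step (P.step x a) a = x := by
  rw [step, s_step, mul_assoc, P.s_dir, step]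
  simp

theorem step_inj {x : Z3} {a b : Fin n} (h : P.step x a = P.step x b) : a = b := by
  have h1 : P.s x * P.dir a = P.s x * P.dir b := add_left_cancel h
  have h2 := congrArg (fun z => P.s x * z) h1
  simp only [s_mul_cancel] at h2
  exact P.dir_inj h2

theorem step_ne (x : Z3) (a : Fin n) : P.step x a ≠ x := by
  intro h
  have h1 : P.s x * P.dir a = 0 := by simpa [step] using h
  have h2 := congrArg (fun z => P.s x * z) h1
  simp only [s_mul_cancel, mul_zero] at h2
  exact P.dir_ne_zero a h2

/-- Two lattice points are joined by a path whose colours lie in `S`. -/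
def Reach (S : Fin n → Prop) : Z3 → Z3 → Prop :=
  Relation.ReflTransGen fun y z => ∃ a, S a ∧ z = P.step y a

variable {P}

theorem Reach.refl {S : Fin n → Prop} {x : Z3} : P.Reach S x x := Relation.ReflTransGen.refl

theorem Reach.step {S : Fin n → Prop} {x y : Z3} (h : P.Reach S x y) {a : Fin n} (ha : S a) :
    P.Reach S x (P.step y a) := Relation.ReflTransGen.tail h ⟨a, ha, rfl⟩

theorem Reach.trans {S : Fin n → Prop} {x y z : Z3} (h : P.Reach S x y) (h' : P.Reach S y z) :
    P.Reach S x z := Relation.ReflTransGen.trans h h'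

theorem Reach.single {S : Fin n → Prop} {x : Z3} {a : Fin n} (ha : S a) :
    P.Reach S x (P.step x a) := Reach.refl.step ha

theorem Reach.symm {S : Fin n → Prop} {x y : Z3} (h : P.Reach S x y) : P.Reach S y x := by
  induction h with
  | refl => exact Reach.refl
  | @tail b _ _ h ih =>
    obtain ⟨a, ha, rfl⟩ := h
    refine Reach.trans ?_ ih
    have := Reach.single (P := P) (x := P.step b a) ha
    rwa [P.step_step] at this

theorem Reach.mono {S S' : Fin n → Prop} (hS : ∀ a, S a → S' a) {x y : Z3} (h : P.Reach S x y) :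
    P.Reach S' x y :=
  reflTransGen_map id (fun _ _ ⟨a, ha, e⟩ => ⟨a, hS a ha, e⟩) h

variable (P)

/-- The component of the origin. -/
def V (x : Z3) : Prop := P.Reach (fun _ => True) 0 x

/-- The pair of colours `a`, `b`. -/
def two (a b : Fin n) (c : Fin n) : Prop := c = a ∨ c = b

variable {P}

theorem V.zero : P.V 0 := Reach.refl

theorem V.reach {S : Fin n → Prop} {x y : Z3} (h : P.V x) (h' : P.Reach S x y) : P.V y :=
  Reach.trans h (h'.mono fun _ _ => trivial)

theorem V.step {x : Z3} (h : P.V x) (a : Fin n) : P.V (P.step x a) :=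
  Reach.step h (a := a) trivial

theorem two_swap {a b : Fin n} : two a b = two b a := by
  funext c; exact propext or_comm

variable (P)

/-- The edge of colour `a` at `x`. -/
def edgeAt (pos : Z3 → E3) (x : Z3) (a : Fin n) : Sym2 E3 := s(pos x, pos (P.step x a))

/-- The face with colours `a`, `b` at `x`. -/
def faceAt (pos : Z3 → E3) (x : Z3) (a b : Fin n) : Set (Sym2 E3) :=
  {e | ∃ y c, P.Reach (two a b) x y ∧ two a b c ∧ e = P.edgeAt pos y c}

/-- The realization of the component of the origin. -/
def complex (pos : Z3 → E3) : CellData where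
  verts := {v | ∃ x, P.V x ∧ v = pos x}
  edges := {e | ∃ x a, P.V x ∧ e = P.edgeAt pos x a}
  faces := {F | ∃ x a b, P.V x ∧ P.X a b ∧ F = P.faceAt pos x a b}

variable {P} {pos : Z3 → E3} (hpos : Function.Injective pos)

theorem X_ne {a b : Fin n} (h : P.X a b) : a ≠ b := by
  rintro rfl
  simp [P.X_irrefl] at h

theorem faceAt_swap (x : Z3) (a b : Fin n) : P.faceAt pos x a b = P.faceAt pos x b a := by
  simp only [faceAt, two_swap]

theorem edgeAt_step (x : Z3) (a : Fin n) : P.edgeAt pos (P.step x a) a = P.edgeAt pos x a := by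
  rw [edgeAt, edgeAt, P.step_step, Sym2.eq_swap]

theorem edgeAt_mem_faceAt_left (x : Z3) (a b : Fin n) : P.edgeAt pos x a ∈ P.faceAt pos x a b :=
  ⟨x, a, Reach.refl, Or.inl rfl, rfl⟩

theorem edgeAt_mem_faceAt_right (x : Z3) (a b : Fin n) : P.edgeAt pos x b ∈ P.faceAt pos x a b :=
  ⟨x, b, Reach.refl, Or.inr rfl, rfl⟩

theorem faceAt_reach {x y : Z3} {a b : Fin n} (h : P.Reach (two a b) x y) :
    P.faceAt pos x a b = P.faceAt pos y a b := by
  ext e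
  constructor
  · rintro ⟨z, c, hz, hc, rfl⟩
    exact ⟨z, c, h.symm.trans hz, hc, rfl⟩
  · rintro ⟨z, c, hz, hc, rfl⟩
    exact ⟨z, c, h.trans hz, hc, rfl⟩

include hpos in
theorem edgeAt_eq_iff {x y : Z3} {a b : Fin n} :
    P.edgeAt pos x a = P.edgeAt pos y b ↔ a = b ∧ (y = x ∨ y = P.step x a) := by
  constructor
  · intro h
    simp only [edgeAt, Sym2.eq_iff] at h
    rcases h with ⟨h1, h2⟩ | ⟨h1, h2⟩
    · have h1 := hpos h1
      subst h1
      exact ⟨P.step_inj (hpos h2), Or.inl rfl⟩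
    · have h1 := hpos h1
      have h2 := hpos h2
      have h3 : P.step x b = y := by rw [h1, P.step_step]
      have : a = b := P.step_inj (h2.trans h3.symm)
      exact ⟨this, Or.inr h2.symm⟩
  · rintro ⟨rfl, rfl | rfl⟩
    · rfl
    · exact (edgeAt_step x a).symm

include hpos in
theorem edgeAt_mem_faceAt_iff {x y : Z3} {a b c : Fin n} :
    P.edgeAt pos y c ∈ P.faceAt pos x a b ↔ two a b c ∧ P.Reach (two a b) x y := by
  constructor
  · rintro ⟨z, d, hz, hd, he⟩
    obtain ⟨rfl, rfl | rfl⟩ := (edgeAt_eq_iff hpos).1 he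
    · exact ⟨hd, hz⟩
    · refine ⟨hd, ?_⟩
      have := hz.step hd
      rwa [P.step_step] at this
  · rintro ⟨hc, h⟩
    exact ⟨y, c, h, hc, rfl⟩

include hpos in
-- An edge remembers its colour and its end points. The two edges at `x` that belong to the face
-- thus recover the pair of colours and the component that is walked through.
theorem faceAt_eq_iff {x y : Z3} {a b c d : Fin n} (hab : a ≠ b) :
    P.faceAt pos x a b = P.faceAt pos y c d ↔
      ((a = c ∧ b = d) ∨ (a = d ∧ b = c)) ∧ P.Reach (two a b) x y := by
  constructor
  · intro h
    have h1 := edgeAt_mem_faceAt_left (P := P) (pos := pos) x a b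
    have h2 := edgeAt_mem_faceAt_right (P := P) (pos := pos) x a b
    rw [h, edgeAt_mem_faceAt_iff hpos] at h1 h2
    have hc : (a = c ∧ b = d) ∨ (a = d ∧ b = c) := by
      rcases h1.1 with e1 | e1 <;> rcases h2.1 with e2 | e2
      · exact absurd (e1.trans e2.symm) hab
      · exact Or.inl ⟨e1, e2⟩
      · exact Or.inr ⟨e1, e2⟩
      · exact absurd (e1.trans e2.symm) hab
    refine ⟨hc, ?_⟩
    have h3 := h1.2.symm
    rcases hc with ⟨rfl, rfl⟩ | ⟨rfl, rfl⟩
    · exact h3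
    · rwa [two_swap]
  · rintro ⟨⟨rfl, rfl⟩ | ⟨rfl, rfl⟩, h⟩
    · exact faceAt_reach h
    · rw [faceAt_swap y]
      exact faceAt_reach h

include hpos in
theorem mem_edgeAt_iff {x y : Z3} {a : Fin n} :
    pos x ∈ P.edgeAt pos y a ↔ x = y ∨ x = P.step y a := by
  simp [edgeAt, hpos.eq_iff]

end Pattern

/-! ### Polygons on the colours: facets and flags of rank 4 -/

/-- A pattern together with a family of polygons, each given by the pairs of consecutive colours,
which form a polyhedron on the set of colours. -/
structure PolyPattern (n m : ℕ) extends Pattern n where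
  adj : Fin m → Fin n → Fin n → Bool
  adj_X : ∀ p a b, adj p a b → X a b
  adj_symm : ∀ p a b, adj p a b → adj p b a
  adj_inj : ∀ p q, adj p = adj q → p = q
  adj_nonempty : ∀ p, ∃ a b, adj p a b
  other_edge : ∀ p a b, adj p a b → ∃ c, c ≠ b ∧ adj p a c ∧ ∀ d, adj p a d → d = b ∨ d = c
  X_adj : ∀ a b, X a b → ∃ p q, p ≠ q ∧ adj p a b ∧ adj q a b ∧ ∀ r, adj r a b → r = p ∨ r = q
  conn_polygon : ∀ p a b c d, adj p a b → adj p c d →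
    Relation.ReflTransGen (fun u v => adj p u v = true) a c
  conn_colour : ∀ a b c, X a b → X a c →
    Relation.ReflTransGen (fun u v => ∃ p, adj p a u ∧ adj p a v) b c

namespace PolyPattern

open Pattern

variable {n m : ℕ} (P : PolyPattern n m)

/-- The colours of a polygon. -/
def colours (p : Fin m) (a : Fin n) : Prop := ∃ b, P.adj p a b

/-- The facet with polygon `p` at `x`. -/
def facetAt (pos : Z3 → E3) (x : Z3) (p : Fin m) : Set (Set (Sym2 E3)) :=
  {F | ∃ y a b, P.Reach (P.colours p) x y ∧ P.adj p a b ∧ F = P.faceAt pos y a b}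

/-- The realization of rank 4. -/
def apeirotope (pos : Z3 → E3) : RankFourData where
  verts := (P.complex pos).verts
  edges := (P.complex pos).edges
  faces := (P.complex pos).faces
  facets := {C | ∃ x p, P.V x ∧ C = P.facetAt pos x p}

/-- The flag at `x` with edge of colour `a`, face with colours `a`, `b` and polygon `p`. -/
def flagAt (pos : Z3 → E3) (x : Z3) (a b : Fin n) (p : Fin m) : RankFourData.Quad :=
  ⟨pos x, P.edgeAt pos x a, P.faceAt pos x a b, P.facetAt pos x p⟩

variable {P} {pos : Z3 → E3}

theorem two_colours {p : Fin m} {a b : Fin n} (h : P.adj p a b) (c : Fin n) (hc : two a b c) :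
    P.colours p c := by
  rcases hc with rfl | rfl
  · exact ⟨b, h⟩
  · exact ⟨a, P.adj_symm _ _ _ h⟩

theorem facetAt_reach {x y : Z3} {p : Fin m} (h : P.Reach (P.colours p) x y) :
    P.facetAt pos x p = P.facetAt pos y p := by
  ext e
  constructor
  · rintro ⟨z, a, b, hz, hc, rfl⟩
    exact ⟨z, a, b, h.symm.trans hz, hc, rfl⟩
  · rintro ⟨z, a, b, hz, hc, rfl⟩
    exact ⟨z, a, b, h.trans hz, hc, rfl⟩

theorem flag_isFlag {x : Z3} {a b : Fin n} {p : Fin m} (hx : P.V x) (h : P.adj p a b) :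
    (P.apeirotope pos).IsFlag (P.flagAt pos x a b p) where
  vert_mem := ⟨x, hx, rfl⟩
  edge_mem := ⟨x, a, hx, rfl⟩
  face_mem := ⟨x, a, b, hx, P.adj_X _ _ _ h, rfl⟩
  facet_mem := ⟨x, p, hx, rfl⟩
  vert_edge := by simp [flagAt, edgeAt]
  edge_face := edgeAt_mem_faceAt_left _ _ _
  face_facet := ⟨x, a, b, Reach.refl, h, rfl⟩

variable (hpos : Function.Injective pos)

include hpos in
theorem faceAt_mem_facetAt_iff {x y : Z3} {p : Fin m} {a b : Fin n} (hab : a ≠ b) :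
    P.faceAt pos y a b ∈ P.facetAt pos x p ↔ P.adj p a b ∧ P.Reach (P.colours p) x y := by
  constructor
  · rintro ⟨z, c, d, hz, hcd, he⟩
    obtain ⟨h1, h2⟩ := (faceAt_eq_iff hpos hab).1 he
    have hab' : P.adj p a b := by
      rcases h1 with ⟨rfl, rfl⟩ | ⟨rfl, rfl⟩
      · exact hcd
      · exact P.adj_symm _ _ _ hcd
    exact ⟨hab', hz.trans (h2.mono (two_colours hab')).symm⟩
  · rintro ⟨h, hr⟩
    exact ⟨y, a, b, hr, h, rfl⟩

include hpos in
theorem facetAt_eq_iff {x y : Z3} {p q : Fin m} :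
    P.facetAt pos x p = P.facetAt pos y q ↔ p = q ∧ P.Reach (P.colours p) x y := by
  constructor
  · intro h
    have key : ∀ (x y : Z3) (p q : Fin m), P.facetAt pos x p = P.facetAt pos y q →
        ∀ a b, P.adj p a b → P.adj q a b ∧ P.Reach (P.colours q) y x := by
      intro x y p q h a b hab
      have h1 : P.faceAt pos x a b ∈ P.facetAt pos x p := ⟨x, a, b, Reach.refl, hab, rfl⟩
      rwa [h, faceAt_mem_facetAt_iff hpos (X_ne (P.adj_X _ _ _ hab))] at h1
    have hpq : p = q := by
      apply P.adj_inj
      funext a b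
      rw [Bool.eq_iff_iff]
      exact ⟨fun h' => (key _ _ _ _ h a b h').1, fun h' => (key _ _ _ _ h.symm a b h').1⟩
    subst hpq
    obtain ⟨a, b, hab⟩ := P.adj_nonempty p
    exact ⟨rfl, (key _ _ _ _ h a b hab).2.symm⟩
  · rintro ⟨rfl, h⟩
    exact facetAt_reach h

include hpos in
-- Incidence allows every element of a flag to be rebased at its vertex. Flags are therefore pairs
-- of a lattice point and a flag of the polyhedron on the colours.
theorem isFlag_iff {Φ : RankFourData.Quad} : (P.apeirotope pos).IsFlag Φ ↔
    ∃ x a b p, P.V x ∧ P.adj p a b ∧ Φ = P.flagAt pos x a b p := by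
  constructor
  · rintro ⟨⟨x, hx, h0⟩, ⟨z, a, hz, h1⟩, ⟨y, c, d, hy, hcd, h2⟩, ⟨w, p, hw, h3⟩, h01, h12, h23⟩
    rw [h0, h1, mem_edgeAt_iff hpos] at h01
    have h1' : Φ.edge = P.edgeAt pos x a := by
      rw [h1, edgeAt_eq_iff hpos]
      refine ⟨rfl, ?_⟩
      exact h01
    rw [h1', h2, edgeAt_mem_faceAt_iff hpos] at h12
    obtain ⟨hac, hyx⟩ := h12
    obtain ⟨b, hab, h2'⟩ : ∃ b, P.X a b ∧ Φ.face = P.faceAt pos x a b := by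
      rcases hac with rfl | rfl
      · exact ⟨d, hcd, h2.trans (faceAt_reach hyx)⟩
      · exact ⟨c, P.X_symm _ _ hcd, by rw [h2, faceAt_reach hyx, faceAt_swap]⟩
    rw [h2', h3, faceAt_mem_facetAt_iff hpos (X_ne hab)] at h23
    exact ⟨x, a, b, p, hx, h23.1, RankFourData.Quad.ext h0 h1' h2' (h3.trans (facetAt_reach h23.2))⟩
  · rintro ⟨x, a, b, p, hx, h, rfl⟩
    exact flag_isFlag hx h

include hpos in
theorem agree_iff {x y : Z3} {a b c d : Fin n} {p q : Fin m} (hab : P.adj p a b) (i : Fin 4) :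
    (P.flagAt pos x a b p).Agree (P.flagAt pos y c d q) i ↔
      match i with
      | 0 => x = y
      | 1 => a = c ∧ (y = x ∨ y = P.step x a)
      | 2 => ((a = c ∧ b = d) ∨ (a = d ∧ b = c)) ∧ P.Reach (two a b) x y
      | 3 => p = q ∧ P.Reach (P.colours p) x y := by
  match i with
  | 0 => exact hpos.eq_iff
  | 1 => exact edgeAt_eq_iff hpos
  | 2 => exact faceAt_eq_iff hpos (X_ne (P.adj_X _ _ _ hab))
  | 3 => exact facetAt_eq_iff hpos

include hpos in
/-- The adjacent flags. -/
theorem adjacent_iff {x y : Z3} {a b c d : Fin n} {p q : Fin m} (hab : P.adj p a b)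
    (hcd : P.adj q c d) (i : Fin 4) :
    (P.flagAt pos x a b p).Adjacent i (P.flagAt pos y c d q) ↔
      match i with
      | 0 => y = P.step x a ∧ c = a ∧ d = b ∧ q = p
      | 1 => y = x ∧ c = b ∧ d = a ∧ q = p
      | 2 => y = x ∧ c = a ∧ d ≠ b ∧ q = p
      | 3 => y = x ∧ c = a ∧ d = b ∧ q ≠ p := by
  have hne := X_ne (P.adj_X _ _ _ hab)
  have hne' := X_ne (P.adj_X _ _ _ hcd)
  have hall : (P.flagAt pos x a b p).Adjacent i (P.flagAt pos y c d q) ↔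
      ((x = y) ↔ (0 : Fin 4) ≠ i) ∧ ((a = c ∧ (y = x ∨ y = P.step x a)) ↔ (1 : Fin 4) ≠ i) ∧
      ((((a = c ∧ b = d) ∨ (a = d ∧ b = c)) ∧ P.Reach (two a b) x y) ↔ (2 : Fin 4) ≠ i) ∧
      ((p = q ∧ P.Reach (P.colours p) x y) ↔ (3 : Fin 4) ≠ i) := by
    constructor
    · intro h
      exact ⟨(agree_iff hpos hab 0).symm.trans (h 0), (agree_iff hpos hab 1).symm.trans (h 1),
        (agree_iff hpos hab 2).symm.trans (h 2), (agree_iff hpos hab 3).symm.trans (h 3)⟩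
    · rintro ⟨h0, h1, h2, h3⟩ j
      rw [agree_iff hpos hab]
      match j with
      | 0 => exact h0
      | 1 => exact h1
      | 2 => exact h2
      | 3 => exact h3
  rw [hall]
  have hs : x ≠ P.step x a := (P.step_ne x a).symm
  match i with
  | 0 =>
    simp only [ne_eq, not_true_eq_false, iff_false, Fin.reduceEq, not_false_eq_true, iff_true]
    constructor
    · rintro ⟨h0, ⟨rfl, h1⟩, ⟨h2, -⟩, ⟨rfl, -⟩⟩
      refine ⟨h1.resolve_left fun e => h0 e.symm, rfl, ?_, rfl⟩
      rcases h2 with ⟨-, h⟩ | ⟨-, h⟩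
      · exact h.symm
      · exact absurd h.symm hne
    · rintro ⟨rfl, rfl, rfl, rfl⟩
      exact ⟨hs, ⟨rfl, Or.inr rfl⟩, ⟨Or.inl ⟨rfl, rfl⟩, Reach.single (Or.inl rfl)⟩,
        rfl, Reach.single ⟨_, hab⟩⟩
  | 1 =>
    simp only [ne_eq, not_true_eq_false, iff_false, Fin.reduceEq, not_false_eq_true, iff_true]
    constructor
    · rintro ⟨rfl, h1, ⟨h2, -⟩, ⟨rfl, -⟩⟩
      rcases h2 with ⟨rfl, -⟩ | ⟨rfl, rfl⟩
      · exact absurd ⟨rfl, Or.inl rfl⟩ h1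
      · exact ⟨rfl, rfl, rfl, rfl⟩
    · rintro ⟨rfl, rfl, rfl, rfl⟩
      exact ⟨rfl, fun h => hne h.1, ⟨Or.inr ⟨rfl, rfl⟩, Reach.refl⟩, rfl, Reach.refl⟩
  | 2 =>
    simp only [ne_eq, not_true_eq_false, iff_false, Fin.reduceEq, not_false_eq_true, iff_true]
    constructor
    · rintro ⟨rfl, ⟨rfl, -⟩, h2, ⟨rfl, -⟩⟩
      exact ⟨rfl, rfl, fun e => h2 ⟨Or.inl ⟨rfl, e.symm⟩, Reach.refl⟩, rfl⟩
    · rintro ⟨rfl, rfl, hd, rfl⟩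
      refine ⟨rfl, ⟨rfl, Or.inl rfl⟩, ?_, rfl, Reach.refl⟩
      rintro ⟨⟨-, h⟩ | ⟨-, h⟩, -⟩
      · exact hd h.symm
      · exact hne h.symm
  | 3 =>
    simp only [ne_eq, not_true_eq_false, iff_false, Fin.reduceEq, not_false_eq_true, iff_true]
    constructor
    · rintro ⟨rfl, ⟨rfl, -⟩, ⟨h2, -⟩, h3⟩
      refine ⟨rfl, rfl, ?_, fun e => h3 ⟨e.symm, Reach.refl⟩⟩
      rcases h2 with ⟨-, h⟩ | ⟨-, h⟩
      · exact h.symm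
      · exact absurd h.symm hne
    · rintro ⟨rfl, rfl, rfl, hq⟩
      exact ⟨rfl, ⟨rfl, Or.inl rfl⟩, ⟨Or.inl ⟨rfl, rfl⟩, Reach.refl⟩, fun h => hq h.1.symm⟩

end PolyPattern

/-! ### Diamond condition and strong flag-connectedness -/

namespace PolyPattern

open Pattern

variable {n m : ℕ} {P : PolyPattern n m} {pos : Z3 → E3} (hpos : Function.Injective pos)

theorem other_polygon {p : Fin m} {a b : Fin n} (h : P.adj p a b) :
    ∃ q, q ≠ p ∧ P.adj q a b ∧ ∀ r, P.adj r a b → r = p ∨ r = q := by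
  obtain ⟨u, v, huv, hu, hv, hall⟩ := P.X_adj a b (P.adj_X _ _ _ h)
  rcases hall p h with rfl | rfl
  · exact ⟨v, huv.symm, hv, hall⟩
  · exact ⟨u, huv, hu, fun r hr => (hall r hr).symm⟩

include hpos in
-- In rank 0 the edge is crossed, in rank 1 the two colours are swapped; ranks 2 and 3 are the
-- diamond condition of the polyhedron on the colours (`other_edge`, `other_polygon`).
theorem diamond {x : Z3} {a b : Fin n} {p : Fin m} (hx : P.V x) (h : P.adj p a b) (i : Fin 4) :
    ∃! Ψ : RankFourData.Quad, (P.apeirotope pos).IsFlag Ψ ∧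
      (P.flagAt pos x a b p).Adjacent i Ψ := by
  have huniq : ∀ Ψ : RankFourData.Quad, (P.apeirotope pos).IsFlag Ψ ∧
      (P.flagAt pos x a b p).Adjacent i Ψ → ∃ y c d q, P.V y ∧ P.adj q c d ∧
        Ψ = P.flagAt pos y c d q ∧ (P.flagAt pos x a b p).Adjacent i (P.flagAt pos y c d q) := by
    rintro Ψ ⟨h1, h2⟩
    obtain ⟨y, c, d, q, hy, hcd, rfl⟩ := (isFlag_iff hpos).1 h1
    exact ⟨y, c, d, q, hy, hcd, rfl, h2⟩
  match i with
  | 0 =>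
    refine ⟨P.flagAt pos (P.step x a) a b p, ⟨flag_isFlag (hx.step a) h,
      (adjacent_iff hpos h h 0).2 ⟨rfl, rfl, rfl, rfl⟩⟩, fun Ψ hΨ => ?_⟩
    obtain ⟨y, c, d, q, hy, hcd, rfl, hadj⟩ := huniq Ψ hΨ
    obtain ⟨rfl, rfl, rfl, rfl⟩ := (adjacent_iff hpos h hcd 0).1 hadj
    rfl
  | 1 =>
    have h' := P.adj_symm _ _ _ h
    refine ⟨P.flagAt pos x b a p, ⟨flag_isFlag hx h',
      (adjacent_iff hpos h h' 1).2 ⟨rfl, rfl, rfl, rfl⟩⟩, fun Ψ hΨ => ?_⟩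
    obtain ⟨y, c, d, q, hy, hcd, rfl, hadj⟩ := huniq Ψ hΨ
    obtain ⟨rfl, rfl, rfl, rfl⟩ := (adjacent_iff hpos h hcd 1).1 hadj
    rfl
  | 2 =>
    obtain ⟨c, hcb, hc, hall⟩ := P.other_edge p a b h
    refine ⟨P.flagAt pos x a c p, ⟨flag_isFlag hx hc,
      (adjacent_iff hpos h hc 2).2 ⟨rfl, rfl, hcb, rfl⟩⟩, fun Ψ hΨ => ?_⟩
    obtain ⟨y, c', d, q, hy, hcd, rfl, hadj⟩ := huniq Ψ hΨ
    obtain ⟨rfl, rfl, hd, rfl⟩ := (adjacent_iff hpos h hcd 2).1 hadj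
    rw [(hall d hcd).resolve_left hd]
  | 3 =>
    obtain ⟨q, hqp, hq, hall⟩ := other_polygon h
    refine ⟨P.flagAt pos x a b q, ⟨flag_isFlag hx hq,
      (adjacent_iff hpos h hq 3).2 ⟨rfl, rfl, rfl, hqp⟩⟩, fun Ψ hΨ => ?_⟩
    obtain ⟨y, c', d, q', hy, hcd, rfl, hadj⟩ := huniq Ψ hΨ
    obtain ⟨rfl, rfl, rfl, hq'⟩ := (adjacent_iff hpos h hcd 3).1 hadj
    rw [(hall q' hcd).resolve_left hq']

/-- Local flags: a colour, a second colour and a polygon. -/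
abbrev LFlag (n m : ℕ) := Fin n × Fin n × Fin m

variable (P) in
/-- Adjacency of local flags, by one of the moves in `J`. -/
def Move (J : Fin 4 → Prop) (u v : LFlag n m) : Prop :=
  P.adj v.2.2 v.1 v.2.1 ∧
    ((J 1 ∧ v = (u.2.1, u.1, u.2.2)) ∨ (J 2 ∧ v.1 = u.1 ∧ v.2.1 ≠ u.2.1 ∧ v.2.2 = u.2.2) ∨
      (J 3 ∧ v.1 = u.1 ∧ v.2.1 = u.2.1 ∧ v.2.2 ≠ u.2.2))

theorem move_mono {J J' : Fin 4 → Prop} (h : ∀ i, J i → J' i) {u v : LFlag n m}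
    (huv : Relation.ReflTransGen (P.Move J) u v) : Relation.ReflTransGen (P.Move J') u v := by
  refine reflTransGen_map id ?_ huv
  rintro u v ⟨h1, h2 | h2 | h2⟩
  · exact ⟨h1, Or.inl ⟨h _ h2.1, h2.2⟩⟩
  · exact ⟨h1, Or.inr (Or.inl ⟨h _ h2.1, h2.2⟩)⟩
  · exact ⟨h1, Or.inr (Or.inr ⟨h _ h2.1, h2.2⟩)⟩

/-- Within one polygon it suffices to turn at a colour (move 2) and to pass on to the next colour
(move 1), along the path given by `conn_polygon`. -/
theorem moves_polygon {p : Fin m} {a b c d : Fin n} (h : P.adj p a b) (h' : P.adj p c d) :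
    Relation.ReflTransGen (P.Move fun i => i = 1 ∨ i = 2) (a, b, p) (c, d, p) := by
  have turn : ∀ u v w, P.adj p u v → P.adj p u w →
      Relation.ReflTransGen (P.Move fun i => i = 1 ∨ i = 2) (u, v, p) (u, w, p) := by
    intro u v w hv hw
    by_cases e : w = v
    · rw [e]
    · exact Relation.ReflTransGen.single ⟨hw, Or.inr (Or.inl ⟨Or.inr rfl, rfl, e, rfl⟩)⟩
  have key : ∀ c, Relation.ReflTransGen (fun u v => P.adj p u v = true) a c → ∃ d, P.adj p c d ∧
      Relation.ReflTransGen (P.Move fun i => i = 1 ∨ i = 2) (a, b, p) (c, d, p) := by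
    intro c hc
    induction hc with
    | refl => exact ⟨b, h, Relation.ReflTransGen.refl⟩
    | @tail u v _ huv ih =>
      obtain ⟨d, hd, hr⟩ := ih
      have hvu := P.adj_symm _ _ _ huv
      exact ⟨u, hvu, (hr.trans (turn _ _ _ hd huv)).tail ⟨hvu, Or.inl ⟨Or.inl rfl, rfl⟩⟩⟩
  obtain ⟨e, he, hr⟩ := key c (P.conn_polygon p a b c d h h')
  exact hr.trans (turn _ _ _ he h')

/-- Around a fixed colour one changes the polygon (move 3) and then the second colour (move 2);
`conn_colour` is the connectedness of the vertex-figure of the polyhedron. -/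
theorem moves_colour {p q : Fin m} {a b c : Fin n} (h : P.adj p a b) (h' : P.adj q a c) :
    Relation.ReflTransGen (P.Move fun i => i = 2 ∨ i = 3) (a, b, p) (a, c, q) := by
  have turn : ∀ u p q, P.adj p a u → P.adj q a u →
      Relation.ReflTransGen (P.Move fun i => i = 2 ∨ i = 3) (a, u, p) (a, u, q) := by
    intro u p q hp hq
    by_cases e : q = p
    · rw [e]
    · exact Relation.ReflTransGen.single ⟨hq, Or.inr (Or.inr ⟨Or.inr rfl, rfl, rfl, e⟩)⟩
  have key : ∀ c, Relation.ReflTransGen (fun u v => ∃ p, P.adj p a u ∧ P.adj p a v) b c →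
      ∃ q, P.adj q a c ∧
      Relation.ReflTransGen (P.Move fun i => i = 2 ∨ i = 3) (a, b, p) (a, c, q) := by
    intro c hc
    induction hc with
    | refl => exact ⟨p, h, Relation.ReflTransGen.refl⟩
    | @tail u v _ huv ih =>
      obtain ⟨q, hq, hr⟩ := ih
      obtain ⟨p', hu, hv⟩ := huv
      refine ⟨p', hv, (hr.trans (turn _ _ _ hq hu)).trans ?_⟩
      by_cases e : v = u
      · rw [e]
      · exact Relation.ReflTransGen.single ⟨hv, Or.inr (Or.inl ⟨Or.inl rfl, rfl, e, rfl⟩)⟩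
  obtain ⟨q', hq', hr⟩ := key c (P.conn_colour a b c (P.adj_X _ _ _ h) (P.adj_X _ _ _ h'))
  exact hr.trans (turn _ _ _ hq' h')

/-- Follow a path of adjacent colours: rotate about each colour until the next one is the second
colour, then swap the two. -/
theorem moves_all {p q : Fin m} {a b c d : Fin n} (h : P.adj p a b) (h' : P.adj q c d) :
    Relation.ReflTransGen (P.Move fun _ => True) (a, b, p) (c, d, q) := by
  have key : ∀ c, Relation.ReflTransGen (fun c d => P.X c d = true) a c → ∃ d q, P.adj q c d ∧
      Relation.ReflTransGen (P.Move fun _ => True) (a, b, p) (c, d, q) := by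
    intro c hc
    induction hc with
    | refl => exact ⟨b, p, h, Relation.ReflTransGen.refl⟩
    | @tail u v _ huv ih =>
      obtain ⟨d, q, hq, hr⟩ := ih
      obtain ⟨p', -, -, hp', -⟩ := P.X_adj u v huv
      refine ⟨u, p', P.adj_symm _ _ _ hp', (hr.trans
        (move_mono (fun _ _ => trivial) (moves_colour hq hp'))).tail ?_⟩
      exact ⟨P.adj_symm _ _ _ hp', Or.inl ⟨trivial, rfl⟩⟩
  obtain ⟨d', q', hq', hr⟩ := key c (P.X_conn a c)
  exact hr.trans (move_mono (fun _ _ => trivial) (moves_colour hq' h'))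

/-- Local flags agree in some element. -/
def LAgree (u v : LFlag n m) (i : Fin 4) : Prop :=
  match i with
  | 0 => True
  | 1 => u.1 = v.1
  | 2 => (u.1 = v.1 ∧ u.2.1 = v.2.1) ∨ (u.1 = v.2.1 ∧ u.2.1 = v.1)
  | 3 => u.2.2 = v.2.2

/-- Strong connectedness of the local flags. -/
theorem moves_strong {u v : LFlag n m} (hu : P.adj u.2.2 u.1 u.2.1) (hv : P.adj v.2.2 v.1 v.2.1) :
    Relation.ReflTransGen (P.Move fun i => ¬ LAgree u v i) u v := by
  obtain ⟨a, b, p⟩ := u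
  obtain ⟨c, d, q⟩ := v
  simp only at hu hv
  have hne := X_ne (P.adj_X _ _ _ hu)
  by_cases h1 : a = c
  · subst h1
    by_cases h2 : b = d
    · subst h2
      by_cases h3 : p = q
      · subst h3; exact Relation.ReflTransGen.refl
      · refine Relation.ReflTransGen.single ⟨hv, Or.inr (Or.inr ⟨?_, rfl, rfl, fun e => h3 e.symm⟩)⟩
        simpa [LAgree] using h3
    · by_cases h3 : p = q
      · subst h3
        refine Relation.ReflTransGen.single
          ⟨hv, Or.inr (Or.inl ⟨?_, rfl, fun e => h2 e.symm, rfl⟩)⟩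
        simp only [LAgree]
        rintro (h | h)
        · exact h2 h.2
        · exact hne h.2.symm
      · refine move_mono ?_ (moves_colour hu hv)
        rintro i (rfl | rfl)
        · simp only [LAgree]
          rintro (h | h)
          · exact h2 h.2
          · exact hne h.2.symm
        · simpa [LAgree] using h3
  · have hJ1 : ¬ LAgree (a, b, p) (c, d, q) 1 := by simpa [LAgree] using h1
    by_cases h2 : a = d ∧ b = c
    · obtain ⟨rfl, rfl⟩ := h2
      have hsw := P.adj_symm _ _ _ hu
      refine Relation.ReflTransGen.head (b := (b, a, p)) ⟨hsw, Or.inl ⟨hJ1, rfl⟩⟩ ?_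
      by_cases h3 : p = q
      · subst h3; exact Relation.ReflTransGen.refl
      · refine Relation.ReflTransGen.single ⟨hv, Or.inr (Or.inr ⟨?_, rfl, rfl, fun e => h3 e.symm⟩)⟩
        simpa [LAgree] using h3
    · have hJ2 : ¬ LAgree (a, b, p) (c, d, q) 2 := by
        simp only [LAgree]
        rintro (h | h)
        · exact h1 h.1
        · exact h2 h
      by_cases h3 : p = q
      · subst h3
        refine move_mono ?_ (moves_polygon hu hv)
        rintro i (rfl | rfl)
        · exact hJ1
        · exact hJ2
      · have key : ∀ i, i ≠ 0 → ¬ LAgree (a, b, p) (c, d, q) i := by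
          intro i hi
          match i with
          | 0 => exact absurd rfl hi
          | 1 => exact hJ1
          | 2 => exact hJ2
          | 3 => simpa [LAgree] using h3
        refine reflTransGen_map id ?_ (moves_all hu hv)
        rintro u v ⟨h1, h2 | h2 | h2⟩
        · exact ⟨h1, Or.inl ⟨key _ (by decide), h2.2⟩⟩
        · exact ⟨h1, Or.inr (Or.inl ⟨key _ (by decide), h2.2⟩)⟩
        · exact ⟨h1, Or.inr (Or.inr ⟨key _ (by decide), h2.2⟩)⟩

/-- The step relation of strong flag-connectedness. -/
abbrev FlagStep (P : PolyPattern n m) (pos : Z3 → E3) (Φ Ψ A B : RankFourData.Quad) : Prop :=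
  (P.apeirotope pos).IsFlag B ∧ (∃ i, A.Adjacent i B) ∧ ∀ j, Φ.Agree Ψ j → Φ.Agree B j

theorem agree_trans {Φ Ψ Ω : RankFourData.Quad} {j : Fin 4} (h : Φ.Agree Ψ j)
    (h' : Ψ.Agree Ω j) : Φ.Agree Ω j := by
  match j with
  | 0 => exact Eq.trans h h'
  | 1 => exact Eq.trans h h'
  | 2 => exact Eq.trans h h'
  | 3 => exact Eq.trans h h'

theorem agree_of_adjacent {Φ Ψ : RankFourData.Quad} {i j : Fin 4} (h : Φ.Adjacent i Ψ)
    (hij : j ≠ i) : Φ.Agree Ψ j := (h j).2 hij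

include hpos in
theorem adjacent_of_move {J : Fin 4 → Prop} {x : Z3} {u v : LFlag n m}
    (hu : P.adj u.2.2 u.1 u.2.1) (h : P.Move J u v) : ∃ i, J i ∧
      (P.flagAt pos x u.1 u.2.1 u.2.2).Adjacent i (P.flagAt pos x v.1 v.2.1 v.2.2) := by
  obtain ⟨hv, ⟨hJ, h⟩ | ⟨hJ, h⟩ | ⟨hJ, h⟩⟩ := h
  · subst h
    exact ⟨1, hJ, (adjacent_iff hpos hu hv 1).2 ⟨rfl, rfl, rfl, rfl⟩⟩
  · exact ⟨2, hJ, (adjacent_iff hpos hu hv 2).2 ⟨rfl, h⟩⟩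
  · exact ⟨3, hJ, (adjacent_iff hpos hu hv 3).2 ⟨rfl, h⟩⟩

include hpos in
/-- A sequence of local moves gives a sequence of flags at a vertex. -/
theorem flagSteps_of_moves {Φ Ψ : RankFourData.Quad} {J : Fin 4 → Prop} {x : Z3} (hx : P.V x)
    {u v : LFlag n m} (hu : P.adj u.2.2 u.1 u.2.1) (hJ : ∀ j, Φ.Agree Ψ j → ¬ J j)
    (h0 : ∀ j, Φ.Agree Ψ j → Φ.Agree (P.flagAt pos x u.1 u.2.1 u.2.2) j)
    (h : Relation.ReflTransGen (P.Move J) u v) :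
    P.adj v.2.2 v.1 v.2.1 ∧ (∀ j, Φ.Agree Ψ j → Φ.Agree (P.flagAt pos x v.1 v.2.1 v.2.2) j) ∧
    Relation.ReflTransGen (FlagStep P pos Φ Ψ)
      (P.flagAt pos x u.1 u.2.1 u.2.2) (P.flagAt pos x v.1 v.2.1 v.2.2) := by
  induction h with
  | refl => exact ⟨hu, h0, Relation.ReflTransGen.refl⟩
  | @tail w v _ hwv ih =>
    obtain ⟨hw, h1, hr⟩ := ih
    obtain ⟨i, hi, hadj⟩ := adjacent_of_move (x := x) hpos hw hwv
    have h2 : ∀ j, Φ.Agree Ψ j → Φ.Agree (P.flagAt pos x v.1 v.2.1 v.2.2) j := by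
      intro j hj
      refine agree_trans (h1 j hj) (agree_of_adjacent hadj ?_)
      rintro rfl
      exact hJ _ hj hi
    exact ⟨hwv.1, h2, hr.tail ⟨flag_isFlag hx hwv.1, ⟨i, hadj⟩, h2⟩⟩

include hpos in
/-- Walking along edges whose colours lie in `S`, provided that any such colour can be reached by
admissible local moves. -/
theorem flagSteps_of_reach {Φ Ψ : RankFourData.Quad} {J : Fin 4 → Prop} {S : Fin n → Prop}
    (T : LFlag n m → Prop) (hT : ∀ u v, T u → T v → Relation.ReflTransGen (P.Move J) u v)
    (hTadj : ∀ u, T u → P.adj u.2.2 u.1 u.2.1) (hS : ∀ a, S a → ∃ b p, T (a, b, p))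
    (hJ : ∀ j, Φ.Agree Ψ j → ¬ J j ∧ j ≠ 0) {x y : Z3} (hx : P.V x) {u : LFlag n m} (hu : T u)
    (h0 : ∀ j, Φ.Agree Ψ j → Φ.Agree (P.flagAt pos x u.1 u.2.1 u.2.2) j)
    (h : P.Reach S x y) :
    ∃ v, T v ∧ (∀ j, Φ.Agree Ψ j → Φ.Agree (P.flagAt pos y v.1 v.2.1 v.2.2) j) ∧
    Relation.ReflTransGen (FlagStep P pos Φ Ψ)
      (P.flagAt pos x u.1 u.2.1 u.2.2) (P.flagAt pos y v.1 v.2.1 v.2.2) := by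
  have hy : ∀ y, P.Reach S x y → P.V y := fun y h => hx.reach h
  induction h with
  | refl => exact ⟨u, hu, h0, Relation.ReflTransGen.refl⟩
  | @tail y z hxy hyz ih =>
    obtain ⟨v, hv, h1, hr⟩ := ih
    obtain ⟨a, ha, rfl⟩ := hyz
    obtain ⟨b, p, hT'⟩ := hS a ha
    obtain ⟨hw, h2, hr'⟩ := flagSteps_of_moves hpos (hy y hxy) (hTadj v hv)
      (fun j hj => (hJ j hj).1) h1 (hT v _ hv hT')
    have hadj : (P.flagAt pos y a b p).Adjacent 0 (P.flagAt pos (P.step y a) a b p) :=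
      (adjacent_iff hpos hw hw 0).2 ⟨rfl, rfl, rfl, rfl⟩
    have h3 : ∀ j, Φ.Agree Ψ j → Φ.Agree (P.flagAt pos (P.step y a) a b p) j := fun j hj =>
      agree_trans (h2 j hj) (agree_of_adjacent hadj (hJ j hj).2)
    exact ⟨(a, b, p), hT', h3,
      (hr.trans hr').tail ⟨flag_isFlag ((hy y hxy).step a) hw, ⟨0, hadj⟩, h3⟩⟩

include hpos in
-- First walk to the vertex `y`, keeping the common elements: along the common edge, inside the
-- common face, inside the common facet, or freely, according to the lowest positive rank in which
-- the flags agree. What remains is a problem about local flags at `y`, settled by `moves_strong`.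
theorem strongly_flag_connected {x y : Z3} {a b c d : Fin n} {p q : Fin m} (hx : P.V x)
    (hy : P.V y) (h : P.adj p a b) (h' : P.adj q c d) :
    Relation.ReflTransGen
      (FlagStep P pos (P.flagAt pos x a b p) (P.flagAt pos y c d q))
      (P.flagAt pos x a b p) (P.flagAt pos y c d q) := by
  set Φ := P.flagAt pos x a b p with hΦ
  set Ψ := P.flagAt pos y c d q with hΨ
  have hrefl : ∀ j, Φ.Agree Φ j := fun j => by
    match j with
    | 0 => rfl
    | 1 => rfl
    | 2 => rfl
    | 3 => rfl
  have hag : ∀ i, Φ.Agree Ψ i ↔ _ := agree_iff hpos h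
  obtain ⟨v, hv, h1, hr⟩ : ∃ v : LFlag n m, P.adj v.2.2 v.1 v.2.1 ∧
      (∀ j, Φ.Agree Ψ j → Φ.Agree (P.flagAt pos y v.1 v.2.1 v.2.2) j) ∧
      Relation.ReflTransGen (FlagStep P pos Φ Ψ) Φ (P.flagAt pos y v.1 v.2.1 v.2.2) := by
    by_cases e0 : x = y
    · subst e0
      exact ⟨(a, b, p), h, fun j _ => hrefl j, Relation.ReflTransGen.refl⟩
    have n0 : ¬ Φ.Agree Ψ 0 := fun e => e0 ((hag 0).1 e)
    by_cases e1 : Φ.Agree Ψ 1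
    · obtain ⟨rfl, hyx⟩ := (hag 1).1 e1
      rcases hyx with rfl | rfl
      · exact absurd rfl e0
      have hadj : Φ.Adjacent 0 (P.flagAt pos (P.step x a) a b p) :=
        (adjacent_iff hpos h h 0).2 ⟨rfl, rfl, rfl, rfl⟩
      have h3 : ∀ j, Φ.Agree Ψ j → Φ.Agree (P.flagAt pos (P.step x a) a b p) j := by
        intro j hj
        refine agree_of_adjacent hadj ?_
        rintro rfl
        exact n0 hj
      exact ⟨(a, b, p), h, h3, Relation.ReflTransGen.single ⟨flag_isFlag hy h, ⟨0, hadj⟩, h3⟩⟩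
    by_cases e2 : Φ.Agree Ψ 2
    · obtain ⟨-, hxy⟩ := (hag 2).1 e2
      have hsw := P.adj_symm _ _ _ h
      obtain ⟨v, hv, h1, hr⟩ := flagSteps_of_reach (Φ := Φ) (Ψ := Ψ) (J := fun i => i = 1)
        (S := two a b) hpos (fun u : LFlag n m => u = (a, b, p) ∨ u = (b, a, p)) (by
          rintro u v (rfl | rfl) (rfl | rfl)
          · exact Relation.ReflTransGen.refl
          · exact Relation.ReflTransGen.single ⟨hsw, Or.inl ⟨rfl, rfl⟩⟩
          · exact Relation.ReflTransGen.single ⟨h, Or.inl ⟨rfl, rfl⟩⟩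
          · exact Relation.ReflTransGen.refl) (by
          rintro u (rfl | rfl)
          · exact h
          · exact hsw) (by
          rintro e (rfl | rfl)
          · exact ⟨b, p, Or.inl rfl⟩
          · exact ⟨a, p, Or.inr rfl⟩) (by
          intro j hj
          constructor
          · rintro rfl; exact e1 hj
          · rintro rfl; exact n0 hj) hx (u := (a, b, p)) (Or.inl rfl) (fun j _ => hrefl j) hxy
      refine ⟨v, ?_, h1, hr⟩
      rcases hv with rfl | rfl
      · exact h
      · exact hsw
    by_cases e3 : Φ.Agree Ψ 3
    · obtain ⟨-, hxy⟩ := (hag 3).1 e3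
      obtain ⟨v, hv, h1, hr⟩ := flagSteps_of_reach (Φ := Φ) (Ψ := Ψ) (J := fun i => i = 1 ∨ i = 2)
        (S := P.colours p) hpos (fun u : LFlag n m => u.2.2 = p ∧ P.adj p u.1 u.2.1) (by
          rintro ⟨u1, u2, u3⟩ ⟨v1, v2, v3⟩ ⟨rfl, hu⟩ ⟨hv3, hv⟩
          simp only at hv3
          subst hv3
          exact moves_polygon hu hv) (by
          rintro ⟨u1, u2, u3⟩ ⟨rfl, hu⟩
          exact hu) (by
          rintro e ⟨b, he⟩
          exact ⟨b, p, rfl, he⟩) (by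
          intro j hj
          constructor
          · rintro (rfl | rfl)
            · exact e1 hj
            · exact e2 hj
          · rintro rfl; exact n0 hj) hx (u := (a, b, p)) ⟨rfl, h⟩ (fun j _ => hrefl j) hxy
      refine ⟨v, ?_, h1, hr⟩
      obtain ⟨v1, v2, v3⟩ := v
      obtain ⟨rfl, hv⟩ := hv
      exact hv
    · have hno : ∀ j, ¬ Φ.Agree Ψ j := by
        intro j
        match j with
        | 0 => exact n0
        | 1 => exact e1
        | 2 => exact e2
        | 3 => exact e3
      have hxy : P.Reach (fun e => ∃ b p, P.adj p e b) x y := by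
        have := Reach.trans (Reach.symm hx) hy
        refine this.mono fun e _ => ?_
        obtain ⟨b', hb'⟩ := P.X_exists e
        obtain ⟨p', -, -, hp', -⟩ := P.X_adj _ _ hb'
        exact ⟨b', p', hp'⟩
      exact flagSteps_of_reach (Φ := Φ) (Ψ := Ψ) (J := fun i => True)
        hpos (fun u : LFlag n m => P.adj u.2.2 u.1 u.2.1) (fun u v hu hv => moves_all hu hv)
        (fun u hu => hu) (fun e he => he) (fun j hj => absurd hj (hno j)) hx (u := (a, b, p)) h
        (fun j _ => hrefl j) hxy
  -- The flag reached at `y` shares with `Φ`, and hence with `Ψ`, all elements common to the two;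
  -- the local walk to `Ψ` uses only moves in ranks where it differs from `Ψ`, so these elements
  -- stay fixed.
  have hJ : ∀ j, Φ.Agree Ψ j → ¬ ¬ LAgree v (c, d, q) j := by
    intro j hj hL
    apply hL
    have h4 : (P.flagAt pos y v.1 v.2.1 v.2.2).Agree Ψ j := by
      have h5 := h1 j hj
      match j with
      | 0 => exact Eq.trans (Eq.symm h5) hj
      | 1 => exact Eq.trans (Eq.symm h5) hj
      | 2 => exact Eq.trans (Eq.symm h5) hj
      | 3 => exact Eq.trans (Eq.symm h5) hj
    have h6 := (agree_iff hpos hv j).1 h4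
    match j with
    | 0 => trivial
    | 1 => exact h6.1
    | 2 => exact h6.1
    | 3 => exact h6.1
  obtain ⟨-, -, hr'⟩ := flagSteps_of_moves hpos hy hv (v := (c, d, q)) hJ h1 (moves_strong hv h')
  exact hr.trans hr'

include hpos in
theorem isPolytope : (P.apeirotope pos).IsPolytope where
  not_isDiag := by
    rintro e ⟨x, a, hx, rfl⟩
    simp only [edgeAt, Sym2.mk_isDiag_iff]
    exact fun h => P.step_ne x a (hpos h).symm
  edge_below := by
    rintro e ⟨x, a, hx, rfl⟩ v hv
    simp only [edgeAt, Sym2.mem_iff] at hv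
    rcases hv with rfl | rfl
    · exact ⟨x, hx, rfl⟩
    · exact ⟨_, hx.step a, rfl⟩
  face_below := by
    rintro F ⟨x, a, b, hx, hab, rfl⟩
    refine ⟨⟨_, edgeAt_mem_faceAt_left x a b⟩, ?_⟩
    rintro e ⟨y, c, hy, -, rfl⟩
    exact ⟨y, c, hx.reach hy, rfl⟩
  facet_below := by
    rintro C ⟨x, p, hx, rfl⟩
    obtain ⟨a, b, hab⟩ := P.adj_nonempty p
    refine ⟨⟨_, x, a, b, Reach.refl, hab, rfl⟩, ?_⟩
    rintro F ⟨y, c, d, hy, hcd, rfl⟩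
    exact ⟨y, c, d, hx.reach hy, P.adj_X _ _ _ hcd, rfl⟩
  vert_above := by
    rintro v ⟨x, hx, rfl⟩
    exact ⟨_, ⟨x, P.base, hx, rfl⟩, by simp [edgeAt]⟩
  edge_above := by
    rintro e ⟨x, a, hx, rfl⟩
    obtain ⟨b, hb⟩ := P.X_exists a
    exact ⟨_, ⟨x, a, b, hx, hb, rfl⟩, edgeAt_mem_faceAt_left x a b⟩
  face_above := by
    rintro F ⟨x, a, b, hx, hab, rfl⟩
    obtain ⟨p, -, -, hp, -⟩ := P.X_adj _ _ hab
    exact ⟨_, ⟨x, p, hx, rfl⟩, x, a, b, Reach.refl, hp, rfl⟩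
  diamond := by
    intro Φ hΦ i
    obtain ⟨x, a, b, p, hx, hab, rfl⟩ := (isFlag_iff hpos).1 hΦ
    exact diamond hpos hx hab i
  strongly_flag_connected := by
    intro Φ Ψ hΦ hΨ
    obtain ⟨x, a, b, p, hx, hab, rfl⟩ := (isFlag_iff hpos).1 hΦ
    obtain ⟨y, c, d, q, hy, hcd, rfl⟩ := (isFlag_iff hpos).1 hΨ
    exact strongly_flag_connected hpos hx hy hab hcd

end PolyPattern

/-! ### Symmetries of the models and their action on flags -/

namespace PolyPattern

open Pattern

variable {n m : ℕ}

/-- A symmetry of the realization of a pattern, with its action on lattice points, colours and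
polygons. -/
structure Auto (P : PolyPattern n m) (pos : Z3 → E3) where
  g : E3 ≃ᵢ E3
  φ : Z3 ≃ Z3
  τ : Equiv.Perm (Fin n)
  π : Equiv.Perm (Fin m)
  g_pos : ∀ x, g (pos x) = pos (φ x)
  φ_step : ∀ x a, φ (P.step x a) = P.step (φ x) (τ a)
  V_zero : P.V (φ 0)
  adj_eq : ∀ p a b, P.adj (π p) (τ a) (τ b) = P.adj p a b

namespace Auto

variable {P : PolyPattern n m} {pos : Z3 → E3} (A : Auto P pos)

/-- Composition of symmetries. -/
noncomputable def mul (A B : Auto P pos) (h : P.V (A.φ (B.φ 0))) : Auto P pos where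
  g := A.g * B.g
  φ := B.φ.trans A.φ
  τ := A.τ * B.τ
  π := A.π * B.π
  g_pos x := by simp [IsometryEquiv.mul_apply, B.g_pos, A.g_pos]
  φ_step x a := by simp [B.φ_step, A.φ_step]
  V_zero := h
  adj_eq p a b := by simp [A.adj_eq, B.adj_eq]

theorem φ_symm_step (x : Z3) (a : Fin n) :
    A.φ.symm (P.step x a) = P.step (A.φ.symm x) (A.τ.symm a) := by
  rw [Equiv.symm_apply_eq, A.φ_step]
  simp

theorem reach_iff {S S' : Fin n → Prop} (h : ∀ a, S' (A.τ a) ↔ S a) {x y : Z3} :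
    P.Reach S' (A.φ x) (A.φ y) ↔ P.Reach S x y := by
  constructor
  · intro hr
    have : P.Reach S (A.φ.symm (A.φ x)) (A.φ.symm (A.φ y)) := by
      refine reflTransGen_map A.φ.symm ?_ hr
      rintro u v ⟨a, ha, rfl⟩
      exact ⟨A.τ.symm a, (h _).1 (by simpa using ha), A.φ_symm_step _ _⟩
    simpa using this
  · intro hr
    refine reflTransGen_map A.φ ?_ hr
    rintro u v ⟨a, ha, rfl⟩
    exact ⟨A.τ a, (h a).2 ha, A.φ_step _ _⟩

theorem V_iff (x : Z3) : P.V (A.φ x) ↔ P.V x := by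
  have hr := A.reach_iff (S := fun _ => True) (S' := fun _ => True) (fun _ => Iff.rfl) (x := 0)
    (y := x)
  rw [V, V, ← hr]
  exact ⟨fun h => (Reach.symm A.V_zero).trans h, fun h => Reach.trans A.V_zero h⟩

theorem X_iff (a b : Fin n) : P.X (A.τ a) (A.τ b) ↔ P.X a b := by
  constructor
  · intro h
    obtain ⟨p, -, -, hp, -⟩ := P.X_adj _ _ h
    have := A.adj_eq (A.π.symm p) a b
    rw [Equiv.apply_symm_apply, hp] at this
    exact P.adj_X _ _ _ this.symm
  · intro h
    obtain ⟨p, -, -, hp, -⟩ := P.X_adj _ _ h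
    exact P.adj_X (A.π p) _ _ (by rw [A.adj_eq, hp])

theorem map_edge (x : Z3) (a : Fin n) :
    Sym2.map A.g (P.edgeAt pos x a) = P.edgeAt pos (A.φ x) (A.τ a) := by
  simp [edgeAt, A.g_pos, A.φ_step]

theorem map_face (x : Z3) (a b : Fin n) :
    Sym2.map A.g '' (P.faceAt pos x a b) = P.faceAt pos (A.φ x) (A.τ a) (A.τ b) := by
  have htwo : ∀ c, two (A.τ a) (A.τ b) (A.τ c) ↔ two a b c := by simp [two]
  ext e
  constructor
  · rintro ⟨_, ⟨y, c, hy, hc, rfl⟩, rfl⟩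
    exact ⟨A.φ y, A.τ c, (A.reach_iff htwo).2 hy, (htwo c).2 hc, A.map_edge y c⟩
  · rintro ⟨y, c, hy, hc, rfl⟩
    obtain ⟨y, rfl⟩ := A.φ.surjective y
    obtain ⟨c, rfl⟩ := A.τ.surjective c
    exact ⟨_, ⟨y, c, (A.reach_iff htwo).1 hy, (htwo c).1 hc, rfl⟩, A.map_edge y c⟩

theorem colours_iff (p : Fin m) (a : Fin n) : P.colours (A.π p) (A.τ a) ↔ P.colours p a := by
  constructor
  · rintro ⟨b, hb⟩
    obtain ⟨b, rfl⟩ := A.τ.surjective b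
    exact ⟨b, by rwa [A.adj_eq] at hb⟩
  · rintro ⟨b, hb⟩
    exact ⟨A.τ b, by rwa [A.adj_eq]⟩

theorem map_facet (x : Z3) (p : Fin m) :
    (fun F => Sym2.map A.g '' F) '' (P.facetAt pos x p) = P.facetAt pos (A.φ x) (A.π p) := by
  ext F
  constructor
  · rintro ⟨_, ⟨y, a, b, hy, hab, rfl⟩, rfl⟩
    exact ⟨A.φ y, A.τ a, A.τ b, (A.reach_iff (A.colours_iff p)).2 hy, by rwa [A.adj_eq],
      A.map_face y a b⟩
  · rintro ⟨y, a, b, hy, hab, rfl⟩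
    obtain ⟨y, rfl⟩ := A.φ.surjective y
    obtain ⟨a, rfl⟩ := A.τ.surjective a
    obtain ⟨b, rfl⟩ := A.τ.surjective b
    exact ⟨_, ⟨y, a, b, (A.reach_iff (A.colours_iff p)).1 hy, by rwa [A.adj_eq] at hab, rfl⟩,
      A.map_face y a b⟩

theorem map_flag (x : Z3) (a b : Fin n) (p : Fin m) :
    (P.flagAt pos x a b p).map A.g = P.flagAt pos (A.φ x) (A.τ a) (A.τ b) (A.π p) :=
  RankFourData.Quad.ext (A.g_pos x) (A.map_edge x a) (A.map_face x a b) (A.map_facet x p)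

theorem map_complex : (P.complex pos).map A.g = P.complex pos := by
  apply CellData.ext
  · ext v
    constructor
    · rintro ⟨_, ⟨x, hx, rfl⟩, rfl⟩
      exact ⟨A.φ x, (A.V_iff x).2 hx, A.g_pos x⟩
    · rintro ⟨x, hx, rfl⟩
      obtain ⟨x, rfl⟩ := A.φ.surjective x
      exact ⟨_, ⟨x, (A.V_iff x).1 hx, rfl⟩, A.g_pos x⟩
  · ext v
    constructor
    · rintro ⟨_, ⟨x, a, hx, rfl⟩, rfl⟩
      exact ⟨A.φ x, A.τ a, (A.V_iff x).2 hx, A.map_edge x a⟩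
    · rintro ⟨x, a, hx, rfl⟩
      obtain ⟨x, rfl⟩ := A.φ.surjective x
      obtain ⟨a, rfl⟩ := A.τ.surjective a
      exact ⟨_, ⟨x, a, (A.V_iff x).1 hx, rfl⟩, A.map_edge x a⟩
  · ext v
    constructor
    · rintro ⟨_, ⟨x, a, b, hx, hab, rfl⟩, rfl⟩
      exact ⟨A.φ x, A.τ a, A.τ b, (A.V_iff x).2 hx, (A.X_iff a b).2 hab, A.map_face x a b⟩
    · rintro ⟨x, a, b, hx, hab, rfl⟩
      obtain ⟨x, rfl⟩ := A.φ.surjective x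
      obtain ⟨a, rfl⟩ := A.τ.surjective a
      obtain ⟨b, rfl⟩ := A.τ.surjective b
      exact ⟨_, ⟨x, a, b, (A.V_iff x).1 hx, (A.X_iff a b).1 hab, rfl⟩, A.map_face x a b⟩

theorem isSymmetry : (P.apeirotope pos).IsSymmetry A.g := by
  have h := A.map_complex
  apply RankFourData.ext
  · exact congrArg CellData.verts h
  · exact congrArg CellData.edges h
  · exact congrArg CellData.faces h
  · ext C
    constructor
    · rintro ⟨_, ⟨x, p, hx, rfl⟩, rfl⟩
      exact ⟨A.φ x, A.π p, (A.V_iff x).2 hx, A.map_facet x p⟩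
    · rintro ⟨x, p, hx, rfl⟩
      obtain ⟨x, rfl⟩ := A.φ.surjective x
      obtain ⟨p, rfl⟩ := A.π.surjective p
      exact ⟨_, ⟨x, p, (A.V_iff x).1 hx, rfl⟩, A.map_facet x p⟩

end Auto

end PolyPattern

/-! ### Isometries and similarities realizing the lattice symmetries -/

/-- A signed permutation of the coordinates. -/
structure SignedPerm where
  perm : Equiv.Perm (Fin 3)
  sgn : Z3
  sgn_sq : sgn * sgn = 1

namespace SignedPerm

variable (σ : SignedPerm)

/-- The action on lattice points. -/
def act (x : Z3) : Z3 := fun i => σ.sgn i * x (σ.perm i)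

theorem sgn_mul_self (i : Fin 3) : σ.sgn i * σ.sgn i = 1 := congrFun σ.sgn_sq i

theorem sgn_mul_self_real (i : Fin 3) : (σ.sgn i : ℝ) * (σ.sgn i : ℝ) = 1 := by
  exact_mod_cast σ.sgn_mul_self i

/-- The affine map on lattice points with translation vector `t`. -/
def affineZ (t : Z3) : Z3 ≃ Z3 where
  toFun x := t + σ.act x
  invFun y := fun j => σ.sgn (σ.perm.symm j) * (y (σ.perm.symm j) - t (σ.perm.symm j))
  left_inv x := by
    funext j
    simp [act, ← mul_assoc, sgn_mul_self]
  right_inv y := by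
    funext i
    simp [act, ← mul_assoc, sgn_mul_self]

end SignedPerm

/-- Lattice points as points of `E3`. -/
noncomputable def castE (x : Z3) : E3 := WithLp.toLp 2 fun i => (x i : ℝ)

theorem castE_injective : Function.Injective castE := by
  intro x y h
  funext i
  have := congrArg (fun v : E3 => v i) h
  simpa [castE] using this

namespace SignedPerm

variable (σ : SignedPerm)

/-- The affine isometry with translation vector `t`. -/
noncomputable def affineE (t : Z3) : E3 ≃ᵢ E3 :=
  IsometryEquiv.mk' (fun x => WithLp.toLp 2 fun i => (t i : ℝ) + σ.sgn i * x (σ.perm i))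
    (fun y => WithLp.toLp 2 fun j =>
      (σ.sgn (σ.perm.symm j) : ℝ) * (y (σ.perm.symm j) - t (σ.perm.symm j)))
    (fun y => by
      ext i
      simp [← mul_assoc, sgn_mul_self_real])
    (by
      refine Isometry.of_dist_eq fun x y => ?_
      rw [EuclideanSpace.dist_eq, EuclideanSpace.dist_eq]
      congr 1
      rw [← Equiv.sum_comp σ.perm fun i => dist (x i) (y i) ^ 2]
      refine Finset.sum_congr rfl fun i _ => ?_
      have h1 := σ.sgn_mul_self_real i
      simp only [Real.dist_eq, sq_abs]
      linear_combination (x (σ.perm i) - y (σ.perm i)) ^ 2 * h1)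

theorem affineE_castE (t x : Z3) : σ.affineE t (castE x) = castE (σ.affineZ t x) := by
  ext i
  simp [affineE, castE, affineZ, act, IsometryEquiv.mk']

end SignedPerm

/-- Conjugation of an isometry by a similarity. -/
noncomputable def conjIso (f : E3 ≃ᵈ E3) (g : E3 ≃ᵢ E3) : E3 ≃ᵢ E3 :=
  IsometryEquiv.mk' (fun x => f (g (f.symm x))) (fun x => f (g.symm (f.symm x)))
    (fun x => by simp)
    (by
      intro x y
      have h := Dilation.edist_eq f (f.symm x) (f.symm y)
      rw [DilationEquiv.apply_symm_apply, DilationEquiv.apply_symm_apply] at h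
      rw [Dilation.edist_eq f, g.edist_eq, h])

theorem conjIso_apply (f : E3 ≃ᵈ E3) (g : E3 ≃ᵢ E3) (x : E3) :
    conjIso f g (f x) = f (g x) := by
  change f (g (f.symm (f x))) = _
  rw [DilationEquiv.symm_apply_apply]

/-- The realization of lattice points determined by a similarity. -/
noncomputable def posOf (f : E3 ≃ᵈ E3) (x : Z3) : E3 := f (castE x)

theorem posOf_injective (f : E3 ≃ᵈ E3) : Function.Injective (posOf f) :=
  f.injective.comp castE_injective

/-! ### Flag-transitivity and distinguished generators -/

namespace PolyPattern

open Pattern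

variable {n m : ℕ} (P : PolyPattern n m) (f : E3 ≃ᵈ E3)

/-- The symmetry which maps the origin to `t` and preserves the colours. -/
noncomputable def translate (t : Z3) (ht : P.V t) : Auto P (posOf f) where
  g := conjIso f (SignedPerm.affineE ⟨1, P.s t, P.s_sq t⟩ t)
  φ := SignedPerm.affineZ ⟨1, P.s t, P.s_sq t⟩ t
  τ := 1
  π := 1
  g_pos x := by rw [posOf, conjIso_apply, SignedPerm.affineE_castE, posOf]
  φ_step x a := by
    have h : ∀ z, SignedPerm.affineZ ⟨1, P.s t, P.s_sq t⟩ t z = t + P.s t * z := fun z => rfl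
    -- Since `s (t + s t * x) = s t * s x`, the map carries the edge of colour `a` at `x` to the
    -- edge of the same colour at the image point.
    rw [h, h, step, step, P.s_add, P.s_twist]
    simp only [Equiv.Perm.coe_one, id_eq]
    ring
  V_zero := by
    have h : SignedPerm.affineZ ⟨1, P.s t, P.s_sq t⟩ t 0 = t + P.s t * 0 := rfl
    rw [h, mul_zero, add_zero]
    exact ht
  adj_eq p a b := rfl

theorem translate_φ (t : Z3) (ht : P.V t) (z : Z3) : (P.translate f t ht).φ z = t + P.s t * z := rfl

/-- The symmetry fixing the origin given by a signed permutation. -/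
noncomputable def localAuto (σ : SignedPerm) (τ : Equiv.Perm (Fin n)) (π : Equiv.Perm (Fin m))
    (hs : ∀ x i, P.s (σ.act x) i = P.s x (σ.perm i)) (hτ : ∀ a, P.dir (τ a) = σ.act (P.dir a))
    (hπ : ∀ p a b, P.adj (π p) (τ a) (τ b) = P.adj p a b) : Auto P (posOf f) where
  g := conjIso f (σ.affineE 0)
  φ := σ.affineZ 0
  τ := τ
  π := π
  g_pos x := by rw [posOf, conjIso_apply, SignedPerm.affineE_castE, posOf]
  φ_step x a := by
    have h : ∀ z, σ.affineZ 0 z = σ.act z := fun z => zero_add _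
    rw [h, h, step, step, hτ]
    funext i
    simp only [Pi.add_apply, Pi.mul_apply, hs]
    simp only [SignedPerm.act, Pi.add_apply, Pi.mul_apply]
    ring
  V_zero := by
    have h : σ.affineZ 0 0 = 0 := by funext i; simp [SignedPerm.affineZ, SignedPerm.act]
    rw [h]
    exact V.zero
  adj_eq := hπ

theorem localAuto_φ_zero (σ : SignedPerm) (τ : Equiv.Perm (Fin n)) (π : Equiv.Perm (Fin m))
    (hs : ∀ x i, P.s (σ.act x) i = P.s x (σ.perm i)) (hτ : ∀ a, P.dir (τ a) = σ.act (P.dir a))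
    (hπ : ∀ p a b, P.adj (π p) (τ a) (τ b) = P.adj p a b) :
    (P.localAuto f σ τ π hs hτ hπ).φ 0 = 0 := by
  funext i; simp [localAuto, SignedPerm.affineZ, SignedPerm.act]

variable {P f}

/-- Symmetries which fix the origin and move the base flag `(a, b, p)` to its adjacent flags. -/
structure IsGen (a b : Fin n) (p : Fin m) (A₁ A₂ A₃ : Auto P (posOf f)) : Prop where
  adj : P.adj p a b
  zero₁ : A₁.φ 0 = 0
  zero₂ : A₂.φ 0 = 0
  zero₃ : A₃.φ 0 = 0
  gen₁ : A₁.τ a = b ∧ A₁.τ b = a ∧ A₁.π p = p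
  gen₂ : A₂.τ a = a ∧ A₂.τ b ≠ b ∧ A₂.π p = p
  gen₃ : A₃.τ a = a ∧ A₃.τ b = b ∧ A₃.π p ≠ p

variable {a b : Fin n} {p : Fin m} {A₁ A₂ A₃ : Auto P (posOf f)}

/-- If `A` takes the base flag to `u`, then `A` after the `i`-th generator takes it to the
`i`-adjacent flag of `u`. By the diamond condition every local move arises in this way, and local
moves connect all local flags. -/
theorem IsGen.exists_local (h : IsGen a b p A₁ A₂ A₃) {c d : Fin n} {q : Fin m}
    (hq : P.adj q c d) :
    ∃ A : Auto P (posOf f), A.φ 0 = 0 ∧ A.τ a = c ∧ A.τ b = d ∧ A.π p = q := by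
  have key : ∀ v : LFlag n m, Relation.ReflTransGen (P.Move fun _ => True) (a, b, p) v →
      ∃ A : Auto P (posOf f), A.φ 0 = 0 ∧ A.τ a = v.1 ∧ A.τ b = v.2.1 ∧ A.π p = v.2.2 := by
    intro v hv
    induction hv with
    | refl =>
      refine ⟨⟨1, 1, 1, 1, fun _ => rfl, fun _ _ => rfl, V.zero, fun _ _ _ => rfl⟩, rfl, rfl, rfl,
        rfl⟩
    | @tail u v _ huv ih =>
      obtain ⟨A, h0, h1, h2, h3⟩ := ih
      have hAadj : P.adj u.2.2 u.1 u.2.1 := by rw [← h1, ← h2, ← h3, A.adj_eq]; exact h.adj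
      obtain ⟨hv, ⟨-, rfl⟩ | ⟨-, e1, e2, e3⟩ | ⟨-, e1, e2, e3⟩⟩ := huv
      · refine ⟨A.mul A₁ (by rw [h.zero₁, h0]; exact V.zero), ?_, ?_, ?_, ?_⟩
        · simp [Auto.mul, h.zero₁, h0]
        · simp [Auto.mul, h.gen₁, h2]
        · simp [Auto.mul, h.gen₁, h1]
        · simp [Auto.mul, h.gen₁, h3]
      · refine ⟨A.mul A₂ (by rw [h.zero₂, h0]; exact V.zero), ?_, ?_, ?_, ?_⟩
        · simp [Auto.mul, h.zero₂, h0]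
        · simp [Auto.mul, h.gen₂, h1, e1]
        -- Both the image under `A * A₂` and the target of the move are different from the old
        -- second colour, and there is only one other choice.
        · obtain ⟨c, hc, hc', hall⟩ := P.other_edge _ _ _ hAadj
          have hx : P.adj u.2.2 u.1 (A.τ (A₂.τ b)) := by
            have := A.adj_eq (A₂.π p) (A₂.τ a) (A₂.τ b)
            rw [A₂.adj_eq, h.gen₂.1, h.gen₂.2.2, h1, h3] at this
            rw [this]; exact h.adj
          have hx' : A.τ (A₂.τ b) ≠ u.2.1 := by
            rw [← h2]; exact fun e => h.gen₂.2.1 (A.τ.injective e)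
          rw [e1, e3] at hv
          simp only [Auto.mul, Equiv.Perm.coe_mul, Function.comp_apply]
          rw [(hall _ hx).resolve_left hx', (hall _ hv).resolve_left e2]
        · simp [Auto.mul, h.gen₂, h3, e3]
      · refine ⟨A.mul A₃ (by rw [h.zero₃, h0]; exact V.zero), ?_, ?_, ?_, ?_⟩
        · simp [Auto.mul, h.zero₃, h0]
        · simp [Auto.mul, h.gen₃, h1, e1]
        · simp [Auto.mul, h.gen₃, h2, e2]
        · obtain ⟨c, hc, hc', hall⟩ := other_polygon hAadj
          have hx : P.adj (A.π (A₃.π p)) u.1 u.2.1 := by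
            have := A.adj_eq (A₃.π p) (A₃.τ a) (A₃.τ b)
            rw [A₃.adj_eq, h.gen₃.1, h.gen₃.2.1, h1, h2] at this
            rw [this]; exact h.adj
          have hx' : A.π (A₃.π p) ≠ u.2.2 := by
            rw [← h3]; exact fun e => h.gen₃.2.2 (A.π.injective e)
          rw [e1, e2] at hv
          simp only [Auto.mul, Equiv.Perm.coe_mul, Function.comp_apply]
          rw [(hall _ hx).resolve_left hx', (hall _ hv).resolve_left e3]
  exact key (c, d, q) (moves_all h.adj hq)

theorem IsGen.exists_auto (h : IsGen a b p A₁ A₂ A₃) {x : Z3} (hx : P.V x) {c d : Fin n}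
    {q : Fin m} (hq : P.adj q c d) :
    ∃ A : Auto P (posOf f), A.φ 0 = x ∧ A.τ a = c ∧ A.τ b = d ∧ A.π p = q := by
  obtain ⟨A, h0, h1, h2, h3⟩ := h.exists_local hq
  have hz : (P.translate f x hx).φ 0 = x := by rw [translate_φ, mul_zero, add_zero]
  refine ⟨(P.translate f x hx).mul A (by rw [h0, hz]; exact hx), ?_, ?_, ?_, ?_⟩
  · change (P.translate f x hx).φ (A.φ 0) = x
    rw [h0, hz]
  · exact h1
  · exact h2
  · exact h3

theorem map_symm_of_map {Q : RankFourData} {g : E3 ≃ᵢ E3} (h : Q.IsSymmetry g) :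
    Q.IsSymmetry g⁻¹ := by
  have h1 : (Q.map g).map (g⁻¹ : E3 ≃ᵢ E3) = Q := by
    have hc : ((g⁻¹ : E3 ≃ᵢ E3) : E3 → E3) ∘ g = id := by
      funext x; exact g.symm_apply_apply x
    have hs : ∀ e, Sym2.map (g⁻¹ : E3 ≃ᵢ E3) (Sym2.map g e) = e := by
      intro e
      rw [Sym2.map_map, hc, Sym2.map_id]; rfl
    have hF : ∀ F, Sym2.map (g⁻¹ : E3 ≃ᵢ E3) '' (Sym2.map g '' F) = F := by
      intro F
      simp [image_image, hs]
    ext1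
    · simp only [RankFourData.map, ← image_comp, hc, image_id]
    · simp only [RankFourData.map, image_image, hs, image_id']
    · simp only [RankFourData.map, image_image _ _ Q.faces, hF, image_id']
    · simp only [RankFourData.map, image_image _ _ Q.facets]
      have : ∀ C : Set (Set (Sym2 E3)), (fun F => Sym2.map (g⁻¹ : E3 ≃ᵢ E3) '' F) ''
          ((fun F => Sym2.map g '' F) '' C) = C := by
        intro C
        rw [image_image]
        simp only [hF, image_id']
      simp only [this, image_id']
  have h' : Q.map g = Q := h
  rwa [h'] at h1

theorem IsGen.flag_transitive (h : IsGen a b p A₁ A₂ A₃) (Φ Ψ : RankFourData.Quad)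
    (hΦ : (P.apeirotope (posOf f)).IsFlag Φ) (hΨ : (P.apeirotope (posOf f)).IsFlag Ψ) :
    ∃ A B : Auto P (posOf f), (P.flagAt (posOf f) 0 a b p).map A.g = Φ ∧
      (P.flagAt (posOf f) 0 a b p).map B.g = Ψ := by
  obtain ⟨x, c, d, q, hx, hcd, rfl⟩ := (isFlag_iff (posOf_injective f)).1 hΦ
  obtain ⟨y, c', d', q', hy, hcd', rfl⟩ := (isFlag_iff (posOf_injective f)).1 hΨ
  obtain ⟨A, h0, h1, h2, h3⟩ := h.exists_auto hx hcd
  obtain ⟨B, k0, k1, k2, k3⟩ := h.exists_auto hy hcd'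
  exact ⟨A, B, by rw [A.map_flag, h0, h1, h2, h3], by rw [B.map_flag, k0, k1, k2, k3]⟩

theorem quad_map_map (Φ : RankFourData.Quad) (g h : E3 → E3) :
    (Φ.map g).map h = Φ.map (h ∘ g) := by
  apply RankFourData.Quad.ext <;> simp [RankFourData.Quad.map, Sym2.map_map, image_image]

theorem quad_map_inv (Φ : RankFourData.Quad) (g : E3 ≃ᵢ E3) :
    (Φ.map g).map (g⁻¹ : E3 ≃ᵢ E3) = Φ := by
  have hc : ((g⁻¹ : E3 ≃ᵢ E3) : E3 → E3) ∘ g = id := by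
    funext x; exact g.symm_apply_apply x
  rw [quad_map_map, hc]
  apply RankFourData.Quad.ext <;> simp [RankFourData.Quad.map]

theorem isSymmetry_mul {Q : RankFourData} {g h : E3 ≃ᵢ E3} (hg : Q.IsSymmetry g)
    (hh : Q.IsSymmetry h) : Q.IsSymmetry (g * h) := by
  have hg' : Q.map g = Q := hg
  have hh' : Q.map h = Q := hh
  have : (Q.map h).map g = Q.map ((g * h : E3 ≃ᵢ E3)) := by
    rw [IsometryEquiv.coe_mul]
    ext <;> simp [RankFourData.map, Sym2.map_map, image_image]
  change Q.map ((g * h : E3 ≃ᵢ E3)) = Q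
  rw [← this, hh', hg']

/-- The generator `T₀` is the colour-preserving symmetry that takes the origin to its neighbour of
colour `a`; it interchanges the ends of the base edge because `s_dir` reverses the direction. -/
theorem IsGen.isDistinguished (h : IsGen a b p A₁ A₂ A₃) :
    (P.apeirotope (posOf f)).IsDistinguished (P.flagAt (posOf f) 0 a b p)
      ![(P.translate f _ (V.zero.step a)).g, A₁.g, A₂.g, A₃.g] := by
  refine ⟨flag_isFlag V.zero h.adj, fun i => ?_⟩
  have hinj := posOf_injective f
  have key : ∀ A : Auto P (posOf f), P.adj (A.π p) (A.τ a) (A.τ b) := fun A => by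
    rw [A.adj_eq]; exact h.adj
  match i with
  | 0 =>
    refine ⟨Auto.isSymmetry _, ?_⟩
    simp only [Matrix.cons_val_zero, Auto.map_flag]
    rw [adjacent_iff hinj h.adj (key _)]
    exact ⟨by rw [translate_φ, mul_zero, add_zero], rfl, rfl, rfl⟩
  | 1 =>
    refine ⟨Auto.isSymmetry A₁, ?_⟩
    change (P.flagAt (posOf f) 0 a b p).Adjacent 1 ((P.flagAt (posOf f) 0 a b p).map A₁.g)
    rw [Auto.map_flag, adjacent_iff hinj h.adj (key _)]
    exact ⟨h.zero₁, h.gen₁⟩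
  | 2 =>
    refine ⟨Auto.isSymmetry A₂, ?_⟩
    change (P.flagAt (posOf f) 0 a b p).Adjacent 2 ((P.flagAt (posOf f) 0 a b p).map A₂.g)
    rw [Auto.map_flag, adjacent_iff hinj h.adj (key _)]
    exact ⟨h.zero₂, h.gen₂⟩
  | 3 =>
    refine ⟨Auto.isSymmetry A₃, ?_⟩
    change (P.flagAt (posOf f) 0 a b p).Adjacent 3 ((P.flagAt (posOf f) 0 a b p).map A₃.g)
    rw [Auto.map_flag, adjacent_iff hinj h.adj (key _)]
    exact ⟨h.zero₃, h.gen₃⟩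

end PolyPattern

/-! ### The two sign rules and the stars of the Platonic solids -/

/-- A rule assigning a sign vector to each lattice point. -/
structure SignRule where
  s : Z3 → Z3
  s_add : ∀ x y, s (x + y) = s x * s y
  s_sq : ∀ x, s x * s x = 1
  s_twist : ∀ x y, s (s x * y) = s y
  s_act : ∀ (σ : SignedPerm) x i, s (σ.act x) i = s x (σ.perm i)

theorem negOnePow_sq (k : ℤ) : (k.negOnePow : ℤ) * (k.negOnePow : ℤ) = 1 := by
  rw [← Units.val_mul, ← Int.negOnePow_add, Int.negOnePow_even _ ⟨k, rfl⟩, Units.val_one]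

/-- A factor `±1` does not affect parity. Both sign rules depend only on parities, which is the
source of their compatibility with twists and signed permutations. -/
theorem even_mul_sub {e k : ℤ} (h : e * e = 1) : Even (e * k - k) := by
  rcases mul_self_eq_one_iff.1 h with rfl | rfl
  · simp
  · exact ⟨-k, by ring⟩

/-- The sign vector `±(1, 1, 1)` determined by the parity of the sum of the coordinates. -/
def zigzagRule : SignRule where
  s x := fun _ => ((x 0 + x 1 + x 2).negOnePow : ℤ)
  s_add x y := by
    funext i
    simp only [Pi.add_apply, Pi.mul_apply, ← Units.val_mul, ← Int.negOnePow_add]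
    congr 2
    ring
  s_sq x := by
    funext i
    exact negOnePow_sq _
  s_twist x y := by
    funext i
    simp only [Pi.mul_apply, Units.val_inj, Int.negOnePow_eq_iff]
    rw [← mul_add, ← mul_add]
    exact even_mul_sub (negOnePow_sq _)
  s_act σ x i := by
    have h : ∑ j, x (σ.perm j) = ∑ j, x j := Equiv.sum_comp σ.perm x
    simp only [Fin.sum_univ_three] at h
    simp only [SignedPerm.act, Units.val_inj, Int.negOnePow_eq_iff]
    rw [← h]
    have := ((even_mul_sub (k := x (σ.perm 0)) (σ.sgn_mul_self 0)).add
      (even_mul_sub (k := x (σ.perm 1)) (σ.sgn_mul_self 1))).add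
      (even_mul_sub (k := x (σ.perm 2)) (σ.sgn_mul_self 2))
    have e : ∀ u v w u' v' w' : ℤ, u + v + w - (u' + v' + w') = u - u' + (v - v') + (w - w') := by
      intros; ring
    rw [e]
    exact this

/-- The sign vector determined by the parities of the coordinates. -/
def squareRule : SignRule where
  s x := fun i => ((x i).negOnePow : ℤ)
  s_add x y := by
    funext i
    simp only [Pi.add_apply, Pi.mul_apply, ← Units.val_mul, ← Int.negOnePow_add]
  s_sq x := by
    funext i
    exact negOnePow_sq _
  s_twist x y := by
    funext i
    simp only [Pi.mul_apply, Units.val_inj, Int.negOnePow_eq_iff]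
    exact even_mul_sub (negOnePow_sq _)
  s_act σ x i := by
    simp only [SignedPerm.act, Units.val_inj, Int.negOnePow_eq_iff]
    exact even_mul_sub (σ.sgn_mul_self i)

/-- The inner product of lattice points. -/
def dotZ (x y : Z3) : ℤ := x 0 * y 0 + x 1 * y 1 + x 2 * y 2

theorem dotZ_comm (x y : Z3) : dotZ x y = dotZ y x := by simp only [dotZ]; ring

/-- All graphs needed here (stars, faces, Petrie hexagons) have diameter at most three, and paths of
bounded length turn connectedness into a finite check. -/
theorem reflTransGen_of_three {α : Type*} {r : α → α → Prop} {a c : α}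
    (h : a = c ∨ ∃ u, r a u ∧ (u = c ∨ ∃ v, r u v ∧ (v = c ∨ r v c))) :
    Relation.ReflTransGen r a c := by
  rcases h with rfl | ⟨u, h1, rfl | ⟨v, h2, rfl | h3⟩⟩
  · exact Relation.ReflTransGen.refl
  · exact Relation.ReflTransGen.single h1
  · exact (Relation.ReflTransGen.single h1).tail h2
  · exact ((Relation.ReflTransGen.single h1).tail h2).tail h3

/-- A finite set of vectors, joined in pairs when their inner product is `κ`. -/
structure StarData (n : ℕ) where
  dir : Fin n → Z3
  κ : ℤ
  base : Fin n
  dir_ne_zero : ∀ a, dir a ≠ 0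
  dir_inj : Function.Injective dir
  irrefl : ∀ a, dotZ (dir a) (dir a) ≠ κ
  exists_adj : ∀ a, ∃ b, dotZ (dir a) (dir b) = κ
  conn : ∀ a c, Relation.ReflTransGen (fun c d => decide (dotZ (dir c) (dir d) = κ) = true) a c

/-- The pattern with a given star and rule. -/
def StarData.pattern {n : ℕ} (S : StarData n) (R : SignRule) (h : ∀ a, R.s (S.dir a) * S.dir a = -S.dir a) :
    Pattern n where
  s := R.s
  dir := S.dir
  X a b := decide (dotZ (S.dir a) (S.dir b) = S.κ)
  s_add := R.s_add
  s_sq := R.s_sq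
  s_twist := R.s_twist
  s_dir := h
  dir_ne_zero := S.dir_ne_zero
  dir_inj := S.dir_inj
  X_symm a b h := by rwa [dotZ_comm]
  X_irrefl a := by simpa using S.irrefl a
  base := S.base
  X_exists a := by simpa using S.exists_adj a
  X_conn := S.conn

/-- Polygons on a star, which form a polyhedron. -/
structure StarData.Polygons {n : ℕ} (S : StarData n) (m : ℕ) where
  adj : Fin m → Fin n → Fin n → Bool
  adj_X : ∀ p a b, adj p a b → dotZ (S.dir a) (S.dir b) = S.κ
  adj_symm : ∀ p a b, adj p a b → adj p b a
  adj_inj : ∀ p q, (∀ a b, adj p a b = adj q a b) → p = q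
  adj_nonempty : ∀ p, ∃ a b, adj p a b
  other_edge : ∀ p a b, adj p a b → ∃ c, c ≠ b ∧ adj p a c ∧ ∀ d, adj p a d → d = b ∨ d = c
  X_adj : ∀ a b, dotZ (S.dir a) (S.dir b) = S.κ →
    ∃ p q, p ≠ q ∧ adj p a b ∧ adj q a b ∧ ∀ r, adj r a b → r = p ∨ r = q
  conn_polygon : ∀ p a, (∃ b, adj p a b) → ∀ c, (∃ d, adj p c d) →
    a = c ∨ ∃ u, adj p a u ∧ (u = c ∨ ∃ v, adj p u v ∧ (v = c ∨ adj p v c))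
  conn_colour : ∀ a b c, dotZ (S.dir a) (S.dir b) = S.κ → dotZ (S.dir a) (S.dir c) = S.κ →
    b = c ∨ ∃ u, (∃ p, adj p a b ∧ adj p a u) ∧ (u = c ∨ ∃ p, adj p a u ∧ adj p a c)

/-- The pattern of rank 4. -/
def StarData.polyPattern {n m : ℕ} (S : StarData n) (R : SignRule)
    (h : ∀ a, R.s (S.dir a) * S.dir a = -S.dir a) (Q : S.Polygons m) : PolyPattern n m where
  toPattern := S.pattern R h
  adj := Q.adj
  adj_X p a b hab := decide_eq_true (Q.adj_X p a b hab)
  adj_symm := Q.adj_symm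
  adj_inj p q hpq := Q.adj_inj p q fun a b => congrFun (congrFun hpq a) b
  adj_nonempty := Q.adj_nonempty
  other_edge := Q.other_edge
  X_adj a b hab := Q.X_adj a b (of_decide_eq_true hab)
  conn_polygon p a b c d hab hcd := reflTransGen_of_three (Q.conn_polygon p a ⟨b, hab⟩ c ⟨d, hcd⟩)
  conn_colour a b c hb hc := by
    rcases Q.conn_colour a b c (of_decide_eq_true hb) (of_decide_eq_true hc) with
      rfl | ⟨u, h1, rfl | h2⟩
    · exact Relation.ReflTransGen.refl
    · exact Relation.ReflTransGen.single h1
    · exact (Relation.ReflTransGen.single h1).tail h2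

/-- The vertices of the regular tetrahedron. -/
def tetraDir : Fin 4 → Z3 := ![![1, 1, 1], ![1, -1, -1], ![-1, 1, -1], ![-1, -1, 1]]

/-- The vertices of the regular octahedron. -/
def octaDir : Fin 6 → Z3 :=
  ![![1, 0, 0], ![-1, 0, 0], ![0, 1, 0], ![0, -1, 0], ![0, 0, 1], ![0, 0, -1]]

/-- The vertices of the cube. -/
def cubeDir : Fin 8 → Z3 :=
  ![![1, 1, 1], ![-1, 1, 1], ![1, -1, 1], ![1, 1, -1], ![-1, -1, -1], ![1, -1, -1], ![-1, 1, -1],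
    ![-1, -1, 1]]

/-- The star of the tetrahedron. -/
def tetraStar : StarData 4 where
  dir := tetraDir
  κ := -1
  base := 0
  dir_ne_zero := by decide +kernel
  dir_inj := by decide +kernel
  irrefl := by decide +kernel
  exists_adj := by decide +kernel
  conn := fun a c => reflTransGen_of_three (by revert a c; decide +kernel)

/-- The star of the octahedron. -/
def octaStar : StarData 6 where
  dir := octaDir
  κ := 0
  base := 0
  dir_ne_zero := by decide +kernel
  dir_inj := by decide +kernel
  irrefl := by decide +kernel
  exists_adj := by decide +kernel
  conn := fun a c => reflTransGen_of_three (by revert a c; decide +kernel)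

/-- The star of the cube. -/
def cubeStar : StarData 8 where
  dir := cubeDir
  κ := 1
  base := 0
  dir_ne_zero := by decide +kernel
  dir_inj := by decide +kernel
  irrefl := by decide +kernel
  exists_adj := by decide +kernel
  conn := fun a c => reflTransGen_of_three (by revert a c; decide +kernel)

/-- The faces of the polyhedron: `h p` is a normal vector of the face `p`. -/
def StarData.faceAdj {n m : ℕ} (S : StarData n) (h : Fin m → Z3) (p : Fin m) (a b : Fin n) : Bool :=
  decide (dotZ (S.dir a) (S.dir b) = S.κ) && decide (dotZ (S.dir a) (h p) = 1) &&
    decide (dotZ (S.dir b) (h p) = 1)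

/-- The Petrie polygons of the polyhedron: `h p` is the axis of the polygon `p`. -/
def StarData.petrieAdj {n m : ℕ} (S : StarData n) (h : Fin m → Z3) (p : Fin m) (a b : Fin n) : Bool :=
  decide (dotZ (S.dir a) (S.dir b) = S.κ) &&
    decide (dotZ (S.dir a) (h p) * dotZ (S.dir b) (h p) = -1)

set_option synthInstance.maxSize 2000
set_option synthInstance.maxHeartbeats 200000

/-- The faces of the tetrahedron. -/
def tetraFaces : tetraStar.Polygons 4 where
  -- The face opposite to vertex `p`: the other three vertices have inner product 1 with this
  -- normal, and `p` itself has inner product -3.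
  adj := tetraStar.faceAdj fun p => -tetraDir p
  adj_X := by decide +kernel
  adj_symm := by decide +kernel
  adj_inj := by decide +kernel
  adj_nonempty := by decide +kernel
  other_edge := by decide +kernel
  X_adj := by decide +kernel
  conn_polygon := by decide +kernel
  conn_colour := by decide +kernel

/-- The Petrie polygons of the tetrahedron. -/
def tetraPetrie : tetraStar.Polygons 3 where
  -- A coordinate axis separates the four vertices into two pairs; the four edges between the pairs
  -- form a Petrie quadrangle.
  adj := tetraStar.petrieAdj ![![1, 0, 0], ![0, 1, 0], ![0, 0, 1]]
  adj_X := by decide +kernel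
  adj_symm := by decide +kernel
  adj_inj := by decide +kernel
  adj_nonempty := by decide +kernel
  other_edge := by decide +kernel
  X_adj := by decide +kernel
  conn_polygon := by decide +kernel
  conn_colour := by decide +kernel

/-- The faces of the octahedron. -/
def octaFaces : octaStar.Polygons 8 where
  adj := octaStar.faceAdj cubeDir
  adj_X := by decide +kernel
  adj_symm := by decide +kernel
  adj_inj := by decide +kernel
  adj_nonempty := by decide +kernel
  other_edge := by decide +kernel
  X_adj := by decide +kernel
  conn_polygon := by decide +kernel
  conn_colour := by decide +kernel

/-- The Petrie polygons of the octahedron. -/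
def octaPetrie : octaStar.Polygons 4 where
  -- An axis through two opposite triangles gives one of them inner product 1 and the other -1; the
  -- edges between them form a hexagon. One normal is needed from each opposite pair.
  adj := octaStar.petrieAdj tetraDir
  adj_X := by decide +kernel
  adj_symm := by decide +kernel
  adj_inj := by decide +kernel
  adj_nonempty := by decide +kernel
  other_edge := by decide +kernel
  X_adj := by decide +kernel
  conn_polygon := by decide +kernel
  conn_colour := by decide +kernel

/-- The faces of the cube. -/
def cubeFaces : cubeStar.Polygons 6 where
  adj := cubeStar.faceAdj octaDir
  adj_X := by decide +kernel
  adj_symm := by decide +kernel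
  adj_inj := by decide +kernel
  adj_nonempty := by decide +kernel
  other_edge := by decide +kernel
  X_adj := by decide +kernel
  conn_polygon := by decide +kernel
  conn_colour := by decide +kernel

/-- The Petrie polygons of the cube. -/
def cubePetrie : cubeStar.Polygons 4 where
  -- Along a body diagonal the vertices have inner products 3, 1, -1, -3. The product -1 selects the
  -- edges between the two middle levels, which form a hexagon.
  adj := cubeStar.petrieAdj tetraDir
  adj_X := by decide +kernel
  adj_symm := by decide +kernel
  adj_inj := by decide +kernel
  adj_nonempty := by decide +kernel
  other_edge := by decide +kernel
  X_adj := by decide +kernel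
  conn_polygon := by decide +kernel
  conn_colour := by decide +kernel

/-! ### Isometries of a full hull and discreteness of the lattice points -/

namespace CellData

open Classical in
theorem hullAct_apply (K : CellData) (g : K.hull ≃ᵢ K.hull) {x : E3} (hx : x ∈ K.hull) :
    K.hullAct g x = g ⟨x, hx⟩ :=
  Equiv.Perm.ofSubtype_apply_of_mem (p := fun x => x ∈ K.hull) g.toEquiv hx

theorem mem_hull_of_eq_top {K : CellData} (h : K.hull = ⊤) (x : E3) : x ∈ K.hull := by
  rw [h]; exact AffineSubspace.mem_top ℝ E3 _

/-- An isometry of the whole space as an isometry of a full hull. -/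
noncomputable def restrictHull (K : CellData) (h : K.hull = ⊤) (g : E3 ≃ᵢ E3) : K.hull ≃ᵢ K.hull where
  toFun x := ⟨g x, mem_hull_of_eq_top h _⟩
  invFun x := ⟨g.symm x, mem_hull_of_eq_top h _⟩
  left_inv x := by ext1; simp
  right_inv x := by ext1; simp
  isometry_toFun x y := by
    simp only [Subtype.edist_eq, g.edist_eq]

theorem hullAct_restrictHull (K : CellData) (h : K.hull = ⊤) (g : E3 ≃ᵢ E3) :
    (K.hullAct (K.restrictHull h g) : E3 → E3) = g := by
  funext x
  rw [hullAct_apply K _ (mem_hull_of_eq_top h x)]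
  rfl

theorem restrictHull_mem (K : CellData) (h : K.hull = ⊤) {g : E3 ≃ᵢ E3} (hg : K.map g = K) :
    K.restrictHull h g ∈ K.symmetryGroup := by
  change K.map (K.hullAct (K.restrictHull h g)) = K
  rw [hullAct_restrictHull, hg]

end CellData

theorem finite_castE_mem {C : Set E3} (hC : Bornology.IsBounded C) : {x : Z3 | castE x ∈ C}.Finite := by
  obtain ⟨M, hM⟩ := hC.exists_norm_le
  refine (Set.finite_Icc (fun _ : Fin 3 => -⌈M⌉) (fun _ => ⌈M⌉)).subset fun x hx => ?_
  have key : ∀ i, |x i| ≤ ⌈M⌉ := by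
    intro i
    have h1 : ‖(castE x) i‖ ≤ ‖castE x‖ := PiLp.norm_apply_le _ i
    have h2 : |(x i : ℝ)| ≤ M := by
      simpa [castE] using h1.trans (hM _ hx)
    have h3 : ((|x i| : ℤ) : ℝ) ≤ (⌈M⌉ : ℝ) := by
      push_cast
      exact h2.trans (Int.le_ceil M)
    exact_mod_cast h3
  exact ⟨fun i => (abs_le.1 (key i)).1, fun i => (abs_le.1 (key i)).2⟩

theorem finite_posOf_mem (f : E3 ≃ᵈ E3) {C : Set E3} (hC : Bornology.IsBounded C) :
    {x : Z3 | posOf f x ∈ C}.Finite := by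
  refine (finite_castE_mem (C := f.symm '' C) ?_).subset fun x hx => ?_
  · exact (Dilation.lipschitz f.symm).isBounded_image hC
  · exact ⟨posOf f x, hx, by simp [posOf]⟩

/-! ### The models are polygonal complexes -/

namespace Pattern

variable {n : ℕ} {P : Pattern n}

/-- Two steps of colours `a` and `b` restore the sign vector and shift by a fixed non-zero vector,
so they can be repeated indefinitely. -/
theorem infinite_V {a b : Fin n} (h1 : P.s (P.dir a) * P.s (P.dir b) = 1)
    (h2 : P.dir a + P.s (P.dir a) * P.dir b ≠ 0) : {x | P.V x}.Infinite := by
  set t := P.dir a + P.s (P.dir a) * P.dir b with ht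
  have key : ∀ k : ℕ, P.V (k • t) ∧ P.s (k • t) = 1 := by
    intro k
    induction k with
    | zero => simpa using ⟨V.zero, P.s_zero⟩
    | succ k ih =>
      have hs : P.step (P.step (k • t) a) b = (k + 1) • t := by
        rw [step, s_step, ih.2, step, ih.2, add_smul, one_smul, ht]
        ring
      refine ⟨hs ▸ (ih.1.step a).step b, ?_⟩
      rw [← hs, s_step, s_step, ih.2, one_mul, h1]
  refine Set.infinite_of_injective_forall_mem (f := fun k : ℕ => k • t) ?_ fun k => (key k).1
  intro k l hkl
  obtain ⟨i, hi⟩ := Function.ne_iff.1 h2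
  have := congrFun hkl i
  simp only [Pi.smul_apply, nsmul_eq_mul] at this
  exact_mod_cast mul_right_cancel₀ hi this

/-- The polygons of a pattern whose sign vectors change along all edges. -/
theorem isPolygon_zigzag (hs : ∀ a, P.s (P.dir a) = -1) {pos : Z3 → E3}
    (hpos : Function.Injective pos)
    (hfin : ∀ C : Set E3, IsCompact C →
      {y | ∃ a, (edgeSegment (P.edgeAt pos y a) ∩ C).Nonempty}.Finite)
    (x : Z3) {a b : Fin n} (hab : a ≠ b) : IsInfinitePolygon (P.faceAt pos x a b) := by
  -- Every second vertex of the zigzag: the step `a` followed by `b` is a translation, since the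
  -- sign vector is reversed in between.
  set w : ℤ → Z3 := fun k => x + k • (P.s x * (P.dir a - P.dir b)) with hw
  have hsx : ∀ y, P.s x * P.s y = 1 → P.s x = P.s y := by
    intro y h
    have := congrArg (fun z => P.s x * z) h
    simp only [P.s_mul_cancel, mul_one] at this
    exact this.symm
  have hstep : ∀ k : ℤ, P.s (w k) = P.s x → P.step (P.step (w k) a) b = w (k + 1) := by
    intro k h
    rw [step, s_step, step, h, hs, hw]
    simp only
    rw [add_smul, one_smul]
    ring
  have hstep' : ∀ k : ℤ, P.s (w k) = P.s x → P.step (P.step (w k) b) a = w (k - 1) := by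
    intro k h
    rw [step, s_step, step, h, hs, hw]
    simp only
    rw [sub_smul, one_smul]
    ring
  have hss : ∀ y c d, P.s (P.step (P.step y c) d) = P.s y := by
    intro y c d
    rw [s_step, s_step, hs, hs]; ring
  have hsw : ∀ k : ℤ, P.s (w k) = P.s x ∧ P.Reach (two a b) x (w k) := by
    intro k
    induction k using Int.induction_on with
    | zero => simp [hw, Reach.refl]
    | succ k ih =>
      rw [← hstep k ih.1]
      exact ⟨by rw [hss, ih.1], (ih.2.step (Or.inl rfl)).step (Or.inr rfl)⟩
    | pred k ih =>
      rw [← hstep' _ ih.1]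
      exact ⟨by rw [hss, ih.1], (ih.2.step (Or.inr rfl)).step (Or.inl rfl)⟩
  have hne : P.s x * (P.dir a - P.dir b) ≠ 0 := by
    intro h
    have := congrArg (fun z => P.s x * z) h
    simp only [P.s_mul_cancel, mul_zero] at this
    exact hab (P.dir_inj (sub_eq_zero.1 this))
  have hwinj : Function.Injective w := by
    intro k l hkl
    obtain ⟨i, hi⟩ := Function.ne_iff.1 hne
    have := congrFun hkl i
    simp only [hw, Pi.add_apply, Pi.smul_apply, smul_eq_mul] at this
    exact mul_right_cancel₀ hi (add_left_cancel this)
  -- The two classes of vertices on the zigzag carry opposite sign vectors, so they are disjoint.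
  have hpar : ∀ k l : ℤ, w k ≠ P.step (w l) a := by
    intro k l h
    have := congrArg P.s h
    rw [(hsw k).1, s_step, (hsw l).1, hs] at this
    have h0 := congrFun this 0
    have h1 := congrFun (P.s_sq x) 0
    simp only [Pi.mul_apply, Pi.neg_apply, Pi.one_apply] at h0 h1
    have : P.s x 0 = 0 := by linarith
    rw [this] at h1
    simp at h1
  set v : ℤ → Z3 := fun i => if Even i then w (i / 2) else P.step (w (i / 2)) a with hv
  have hve : ∀ k : ℤ, v (2 * k) = w k := by
    intro k
    simp [hv]
  have hvo : ∀ k : ℤ, v (2 * k + 1) = P.step (w k) a := by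
    intro k
    have h1 : ¬ Even (2 * k + 1) := by simp [parity_simps]
    have h2 : (2 * k + 1) / 2 = k := by omega
    simp [hv, h1, h2]
  have hF : P.faceAt pos x a b = range fun i : ℤ => s(pos (v i), pos (v (i + 1))) := by
    have e1 : ∀ k : ℤ, s(pos (v (2 * k)), pos (v (2 * k + 1))) = P.edgeAt pos (w k) a := by
      intro k; rw [hve, hvo, edgeAt]
    have e2 : ∀ k : ℤ, s(pos (v (2 * k + 1)), pos (v (2 * k + 1 + 1))) =
        P.edgeAt pos (P.step (w k) a) b := by
      intro k
      have : 2 * k + 1 + 1 = 2 * (k + 1) := by ring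
      rw [this, hve, hvo, edgeAt, hstep k (hsw k).1]
    apply Subset.antisymm
    · rintro e ⟨y, c, hy, hc, rfl⟩
      have hyw : ∃ k, y = w k ∨ y = P.step (w k) a := by
        clear hc
        induction hy with
        | refl => exact ⟨0, Or.inl (by simp [hw])⟩
        | @tail y z _ hyz ih =>
          obtain ⟨c, hc, rfl⟩ := hyz
          obtain ⟨k, rfl | rfl⟩ := ih
          · rcases hc with rfl | rfl
            · exact ⟨k, Or.inr rfl⟩
            · refine ⟨k - 1, Or.inr ?_⟩
              rw [← hstep' k (hsw k).1, P.step_step]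
          · rcases hc with rfl | rfl
            · exact ⟨k, Or.inl (P.step_step _ _)⟩
            · exact ⟨k + 1, Or.inl (hstep k (hsw k).1)⟩
      obtain ⟨k, rfl | rfl⟩ := hyw
      · rcases hc with rfl | rfl
        · exact ⟨2 * k, e1 k⟩
        · refine ⟨2 * (k - 1) + 1, (e2 (k - 1)).trans ?_⟩
          rw [← edgeAt_step, hstep _ (hsw _).1, sub_add_cancel]
      · rcases hc with rfl | rfl
        · exact ⟨2 * k, by rw [edgeAt_step]; exact e1 k⟩
        · exact ⟨2 * k + 1, e2 k⟩
    · rintro e ⟨i, rfl⟩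
      obtain ⟨k, rfl | rfl⟩ := Int.even_or_odd' i
      · simp only
        rw [e1]
        exact ⟨_, _, (hsw k).2, Or.inl rfl, rfl⟩
      · simp only
        rw [e2]
        exact ⟨_, _, (hsw k).2.step (Or.inl rfl), Or.inr rfl, rfl⟩
  refine ⟨fun i => pos (v i), ?_, hF, ?_⟩
  · refine hpos.comp ?_
    intro i j hij
    obtain ⟨k, rfl | rfl⟩ := Int.even_or_odd' i <;> obtain ⟨l, rfl | rfl⟩ := Int.even_or_odd' j
    · rw [hve, hve] at hij; rw [hwinj hij]
    · rw [hve, hvo] at hij; exact absurd hij (hpar _ _)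
    · rw [hve, hvo] at hij; exact absurd hij.symm (hpar _ _)
    · rw [hvo, hvo] at hij
      have := congrArg (fun z => P.step z a) hij
      simp only [P.step_step] at this
      rw [hwinj this]
  · intro C hC
    refine (((hfin C hC).prod (Set.finite_univ (α := Fin n))).image
      fun u => P.edgeAt pos u.1 u.2).subset ?_
    rintro e ⟨⟨y, c, -, -, rfl⟩, h⟩
    exact ⟨(y, c), ⟨⟨c, h⟩, mem_univ _⟩, rfl⟩

/-- The polygons of a pattern in which consecutive colours commute. -/
theorem isPolygon_square {pos : Z3 → E3} (hpos : Function.Injective pos)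
    (x : Z3) {a b : Fin n} (hab : a ≠ b) (h1 : P.s (P.dir a) * P.dir b = P.dir b)
    (h2 : P.s (P.dir b) * P.dir a = P.dir a) : IsFinitePolygon (P.faceAt pos x a b) := by
  -- Crossing an edge of one colour leaves the direction of the other unchanged, so the two steps
  -- commute and the walk closes after four edges.
  have hcomm : ∀ y, P.step (P.step y a) b = P.step (P.step y b) a := by
    intro y
    rw [step, s_step, mul_assoc, h1, step, step, s_step, mul_assoc, h2, step]
    ring
  have h3 : P.step (P.step x a) b ≠ x := by
    intro h
    have e : P.step x b = P.step x a := by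
      rw [← P.step_step (P.step x a) b, h]
    exact hab (P.step_inj e).symm
  have h4 : P.step x a ≠ P.step x b := fun h => hab (P.step_inj h)
  have h5 : P.step (P.step x a) b ≠ P.step x a := P.step_ne _ _
  have h6 : P.step (P.step x a) b ≠ P.step x b := by
    rw [hcomm]; exact P.step_ne _ _
  have h7 := P.step_ne x a
  have h8 := P.step_ne x b
  let v : Fin 4 → Z3 := ![x, P.step x a, P.step (P.step x a) b, P.step x b]
  refine ⟨4, by norm_num, fun i : Fin 4 => pos (v i), hpos.comp ?_, ?_⟩
  · intro i j hij
    fin_cases i <;> fin_cases j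
    · rfl
    · exact absurd hij h7.symm
    · exact absurd hij h3.symm
    · exact absurd hij h8.symm
    · exact absurd hij h7
    · rfl
    · exact absurd hij h5.symm
    · exact absurd hij h4
    · exact absurd hij h3
    · exact absurd hij h5
    · rfl
    · exact absurd hij h6
    · exact absurd hij h8
    · exact absurd hij h4.symm
    · exact absurd hij h6.symm
    · rfl
  · have e0 : s(pos (v 0), pos (v 1)) = P.edgeAt pos x a := rfl
    have e1 : s(pos (v 1), pos (v 2)) = P.edgeAt pos (P.step x a) b := rfl
    have e2 : s(pos (v 2), pos (v 3)) = P.edgeAt pos (P.step x b) a := by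
      rw [edgeAt, ← hcomm, Sym2.eq_swap]; rfl
    have e3 : s(pos (v 3), pos (v 0)) = P.edgeAt pos x b := by
      rw [edgeAt, Sym2.eq_swap]; rfl
    apply Subset.antisymm
    · rintro e ⟨y, c, hy, hc, rfl⟩
      have hy' : y = x ∨ y = P.step x a ∨ y = P.step (P.step x a) b ∨ y = P.step x b := by
        clear hc
        induction hy with
        | refl => exact Or.inl rfl
        | @tail y z _ hyz ih =>
          obtain ⟨c, hc, rfl⟩ := hyz
          rcases ih with rfl | rfl | rfl | rfl <;> rcases hc with rfl | rfl
          · exact Or.inr (Or.inl rfl)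
          · exact Or.inr (Or.inr (Or.inr rfl))
          · exact Or.inl (P.step_step _ _)
          · exact Or.inr (Or.inr (Or.inl rfl))
          · rw [hcomm, P.step_step]; exact Or.inr (Or.inr (Or.inr rfl))
          · rw [P.step_step]; exact Or.inr (Or.inl rfl)
          · rw [← hcomm]; exact Or.inr (Or.inr (Or.inl rfl))
          · exact Or.inl (P.step_step _ _)
      rcases hy' with rfl | rfl | rfl | rfl <;> rcases hc with rfl | rfl
      · exact ⟨(0 : Fin 4), e0⟩
      · exact ⟨(3 : Fin 4), e3⟩
      · exact ⟨(0 : Fin 4), e0.trans (edgeAt_step _ _).symm⟩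
      · exact ⟨(1 : Fin 4), e1⟩
      · exact ⟨(2 : Fin 4), by rw [hcomm, edgeAt_step]; exact e2⟩
      · exact ⟨(1 : Fin 4), by rw [edgeAt_step]; exact e1⟩
      · exact ⟨(2 : Fin 4), e2⟩
      · exact ⟨(3 : Fin 4), by rw [edgeAt_step]; exact e3⟩
    · rintro e ⟨i, rfl⟩
      have hra : P.Reach (two a b) x (P.step x a) := Reach.single (Or.inl rfl)
      have hrb : P.Reach (two a b) x (P.step x b) := Reach.single (Or.inr rfl)
      change Fin 4 at i
      fin_cases i
      · exact ⟨x, a, Reach.refl, Or.inl rfl, e0⟩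
      · exact ⟨_, b, hra, Or.inr rfl, e1⟩
      · exact ⟨_, a, hrb, Or.inl rfl, e2⟩
      · exact ⟨x, b, Reach.refl, Or.inr rfl, e3⟩

variable {pos : Z3 → E3} (hpos : Function.Injective pos)

include hpos in
theorem edge_at_iff {x : Z3} (hx : P.V x) (u : E3) :
    s(u, pos x) ∈ (P.complex pos).edges ↔ ∃ a, u = pos (P.step x a) := by
  constructor
  · rintro ⟨y, a, hy, h⟩
    have hm : pos x ∈ P.edgeAt pos y a := by rw [← h]; simp
    have he : P.edgeAt pos y a = P.edgeAt pos x a := by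
      rw [edgeAt_eq_iff hpos]
      exact ⟨rfl, (mem_edgeAt_iff hpos).1 hm⟩
    rw [he, edgeAt, Sym2.eq_iff] at h
    rcases h with ⟨-, h⟩ | ⟨h, -⟩
    · exact absurd (hpos h).symm (P.step_ne x a)
    · exact ⟨a, h⟩
  · rintro ⟨a, rfl⟩
    exact ⟨x, a, hx, Sym2.eq_swap⟩

include hpos in
theorem face_at_iff {x : Z3} (hx : P.V x) (a : Fin n) (F : Set (Sym2 E3)) :
    (F ∈ (P.complex pos).faces ∧ P.edgeAt pos x a ∈ F) ↔
      ∃ b, P.X a b ∧ F = P.faceAt pos x a b := by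
  constructor
  · rintro ⟨⟨y, c, d, hy, hcd, rfl⟩, h⟩
    obtain ⟨h1, h2⟩ := (edgeAt_mem_faceAt_iff hpos).1 h
    rcases h1 with rfl | rfl
    · exact ⟨d, hcd, faceAt_reach h2⟩
    · exact ⟨c, P.X_symm _ _ hcd, by rw [faceAt_reach h2, faceAt_swap]⟩
  · rintro ⟨b, hb, rfl⟩
    exact ⟨⟨x, a, b, hx, hb, rfl⟩, edgeAt_mem_faceAt_left _ _ _⟩

include hpos in
theorem isPolygonalComplex (r : ℕ) (hr : 2 ≤ r)
    (hcard : ∀ a, (Finset.univ.filter fun b => P.X a b = true).card = r)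
    (hpoly : ∀ x a b, P.X a b → IsPolygon (P.faceAt pos x a b))
    (hfin : ∀ C : Set E3, IsCompact C →
      {y | ∃ a, (edgeSegment (P.edgeAt pos y a) ∩ C).Nonempty}.Finite) :
    (P.complex pos).IsPolygonalComplex where
  not_isDiag := by
    rintro e ⟨x, a, hx, rfl⟩
    simp only [edgeAt, Sym2.mk_isDiag_iff]
    exact fun h => P.step_ne x a (hpos h).symm
  mem_verts := by
    rintro e ⟨x, a, hx, rfl⟩ v hv
    simp only [edgeAt, Sym2.mem_iff] at hv
    rcases hv with rfl | rfl
    · exact ⟨x, hx, rfl⟩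
    · exact ⟨_, hx.step a, rfl⟩
  isPolygon := by
    rintro F ⟨x, a, b, hx, hab, rfl⟩
    exact hpoly x a b hab
  mem_edges := by
    rintro F ⟨x, a, b, hx, hab, rfl⟩ e ⟨y, c, hy, -, rfl⟩
    exact ⟨y, c, hx.reach hy, rfl⟩
  connected := by
    have key : ∀ x (hx : P.V x), (P.complex pos).edgeGraph.Reachable
        ⟨pos 0, 0, V.zero, rfl⟩ ⟨pos x, x, hx, rfl⟩ := by
      intro x hx
      have hx' : P.Reach (fun _ => True) 0 x := hx
      induction hx' with
      | refl => exact SimpleGraph.Reachable.refl _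
      | @tail y z hy hyz ih =>
        obtain ⟨a, -, rfl⟩ := hyz
        refine (ih hy).trans (SimpleGraph.Adj.reachable ⟨?_, y, a, hy, rfl⟩)
        intro h
        exact P.step_ne y a (hpos (congrArg Subtype.val h)).symm
    refine SimpleGraph.connected_iff_exists_forall_reachable _ |>.2 ⟨⟨pos 0, 0, V.zero, rfl⟩, ?_⟩
    rintro ⟨v, x, hx, rfl⟩
    exact key x hx
  vertexFigure_connected := by
    rintro v ⟨x, hx, rfl⟩
    have hmem : ∀ a, s(pos (P.step x a), pos x) ∈ (P.complex pos).edges := fun a =>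
      (edge_at_iff hpos hx _).2 ⟨a, rfl⟩
    have key : ∀ a, ((P.complex pos).vertexFigure (pos x)).Reachable
        ⟨_, hmem P.base⟩ ⟨_, hmem a⟩ := by
      intro a
      have ha := P.X_conn P.base a
      induction ha with
      | refl => exact SimpleGraph.Reachable.refl _
      | @tail b c _ hbc ih =>
        refine ih.trans (SimpleGraph.Adj.reachable ⟨?_, _, ⟨x, b, c, hx, hbc, rfl⟩, ?_, ?_⟩)
        · intro h
          exact X_ne hbc (P.step_inj (hpos (congrArg Subtype.val h)))
        · rw [Sym2.eq_swap]; exact edgeAt_mem_faceAt_left _ _ _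
        · exact edgeAt_mem_faceAt_right _ _ _
    refine SimpleGraph.connected_iff_exists_forall_reachable _ |>.2 ⟨⟨_, hmem P.base⟩, ?_⟩
    rintro ⟨u, hu⟩
    obtain ⟨a, rfl⟩ := (edge_at_iff hpos hx u).1 hu
    exact key a
  faces_on_edge := by
    refine ⟨r, hr, ?_⟩
    rintro e ⟨x, a, hx, rfl⟩
    have : {F | F ∈ (P.complex pos).faces ∧ P.edgeAt pos x a ∈ F} =
        (fun b => P.faceAt pos x a b) '' (Finset.univ.filter fun b => P.X a b = true : Finset _) := by
      ext F
      rw [mem_ofPred_eq, face_at_iff hpos hx]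
      simp only [Finset.coe_filter, Finset.mem_univ, true_and, mem_image, mem_ofPred_eq]
      exact exists_congr fun b => and_congr_right fun _ => eq_comm
    rw [this, InjOn.encard_image, Set.encard_coe_eq_coe_finsetCard, hcard]
    intro b hb c hc hbc
    simp only [Finset.coe_filter, Finset.mem_univ, true_and, mem_ofPred_eq] at hb hc
    rcases ((faceAt_eq_iff hpos (X_ne hb)).1 hbc).1 with ⟨-, h⟩ | ⟨h, -⟩
    · exact h
    · exact absurd h (X_ne hc)
  discrete := by
    intro C hC
    -- A face meeting `C` has an edge meeting `C` and can be rebased at that edge, so finitely many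
    -- base points and colour pairs cover all such faces.
    refine (((hfin C hC).prod (Set.finite_univ (α := Fin n × Fin n))).image
      fun u => P.faceAt pos u.1 u.2.1 u.2.2).subset ?_
    rintro F ⟨⟨x, a, b, hx, hab, rfl⟩, z, hz, hzC⟩
    simp only [polygonBody, mem_iUnion] at hz
    obtain ⟨e, ⟨y, c, hy, hc, rfl⟩, hz⟩ := hz
    exact ⟨(y, a, b), ⟨⟨c, z, hz, hzC⟩, mem_univ _⟩, (faceAt_reach hy).symm⟩

theorem s_eq_one_or (x : Z3) (i : Fin 3) : P.s x i = 1 ∨ P.s x i = -1 :=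
  mul_self_eq_one_iff.1 (congrFun (P.s_sq x) i)

theorem finite_edges_meeting (hdir : ∀ a i, |P.dir a i| ≤ 1) (C : Set E3) (hC : IsCompact C) :
    {y | ∃ a, (edgeSegment (P.edgeAt castE y a) ∩ C).Nonempty}.Finite := by
  -- Coordinates change by at most 1 along an edge, so an edge has length at most `√3 < 2`.
  refine (finite_castE_mem (C := Metric.cthickening 2 C) hC.isBounded.cthickening).subset ?_
  rintro y ⟨a, z, hz, hzC⟩
  refine Metric.mem_cthickening_of_dist_le _ z _ _ hzC ?_
  have hz' : z ∈ segment ℝ (castE y) (castE (P.step y a)) := hz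
  have h1 : dist (castE y) z ≤ dist (castE y) (castE (P.step y a)) := by
    have := dist_add_dist_of_mem_segment hz'
    linarith [dist_nonneg (x := z) (y := castE (P.step y a))]
  refine h1.trans ?_
  rw [EuclideanSpace.dist_eq]
  refine Real.sqrt_le_iff.2 ⟨by norm_num, ?_⟩
  have key : ∀ i, dist (castE y i) (castE (P.step y a) i) ^ 2 ≤ 1 := by
    intro i
    have h2 : |P.s y i * P.dir a i| ≤ 1 := by
      rw [abs_mul]
      rcases P.s_eq_one_or y i with h | h <;> simpa [h] using hdir a i
    have h3 : |((P.s y i * P.dir a i : ℤ) : ℝ)| ≤ 1 := by exact_mod_cast h2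
    rw [Real.dist_eq, sq_abs]
    have h4 : castE y i - castE (P.step y a) i = -((P.s y i * P.dir a i : ℤ) : ℝ) := by
      simp [castE, step]
    rw [h4, neg_sq, ← sq_abs]
    exact pow_le_one₀ (abs_nonneg _) h3
  calc _ ≤ ∑ _i : Fin 3, (1 : ℝ) := Finset.sum_le_sum fun i _ => key i
    _ ≤ _ := by norm_num

/-- The complex spans the space. -/
theorem hull_complex (ε : ℤ) (h : ∀ i, ∃ a b, P.dir a + ε • P.dir b = Pi.single i 2) :
    (P.complex castE).hull = ⊤ := by
  have h0 : castE 0 = (0 : E3) := by ext i; simp [castE]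
  have hz : (0 : E3) ∈ (P.complex castE).hull :=
    subset_affineSpan ℝ _ ⟨0, V.zero, h0.symm⟩
  have hd : ∀ a, castE (P.dir a) ∈ (P.complex castE).hull.direction := by
    intro a
    have h1 : castE (P.step 0 a) ∈ (P.complex castE).hull :=
      subset_affineSpan ℝ _ ⟨_, V.zero.step a, rfl⟩
    have h2 := AffineSubspace.vsub_mem_direction h1 hz
    simpa [step, P.s_zero] using h2
  have hdir : (P.complex castE).hull.direction = ⊤ := by
    rw [eq_top_iff]
    intro v _
    have hv : v = ∑ i, v i • EuclideanSpace.single i (1 : ℝ) := by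
      ext j
      simp [Finset.sum_apply, Pi.single_apply]
    rw [hv]
    refine Submodule.sum_mem _ fun i _ => Submodule.smul_mem _ _ ?_
    obtain ⟨a, b, hab⟩ := h i
    have h3 : EuclideanSpace.single i (1 : ℝ) =
        (1 / 2 : ℝ) • (castE (P.dir a) + (ε : ℝ) • castE (P.dir b)) := by
      ext j
      have := congrFun hab j
      have h5 : ((P.dir a j + ε * P.dir b j : ℤ) : ℝ) = ((Pi.single i 2 : Z3) j : ℤ) := by
        rw [← this]; rfl
      push_cast at h5
      simp only [castE, PiLp.smul_apply, PiLp.add_apply, smul_eq_mul, h5]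
      by_cases hij : j = i
      · subst hij; simp
      · simp [hij]
    rw [h3]
    exact Submodule.smul_mem _ _ (Submodule.add_mem _ (hd a) (Submodule.smul_mem _ _ (hd b)))
  exact (AffineSubspace.direction_eq_top_iff_of_nonempty ⟨0, hz⟩).1 hdir

end Pattern

theorem infinite_of_isInfinitePolygon {F : Set (Sym2 E3)} (h : IsInfinitePolygon F) :
    F.Infinite := by
  obtain ⟨v, hv, rfl, -⟩ := h
  refine Set.infinite_range_of_injective fun i j hij => ?_
  simp only [Sym2.eq_iff, hv.eq_iff] at hij
  omega

theorem finite_of_isFinitePolygon {F : Set (Sym2 E3)} (h : IsFinitePolygon F) : F.Finite := by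
  obtain ⟨n, hn, v, hv, rfl⟩ := h
  have : NeZero n := ⟨by omega⟩
  exact Set.finite_range _

/-! ### Petrie pairs on a common star -/

/-- The permutation given by an involutory table. -/
def tablePerm {n : ℕ} (t : Fin n → Fin n) (h : ∀ i, t (t i) = i) : Equiv.Perm (Fin n) :=
  ⟨t, t, h, h⟩

/-- Signed permutations which generate the symmetry groups of two families of polygons on the same
star, the second family being obtained from the first by the Petrie operation. -/
structure Generators {n m₁ m₂ : ℕ} (S : StarData n) (Q₁ : S.Polygons m₁) (Q₂ : S.Polygons m₂) where
  a : Fin n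
  b : Fin n
  p : Fin m₁
  q : Fin m₂
  σ : Fin 3 → SignedPerm
  τ : Fin 3 → Equiv.Perm (Fin n)
  π₁ : Fin 3 → Equiv.Perm (Fin m₁)
  π₂ : Fin 3 → Equiv.Perm (Fin m₂)
  dir_τ : ∀ k c, S.dir (τ k c) = (σ k).act (S.dir c)
  adj₁ : ∀ k p c d, Q₁.adj (π₁ k p) (τ k c) (τ k d) = Q₁.adj p c d
  adj₂ : ∀ k p c d, Q₂.adj (π₂ k p) (τ k c) (τ k d) = Q₂.adj p c d
  base₁ : Q₁.adj p a b
  base₂ : Q₂.adj q a b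
  perm_sq : ∀ i, (σ 2).perm ((σ 2).perm i) = i
  sgn_sq : ∀ i, (σ 2).sgn i * (σ 2).sgn ((σ 2).perm i) = 1
  gen₁ : τ 0 a = b ∧ τ 0 b = a ∧ π₁ 0 p = p
  gen₂ : τ 1 a = a ∧ τ 1 b ≠ b ∧ π₁ 1 p = p ∧ π₂ 1 q = q
  gen₃ : τ 2 a = a ∧ τ 2 b = b ∧ π₁ 2 p ≠ p ∧ π₂ 2 q ≠ q
  petrie : π₂ 0 (π₂ 2 q) = q
  ne : ∀ q', ∃ c d, Q₁.adj p c d ≠ Q₂.adj q' c d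

namespace Generators

open PolyPattern Pattern

variable {n m₁ m₂ : ℕ} {S : StarData n} {Q₁ : S.Polygons m₁} {Q₂ : S.Polygons m₂}
  (G : Generators S Q₁ Q₂) (R : SignRule) (h : ∀ a, R.s (S.dir a) * S.dir a = -S.dir a)
  (f : E3 ≃ᵈ E3)

/-- The symmetries of the first apeirotope. -/
noncomputable def auto₁ (k : Fin 3) : Auto (S.polyPattern R h Q₁) (posOf f) :=
  (S.polyPattern R h Q₁).localAuto f (G.σ k) (G.τ k) (G.π₁ k) (R.s_act (G.σ k)) (G.dir_τ k)
    (G.adj₁ k)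

/-- The symmetries of the second apeirotope. -/
noncomputable def auto₂ (k : Fin 3) : Auto (S.polyPattern R h Q₂) (posOf f) :=
  (S.polyPattern R h Q₂).localAuto f (G.σ k) (G.τ k) (G.π₂ k) (R.s_act (G.σ k)) (G.dir_τ k)
    (G.adj₂ k)

theorem auto₁_zero (k : Fin 3) : (G.auto₁ R h f k).φ 0 = 0 :=
  localAuto_φ_zero (S.polyPattern R h Q₁) f _ _ _ _ _ _

theorem auto₂_zero (k : Fin 3) : (G.auto₂ R h f k).φ 0 = 0 :=
  localAuto_φ_zero (S.polyPattern R h Q₂) f _ _ _ _ _ _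

theorem isGen₁ : IsGen G.a G.b G.p (G.auto₁ R h f 0) (G.auto₁ R h f 1) (G.auto₁ R h f 2) where
  adj := G.base₁
  zero₁ := G.auto₁_zero R h f 0
  zero₂ := G.auto₁_zero R h f 1
  zero₃ := G.auto₁_zero R h f 2
  gen₁ := G.gen₁
  gen₂ := ⟨G.gen₂.1, G.gen₂.2.1, G.gen₂.2.2.1⟩
  gen₃ := ⟨G.gen₃.1, G.gen₃.2.1, G.gen₃.2.2.1⟩

/-- The product of the first and the third generator. -/
noncomputable def autoPetrie : Auto (S.polyPattern R h Q₂) (posOf f) :=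
  (G.auto₂ R h f 0).mul (G.auto₂ R h f 2) (by
    rw [G.auto₂_zero, G.auto₂_zero]; exact V.zero)

/-- The third generator fixes both base colours, so multiplying by it does not disturb how the first
interchanges them. Neither factor preserves the base Petrie polygon, but by `petrie` their product
does. -/
theorem isGen₂ : IsGen G.a G.b G.q (G.autoPetrie R h f) (G.auto₂ R h f 1) (G.auto₂ R h f 2) where
  adj := G.base₂
  zero₁ := by
    change (G.auto₂ R h f 0).φ ((G.auto₂ R h f 2).φ 0) = 0
    rw [G.auto₂_zero, G.auto₂_zero]
  zero₂ := G.auto₂_zero R h f 1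
  zero₃ := G.auto₂_zero R h f 2
  gen₁ := by
    refine ⟨?_, ?_, G.petrie⟩
    · change G.τ 0 (G.τ 2 G.a) = G.b
      rw [G.gen₃.1, G.gen₁.1]
    · change G.τ 0 (G.τ 2 G.b) = G.a
      rw [G.gen₃.2.1, G.gen₁.2.1]
  gen₂ := ⟨G.gen₂.1, G.gen₂.2.1, G.gen₂.2.2.2⟩
  gen₃ := ⟨G.gen₃.1, G.gen₃.2.1, G.gen₃.2.2.2⟩

/-- The third generator is an involution. -/
theorem auto_sq : (G.auto₁ R h f 2).g * (G.auto₁ R h f 2).g = 1 := by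
  ext1 x
  obtain ⟨x, rfl⟩ := f.surjective x
  change conjIso f _ (conjIso f _ (f x)) = f x
  rw [conjIso_apply, conjIso_apply]
  congr 1
  ext i
  have h1 : ((G.σ 2).sgn i : ℝ) * ((G.σ 2).sgn ((G.σ 2).perm i) : ℝ) = 1 := by
    exact_mod_cast G.sgn_sq i
  simp [SignedPerm.affineE, IsometryEquiv.mk', G.perm_sq, ← mul_assoc, h1]

include G in
theorem isPetrieDual :
    ((S.polyPattern R h Q₁).apeirotope (posOf f)).IsPetrieDual
      ((S.polyPattern R h Q₂).apeirotope (posOf f)) :=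
  ⟨_, _, _, (G.isGen₁ R h f).isDistinguished, (G.isGen₂ R h f).isDistinguished, rfl⟩

include G in
-- The Petrie operation is an involution because `T₃` is one: `(T₁T₃)T₃ = T₁`.
theorem isPetrieDual' :
    ((S.polyPattern R h Q₂).apeirotope (posOf f)).IsPetrieDual
      ((S.polyPattern R h Q₁).apeirotope (posOf f)) := by
  refine ⟨_, (S.polyPattern R h Q₁).flagAt (posOf f) 0 G.a G.b G.p, _,
    (G.isGen₂ R h f).isDistinguished, ?_, rfl⟩
  · have h1 := (G.isGen₁ R h f).isDistinguished
    convert h1 using 1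
    have hsq := G.auto_sq R h f
    funext k
    match k with
    | 0 => rfl
    | 1 =>
      change (G.auto₁ R h f 0).g * (G.auto₁ R h f 2).g * (G.auto₁ R h f 2).g = (G.auto₁ R h f 0).g
      rw [mul_assoc, hsq, mul_one]
    | 2 => rfl
    | 3 => rfl

include G in
-- The pairs of colours of the 2-faces in a facet recover its polygon, and by `ne` the base polygon
-- of the first family differs from every polygon of the second.
theorem apeirotope_ne : (S.polyPattern R h Q₁).apeirotope (posOf f) ≠
    (S.polyPattern R h Q₂).apeirotope (posOf f) := by
  intro e
  have h1 : (S.polyPattern R h Q₁).facetAt (posOf f) 0 G.p ∈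
      ((S.polyPattern R h Q₁).apeirotope (posOf f)).facets := ⟨0, G.p, V.zero, rfl⟩
  rw [e] at h1
  obtain ⟨y, q', hy, hC⟩ := h1
  have hinj := posOf_injective f
  obtain ⟨c, d, hcd⟩ := G.ne q'
  have key : ∀ c d, Q₁.adj G.p c d = true ↔ Q₂.adj q' c d = true := by
    intro c d
    constructor
    · intro hcd
      have hX : (S.pattern R h).X c d := decide_eq_true (Q₁.adj_X _ _ _ hcd)
      have h2 : (S.pattern R h).faceAt (posOf f) 0 c d ∈
          (S.polyPattern R h Q₁).facetAt (posOf f) 0 G.p := ⟨0, c, d, Reach.refl, hcd, rfl⟩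
      rw [hC] at h2
      exact ((faceAt_mem_facetAt_iff (P := S.polyPattern R h Q₂) hinj (X_ne hX)).1 h2).1
    · intro hcd
      have hX : (S.pattern R h).X c d := decide_eq_true (Q₂.adj_X _ _ _ hcd)
      have h2 : (S.pattern R h).faceAt (posOf f) y c d ∈
          (S.polyPattern R h Q₂).facetAt (posOf f) y q' := ⟨y, c, d, Reach.refl, hcd, rfl⟩
      rw [← hC] at h2
      exact ((faceAt_mem_facetAt_iff (P := S.polyPattern R h Q₁) hinj (X_ne hX)).1 h2).1
  exact hcd (Bool.eq_iff_iff.2 (key c d))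

end Generators

namespace PolyPattern

open Pattern

variable {n m : ℕ} {P : PolyPattern n m} {f : E3 ≃ᵈ E3} {a b : Fin n} {p : Fin m}
  {A₁ A₂ A₃ : Auto P (posOf f)}

theorem IsGen.exists_symmetry (h : IsGen a b p A₁ A₂ A₃) (Φ Ψ : RankFourData.Quad)
    (hΦ : (P.apeirotope (posOf f)).IsFlag Φ) (hΨ : (P.apeirotope (posOf f)).IsFlag Ψ) :
    ∃ g : E3 ≃ᵢ E3, (P.apeirotope (posOf f)).IsSymmetry g ∧ Φ.map g = Ψ := by
  obtain ⟨A, B, rfl, rfl⟩ := h.flag_transitive Φ Ψ hΦ hΨ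
  refine ⟨B.g * A.g⁻¹, isSymmetry_mul B.isSymmetry (map_symm_of_map A.isSymmetry), ?_⟩
  rw [IsometryEquiv.coe_mul, ← quad_map_map, quad_map_inv]

theorem IsGen.isRegularApeirotope (h : IsGen a b p A₁ A₂ A₃)
    (hinf : {x | P.V x}.Infinite) : (P.apeirotope (posOf f)).IsRegularApeirotope where
  isPolytope := isPolytope (posOf_injective f)
  infinite := by
    have : (P.apeirotope (posOf f)).verts = posOf f '' {x | P.V x} := by
      ext v
      constructor
      · rintro ⟨x, hx, rfl⟩; exact ⟨x, hx, rfl⟩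
      · rintro ⟨x, hx, rfl⟩; exact ⟨x, hx, rfl⟩
    rw [this]
    exact hinf.image (posOf_injective f).injOn
  discrete := by
    intro C hC
    refine ((finite_posOf_mem f hC.isBounded).image (posOf f)).subset ?_
    rintro v ⟨⟨x, hx, rfl⟩, hv⟩
    exact ⟨x, hv, rfl⟩
  flag_transitive := h.exists_symmetry

theorem complex_map_of_isSymmetry {pos : Z3 → E3} {g : E3 ≃ᵢ E3}
    (h : (P.apeirotope pos).IsSymmetry g) : (P.complex pos).map g = P.complex pos := by
  have h' : (P.apeirotope pos).map g = P.apeirotope pos := h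
  apply CellData.ext
  · exact congrArg RankFourData.verts h'
  · exact congrArg RankFourData.edges h'
  · exact congrArg RankFourData.faces h'

theorem exists_flag_of_triple {pos : Z3 → E3} (hpos : Function.Injective pos)
    {Φ : CellData.Triple} (hΦ : (P.complex pos).IsFlag Φ) :
    ∃ C, (P.apeirotope pos).IsFlag ⟨Φ.vert, Φ.edge, Φ.face, C⟩ := by
  obtain ⟨C, hC, hF⟩ := (isPolytope (P := P) hpos).face_above Φ.face hΦ.face_mem
  exact ⟨C, hΦ.vert_mem, hΦ.edge_mem, hΦ.face_mem, hC, hΦ.vert_edge, hΦ.edge_face, hF⟩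

/-- Flags of the 2-skeleton extend to flags of rank 4, so transitivity is inherited. The third
generator fixes vertex, edge and 2-face but moves the facet, so it is a non-trivial flag stabilizer.
-/
theorem IsGen.isRegularComplex {A₁ A₂ A₃ : Auto P (posOf (DilationEquiv.refl E3))}
    (h : IsGen a b p A₁ A₂ A₃) (hK : (P.complex castE).IsPolygonalComplex)
    (hhull : (P.complex castE).hull = ⊤) :
    (P.complex castE).IsRegularComplex ∧ (P.complex castE).HasNontrivialFlagStabilizer := by
  refine ⟨⟨hK, fun Φ Ψ hΦ hΨ => ?_⟩, ?_⟩
  · obtain ⟨C, hC⟩ := exists_flag_of_triple castE_injective hΦ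
    obtain ⟨D, hD⟩ := exists_flag_of_triple castE_injective hΨ
    obtain ⟨g, hg, hgm⟩ := h.exists_symmetry _ _ hC hD
    refine ⟨_, CellData.restrictHull_mem _ hhull (complex_map_of_isSymmetry hg), ?_⟩
    rw [CellData.hullAct_restrictHull]
    exact CellData.Triple.ext (congrArg RankFourData.Quad.vert hgm)
      (congrArg RankFourData.Quad.edge hgm) (congrArg RankFourData.Quad.face hgm)
  · have hfl := flag_isFlag (P := P) (pos := castE) V.zero h.adj
    refine ⟨⟨castE 0, P.edgeAt castE 0 a, P.faceAt castE 0 a b⟩,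
      ⟨hfl.vert_mem, hfl.edge_mem, hfl.face_mem, hfl.vert_edge, hfl.edge_face⟩, _,
      CellData.restrictHull_mem _ hhull (complex_map_of_isSymmetry A₃.isSymmetry), ?_, ?_⟩
    · intro e
      have e1 : (A₃.g : E3 → E3) = id := by
        rw [← CellData.hullAct_restrictHull (P.complex castE) hhull A₃.g, e, CellData.hullAct_one]
        rfl
      have e2 := A₃.map_flag 0 a b p
      rw [e1] at e2
      have e3 : P.facetAt (posOf (DilationEquiv.refl E3)) 0 p =
          P.facetAt (posOf (DilationEquiv.refl E3)) (A₃.φ 0) (A₃.π p) := by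
        have := congrArg RankFourData.Quad.facet e2
        simpa [RankFourData.Quad.map, flagAt] using this
      exact h.gen₃.2.2 ((facetAt_eq_iff (posOf_injective _)).1 e3).1.symm
    · rw [CellData.hullAct_restrictHull]
      refine CellData.Triple.ext ?_ ?_ ?_
      · refine (A₃.g_pos 0).trans ?_
        rw [h.zero₃]; rfl
      · refine (A₃.map_edge 0 a).trans ?_
        rw [h.zero₃, h.gen₃.1]; rfl
      · refine (A₃.map_face 0 a b).trans ?_
        rw [h.zero₃, h.gen₃.1, h.gen₃.2.1]; rfl

end PolyPattern

/-! ### The four complexes and their pairs of apeirotopes -/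

/-- Generators for the tetrahedron. -/
def tetraGen : Generators tetraStar tetraFaces tetraPetrie where
  a := 0
  b := 1
  p := 2
  q := 1
  -- Three reflections of the solid: one interchanges the ends of the base edge within the base
  -- face, one fixes `a` and turns the face over, one fixes the edge and changes the face. The same
  -- scheme is used for the octahedron and the cube.
  σ := ![⟨Equiv.swap 1 2, ![1, -1, -1], by decide⟩, ⟨Equiv.swap 0 2, ![1, 1, 1], by decide⟩,
    ⟨Equiv.swap 1 2, ![1, 1, 1], by decide⟩]
  τ := ![Equiv.swap 0 1, Equiv.swap 1 3, Equiv.swap 2 3]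
  π₁ := ![Equiv.swap 0 1, Equiv.swap 1 3, Equiv.swap 2 3]
  π₂ := ![Equiv.swap 1 2, Equiv.swap 0 2, Equiv.swap 1 2]
  dir_τ := by decide +kernel
  adj₁ := by decide +kernel
  adj₂ := by decide +kernel
  base₁ := by decide +kernel
  base₂ := by decide +kernel
  perm_sq := by decide +kernel
  sgn_sq := by decide +kernel
  gen₁ := by decide +kernel
  gen₂ := by decide +kernel
  gen₃ := by decide +kernel
  petrie := by decide +kernel
  ne := by decide +kernel

/-- Generators for the octahedron. -/
def octaGen : Generators octaStar octaFaces octaPetrie where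
  a := 0
  b := 2
  p := 0
  q := 1
  σ := ![⟨Equiv.swap 0 1, ![1, 1, 1], by decide⟩, ⟨Equiv.swap 1 2, ![1, 1, 1], by decide⟩,
    ⟨1, ![1, 1, -1], by decide⟩]
  τ := ![tablePerm ![2, 3, 0, 1, 4, 5] (by decide), tablePerm ![0, 1, 4, 5, 2, 3] (by decide),
    Equiv.swap 4 5]
  π₁ := ![tablePerm ![0, 2, 1, 3, 4, 6, 5, 7] (by decide),
    tablePerm ![0, 1, 3, 2, 4, 5, 7, 6] (by decide),
    tablePerm ![3, 6, 5, 0, 7, 2, 1, 4] (by decide)]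
  π₂ := ![Equiv.swap 1 2, Equiv.swap 2 3, tablePerm ![3, 2, 1, 0] (by decide)]
  dir_τ := by decide +kernel
  adj₁ := by decide +kernel
  adj₂ := by decide +kernel
  base₁ := by decide +kernel
  base₂ := by decide +kernel
  perm_sq := by decide +kernel
  sgn_sq := by decide +kernel
  gen₁ := by decide +kernel
  gen₂ := by decide +kernel
  gen₃ := by decide +kernel
  petrie := by decide +kernel
  ne := by decide +kernel

/-- Generators for the cube. -/
def cubeGen : Generators cubeStar cubeFaces cubePetrie where
  a := 0
  b := 1
  p := 2
  q := 2
  σ := ![⟨1, ![-1, 1, 1], by decide⟩, ⟨Equiv.swap 0 2, ![1, 1, 1], by decide⟩,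
    ⟨Equiv.swap 1 2, ![1, 1, 1], by decide⟩]
  τ := ![tablePerm ![1, 0, 7, 6, 5, 4, 3, 2] (by decide),
    tablePerm ![0, 3, 2, 1, 4, 7, 6, 5] (by decide),
    tablePerm ![0, 1, 3, 2, 4, 5, 7, 6] (by decide)]
  π₁ := ![Equiv.swap 0 1, tablePerm ![4, 5, 2, 3, 0, 1] (by decide),
    tablePerm ![0, 1, 4, 5, 2, 3] (by decide)]
  π₂ := ![tablePerm ![1, 0, 3, 2] (by decide), Equiv.swap 1 3, Equiv.swap 2 3]
  dir_τ := by decide +kernel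
  adj₁ := by decide +kernel
  adj₂ := by decide +kernel
  base₁ := by decide +kernel
  base₂ := by decide +kernel
  perm_sq := by decide +kernel
  sgn_sq := by decide +kernel
  gen₁ := by decide +kernel
  gen₂ := by decide +kernel
  gen₃ := by decide +kernel
  petrie := by decide +kernel
  ne := by decide +kernel

theorem Generators.exists_petrie_pair {n m₁ m₂ : ℕ} {S : StarData n} {Q₁ : S.Polygons m₁}
    {Q₂ : S.Polygons m₂} (G : Generators S Q₁ Q₂) (R : SignRule)
    (h : ∀ a, R.s (S.dir a) * S.dir a = -S.dir a) (hinf : {x | (S.pattern R h).V x}.Infinite)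
    (f : E3 ≃ᵈ E3) :
    ∃ P Q : RankFourData, P.IsRegularApeirotope ∧ Q.IsRegularApeirotope ∧ P ≠ Q ∧
      P.IsPetrieDual Q ∧ Q.IsPetrieDual P ∧ P.twoSkeleton = (S.pattern R h).complex (posOf f) ∧
      Q.twoSkeleton = (S.pattern R h).complex (posOf f) :=
  ⟨_, _, (G.isGen₁ R h f).isRegularApeirotope hinf, (G.isGen₂ R h f).isRegularApeirotope hinf,
    G.apeirotope_ne R h f, G.isPetrieDual R h f, G.isPetrieDual' R h f, rfl, rfl⟩

theorem Generators.isRegularComplex {n m₁ m₂ : ℕ} {S : StarData n} {Q₁ : S.Polygons m₁}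
    {Q₂ : S.Polygons m₂} (G : Generators S Q₁ Q₂) (R : SignRule)
    (h : ∀ a, R.s (S.dir a) * S.dir a = -S.dir a) (r : ℕ) (hr : 2 ≤ r)
    (hcard : ∀ a, (Finset.univ.filter fun b => (S.pattern R h).X a b = true).card = r)
    (hdir : ∀ a i, |S.dir a i| ≤ 1) (ε : ℤ)
    (hspan : ∀ i, ∃ a b, S.dir a + ε • S.dir b = Pi.single i 2)
    (hpoly : ∀ x a b, (S.pattern R h).X a b → IsPolygon ((S.pattern R h).faceAt castE x a b)) :
    ((S.pattern R h).complex castE).IsRegularComplex ∧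
      ((S.pattern R h).complex castE).HasNontrivialFlagStabilizer :=
  (G.isGen₁ R h (DilationEquiv.refl E3)).isRegularComplex
    (Pattern.isPolygonalComplex castE_injective r hr hcard hpoly
      (Pattern.finite_edges_meeting (P := S.pattern R h) hdir))
    (Pattern.hull_complex (P := S.pattern R h) ε hspan)

/-- The diamond net, with zigzag faces. -/
def tetraPattern : Pattern 4 := tetraStar.pattern zigzagRule (by decide +kernel)

/-- The cubical lattice, with zigzag faces. -/
def octaPattern : Pattern 6 := octaStar.pattern zigzagRule (by decide +kernel)

/-- The body-centred cubic lattice, with zigzag faces. -/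
def cubePattern : Pattern 8 := cubeStar.pattern zigzagRule (by decide +kernel)

/-- The cubical lattice, with square faces. -/
def squarePattern : Pattern 6 := octaStar.pattern squareRule (by decide +kernel)

theorem tetra_sign : ∀ a, tetraPattern.s (tetraPattern.dir a) = -1 := by decide +kernel
theorem octa_sign : ∀ a, octaPattern.s (octaPattern.dir a) = -1 := by decide +kernel
theorem cube_sign : ∀ a, cubePattern.s (cubePattern.dir a) = -1 := by decide +kernel

theorem square_comm : ∀ a b, squarePattern.X a b →
    squarePattern.s (squarePattern.dir a) * squarePattern.dir b = squarePattern.dir b := by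
  decide +kernel

theorem tetraDir_le : ∀ a i, |tetraPattern.dir a i| ≤ 1 := by decide +kernel
theorem octaDir_le : ∀ a i, |octaPattern.dir a i| ≤ 1 := by decide +kernel
theorem cubeDir_le : ∀ a i, |cubePattern.dir a i| ≤ 1 := by decide +kernel

theorem tetra_face (x : Z3) (a b : Fin 4) (h : tetraPattern.X a b) :
    IsInfinitePolygon (tetraPattern.faceAt castE x a b) :=
  Pattern.isPolygon_zigzag tetra_sign castE_injective
    (Pattern.finite_edges_meeting tetraDir_le) x (Pattern.X_ne h)

theorem octa_face (x : Z3) (a b : Fin 6) (h : octaPattern.X a b) :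
    IsInfinitePolygon (octaPattern.faceAt castE x a b) :=
  Pattern.isPolygon_zigzag octa_sign castE_injective
    (Pattern.finite_edges_meeting octaDir_le) x (Pattern.X_ne h)

theorem cube_face (x : Z3) (a b : Fin 8) (h : cubePattern.X a b) :
    IsInfinitePolygon (cubePattern.faceAt castE x a b) :=
  Pattern.isPolygon_zigzag cube_sign castE_injective
    (Pattern.finite_edges_meeting cubeDir_le) x (Pattern.X_ne h)

theorem square_face (x : Z3) (a b : Fin 6) (h : squarePattern.X a b) :
    IsFinitePolygon (squarePattern.faceAt castE x a b) :=
  Pattern.isPolygon_square castE_injective x (Pattern.X_ne h) (square_comm a b h)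
    (square_comm b a (squarePattern.X_symm a b h))

theorem tetra_regular : (tetraPattern.complex castE).IsRegularComplex ∧
    (tetraPattern.complex castE).HasNontrivialFlagStabilizer :=
  -- The final 1: sums of two tetrahedral directions give twice the coordinate vectors. For the
  -- octahedron and the cube differences do, whence -1 there.
  tetraGen.isRegularComplex zigzagRule _ 3 (by norm_num) (by decide +kernel) tetraDir_le 1
    (by decide +kernel) fun x a b h => Or.inr (tetra_face x a b h)

theorem octa_regular : (octaPattern.complex castE).IsRegularComplex ∧
    (octaPattern.complex castE).HasNontrivialFlagStabilizer :=
  octaGen.isRegularComplex zigzagRule _ 4 (by norm_num) (by decide +kernel) octaDir_le (-1)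
    (by decide +kernel) fun x a b h => Or.inr (octa_face x a b h)

theorem cube_regular : (cubePattern.complex castE).IsRegularComplex ∧
    (cubePattern.complex castE).HasNontrivialFlagStabilizer :=
  cubeGen.isRegularComplex zigzagRule _ 3 (by norm_num) (by decide +kernel) cubeDir_le (-1)
    (by decide +kernel) fun x a b h => Or.inr (cube_face x a b h)

theorem square_regular : (squarePattern.complex castE).IsRegularComplex ∧
    (squarePattern.complex castE).HasNontrivialFlagStabilizer :=
  octaGen.isRegularComplex squareRule _ 4 (by norm_num) (by decide +kernel) octaDir_le (-1)
    (by decide +kernel) fun x a b h => Or.inl (square_face x a b h)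

theorem tetra_petrie (f : E3 ≃ᵈ E3) :
    ∃ P Q : RankFourData, P.IsRegularApeirotope ∧ Q.IsRegularApeirotope ∧ P ≠ Q ∧
      P.IsPetrieDual Q ∧ Q.IsPetrieDual P ∧ P.twoSkeleton = tetraPattern.complex (posOf f) ∧
      Q.twoSkeleton = tetraPattern.complex (posOf f) :=
  tetraGen.exists_petrie_pair zigzagRule _
    (Pattern.infinite_V (P := tetraPattern) (a := 0) (b := 1) (by decide +kernel)
      (by decide +kernel)) f

theorem octa_petrie (f : E3 ≃ᵈ E3) :
    ∃ P Q : RankFourData, P.IsRegularApeirotope ∧ Q.IsRegularApeirotope ∧ P ≠ Q ∧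
      P.IsPetrieDual Q ∧ Q.IsPetrieDual P ∧ P.twoSkeleton = octaPattern.complex (posOf f) ∧
      Q.twoSkeleton = octaPattern.complex (posOf f) :=
  octaGen.exists_petrie_pair zigzagRule _
    (Pattern.infinite_V (P := octaPattern) (a := 0) (b := 1) (by decide +kernel)
      (by decide +kernel)) f

theorem cube_petrie (f : E3 ≃ᵈ E3) :
    ∃ P Q : RankFourData, P.IsRegularApeirotope ∧ Q.IsRegularApeirotope ∧ P ≠ Q ∧
      P.IsPetrieDual Q ∧ Q.IsPetrieDual P ∧ P.twoSkeleton = cubePattern.complex (posOf f) ∧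
      Q.twoSkeleton = cubePattern.complex (posOf f) :=
  cubeGen.exists_petrie_pair zigzagRule _
    (Pattern.infinite_V (P := cubePattern) (a := 0) (b := 1) (by decide +kernel)
      (by decide +kernel)) f

theorem square_petrie (f : E3 ≃ᵈ E3) :
    ∃ P Q : RankFourData, P.IsRegularApeirotope ∧ Q.IsRegularApeirotope ∧ P ≠ Q ∧
      P.IsPetrieDual Q ∧ Q.IsPetrieDual P ∧ P.twoSkeleton = squarePattern.complex (posOf f) ∧
      Q.twoSkeleton = squarePattern.complex (posOf f) :=
  octaGen.exists_petrie_pair squareRule _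
    (Pattern.infinite_V (P := squarePattern) (a := 0) (b := 1) (by decide +kernel)
      (by decide +kernel)) f

/-- The four complexes. -/
noncomputable def fourComplexes : Fin 4 → CellData :=
  ![tetraPattern.complex castE, octaPattern.complex castE, cubePattern.complex castE,
    squarePattern.complex castE]

/-! ### The four complexes are pairwise not similar -/

namespace CellData

/-- All vertices have `d` neighbours. -/
def HasDegree (K : CellData) (d : ℕ) : Prop :=
  ∀ v ∈ K.verts, {u | s(u, v) ∈ K.edges}.ncard = d

theorem HasDegree.map {K : CellData} {d : ℕ} (h : K.HasDegree d) (f : E3 ≃ᵈ E3) :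
    (K.map f).HasDegree d := by
  rintro _ ⟨v, hv, rfl⟩
  have : {u | s(u, f v) ∈ (K.map f).edges} = f '' {u | s(u, v) ∈ K.edges} := by
    ext u
    obtain ⟨u, rfl⟩ := f.surjective u
    have h1 : s(f u, f v) = Sym2.map f s(u, v) := rfl
    simp only [CellData.map, mem_ofPred_eq, h1]
    rw [(Sym2.map.injective f.injective).mem_set_image, f.injective.mem_set_image]
    rfl
  rw [this, ncard_image_of_injective _ f.injective, h v hv]

end CellData

theorem Pattern.hasDegree_complex {n : ℕ} (P : Pattern n) : (P.complex castE).HasDegree n := by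
  rintro v ⟨x, hx, rfl⟩
  have : {u | s(u, castE x) ∈ (P.complex castE).edges} =
      (fun a => castE (P.step x a)) '' univ := by
    ext u
    rw [mem_ofPred_eq, Pattern.edge_at_iff castE_injective hx]
    simp [eq_comm]
  rw [this, ncard_image_of_injective _ fun a b h => P.step_inj (castE_injective h)]
  simp

theorem Pattern.zero_mem_complex {n : ℕ} (P : Pattern n) :
    castE 0 ∈ (P.complex castE).verts := ⟨0, Pattern.V.zero, rfl⟩

/-- The number of neighbours of a vertex is a similarity invariant; it distinguishes the values 4, 6
and 8. -/
theorem degree_eq_of_similar {n m : ℕ} {P : Pattern n} {Q : Pattern m}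
    (h : (P.complex castE).Similar (Q.complex castE)) : n = m := by
  obtain ⟨f, hf⟩ := h
  have h1 := P.hasDegree_complex.map f
  rw [hf] at h1
  exact (h1 _ Q.zero_mem_complex).symm.trans (Q.hasDegree_complex _ Q.zero_mem_complex)

/-- The degrees agree, but one complex has finite faces and the other infinite ones. -/
theorem octa_not_similar_square :
    ¬ (octaPattern.complex castE).Similar (squarePattern.complex castE) := by
  rintro ⟨f, hf⟩
  have h1 : squarePattern.faceAt castE 0 0 2 ∈ (squarePattern.complex castE).faces :=
    ⟨0, 0, 2, Pattern.V.zero, by decide +kernel, rfl⟩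
  have h2 := finite_of_isFinitePolygon (square_face 0 0 2 (by decide +kernel))
  rw [← hf] at h1
  obtain ⟨F, ⟨x, a, b, hx, hab, rfl⟩, hF⟩ := h1
  have h3 := infinite_of_isInfinitePolygon (octa_face x a b hab)
  rw [← hF] at h2
  exact (h3.image (Sym2.map.injective f.injective).injOn) h2

theorem CellData.Similar.symm {K L : CellData} (h : K.Similar L) : L.Similar K := by
  obtain ⟨f, rfl⟩ := h
  refine ⟨f.symm, ?_⟩
  rw [CellData.map_map]
  have : (f.symm : E3 → E3) ∘ f = id := by funext x; simp
  rw [this, CellData.map_id]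

theorem fourComplexes_injective (i j : Fin 4)
    (h : (fourComplexes i).Similar (fourComplexes j)) : i = j := by
  fin_cases i <;> fin_cases j
  · rfl
  · exact absurd (degree_eq_of_similar (P := tetraPattern) (Q := octaPattern) h) (by decide)
  · exact absurd (degree_eq_of_similar (P := tetraPattern) (Q := cubePattern) h) (by decide)
  · exact absurd (degree_eq_of_similar (P := tetraPattern) (Q := squarePattern) h) (by decide)
  · exact absurd (degree_eq_of_similar (P := octaPattern) (Q := tetraPattern) h) (by decide)
  · rfl
  · exact absurd (degree_eq_of_similar (P := octaPattern) (Q := cubePattern) h) (by decide)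
  · exact absurd h octa_not_similar_square
  · exact absurd (degree_eq_of_similar (P := cubePattern) (Q := tetraPattern) h) (by decide)
  · exact absurd (degree_eq_of_similar (P := cubePattern) (Q := octaPattern) h) (by decide)
  · rfl
  · exact absurd (degree_eq_of_similar (P := cubePattern) (Q := squarePattern) h) (by decide)
  · exact absurd (degree_eq_of_similar (P := squarePattern) (Q := tetraPattern) h) (by decide)
  · exact absurd h.symm octa_not_similar_square
  · exact absurd (degree_eq_of_similar (P := squarePattern) (Q := cubePattern) h) (by decide)
  · rfl

theorem Pattern.complex_map {n : ℕ} (P : Pattern n) (f : E3 ≃ᵈ E3) :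
    (P.complex castE).map f = P.complex (posOf f) := by
  have he : ∀ x a, Sym2.map f (P.edgeAt castE x a) = P.edgeAt (posOf f) x a := fun x a => rfl
  have hF : ∀ x a b, Sym2.map f '' (P.faceAt castE x a b) = P.faceAt (posOf f) x a b := by
    intro x a b
    ext e
    constructor
    · rintro ⟨_, ⟨y, c, hy, hc, rfl⟩, rfl⟩; exact ⟨y, c, hy, hc, rfl⟩
    · rintro ⟨y, c, hy, hc, rfl⟩; exact ⟨_, ⟨y, c, hy, hc, rfl⟩, rfl⟩
  apply CellData.ext
  · ext v
    constructor
    · rintro ⟨_, ⟨x, hx, rfl⟩, rfl⟩; exact ⟨x, hx, rfl⟩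
    · rintro ⟨x, hx, rfl⟩; exact ⟨_, ⟨x, hx, rfl⟩, rfl⟩
  · ext v
    constructor
    · rintro ⟨_, ⟨x, a, hx, rfl⟩, rfl⟩; exact ⟨x, a, hx, rfl⟩
    · rintro ⟨x, a, hx, rfl⟩; exact ⟨_, ⟨x, a, hx, rfl⟩, rfl⟩
  · ext v
    constructor
    · rintro ⟨_, ⟨x, a, b, hx, hab, rfl⟩, rfl⟩; exact ⟨x, a, b, hx, hab, hF x a b⟩
    · rintro ⟨x, a, b, hx, hab, rfl⟩; exact ⟨_, ⟨x, a, b, hx, hab, rfl⟩, hF x a b⟩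

/-- The four complexes, up to a given similarity. -/
def IsStandard (K : CellData) (f : E3 ≃ᵈ E3) : Prop :=
  K = tetraPattern.complex (posOf f) ∨ K = octaPattern.complex (posOf f) ∨
    K = cubePattern.complex (posOf f) ∨ K = squarePattern.complex (posOf f)

theorem similar_of_isStandard {K : CellData} {f : E3 ≃ᵈ E3} (h : IsStandard K f) :
    ∃ i, K.Similar (fourComplexes i) := by
  rcases h with rfl | rfl | rfl | rfl
  · exact ⟨0, CellData.Similar.symm ⟨f, tetraPattern.complex_map f⟩⟩
  · exact ⟨1, CellData.Similar.symm ⟨f, octaPattern.complex_map f⟩⟩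
  · exact ⟨2, CellData.Similar.symm ⟨f, cubePattern.complex_map f⟩⟩
  · exact ⟨3, CellData.Similar.symm ⟨f, squarePattern.complex_map f⟩⟩

theorem petrie_of_isStandard {K : CellData} {f : E3 ≃ᵈ E3} (h : IsStandard K f) :
    ∃ P Q : RankFourData, P.IsRegularApeirotope ∧ Q.IsRegularApeirotope ∧ P ≠ Q ∧
      P.IsPetrieDual Q ∧ Q.IsPetrieDual P ∧ P.twoSkeleton = K ∧ Q.twoSkeleton = K := by
  rcases h with rfl | rfl | rfl | rfl
  · exact tetra_petrie f
  · exact octa_petrie f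
  · exact cube_petrie f
  · exact square_petrie f

theorem fourComplexes_regular (i : Fin 4) :
    (fourComplexes i).IsRegularComplex ∧ (fourComplexes i).HasNontrivialFlagStabilizer := by
  fin_cases i
  · exact tetra_regular
  · exact octa_regular
  · exact cube_regular
  · exact square_regular

/-! ### Polygons, and points determined by distances -/

theorem IsPolygon.exists_param {F : Set (Sym2 E3)} (h : IsPolygon F) :
    ∃ n : ℕ, n ≠ 1 ∧ n ≠ 2 ∧ ∃ v : ZMod n → E3, Function.Injective v ∧
      F = range fun i : ZMod n => s(v i, v (i + 1)) := by
  rcases h with ⟨n, hn, v, hv, hF⟩ | ⟨v, hv, hF, -⟩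
  · exact ⟨n, by omega, by omega, v, hv, hF⟩
  -- As `ZMod 0` is `ℤ`, both kinds of polygon are indexed by some `ZMod n`. Excluding `n = 1, 2`
  -- makes `2 ≠ 0` there, which is what keeps the two neighbours of a vertex apart.
  · exact ⟨0, by omega, by omega, v, hv, hF⟩

theorem zmod_two_ne_zero {n : ℕ} (h1 : n ≠ 1) (h2 : n ≠ 2) : (2 : ZMod n) ≠ 0 := by
  intro h
  have h' : ((2 : ℕ) : ZMod n) = 0 := by exact_mod_cast h
  rw [ZMod.natCast_eq_zero_iff] at h'
  have := Nat.le_of_dvd (by norm_num) h'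
  interval_cases n <;> simp_all

/-- Each vertex of a polygon has two neighbours. -/
theorem IsPolygon.exists_other {F : Set (Sym2 E3)} (h : IsPolygon F) {v u : E3}
    (hu : s(v, u) ∈ F) : ∃ w, w ≠ u ∧ s(v, w) ∈ F ∧ ∀ x, s(v, x) ∈ F → x = u ∨ x = w := by
  obtain ⟨n, h1, h2, p, hp, rfl⟩ := h.exists_param
  have h20 := zmod_two_ne_zero h1 h2
  have key : ∀ i x, s(p i, x) ∈ (range fun i : ZMod n => s(p i, p (i + 1))) ↔
      x = p (i + 1) ∨ x = p (i - 1) := by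
    intro i x
    constructor
    · rintro ⟨j, hj⟩
      simp only [Sym2.eq_iff] at hj
      rcases hj with ⟨e1, e2⟩ | ⟨e1, e2⟩
      · rw [← e2, hp e1]; exact Or.inl rfl
      · right
        rw [← e1, ← hp e2, add_sub_cancel_right]
    · rintro (rfl | rfl)
      · exact ⟨i, rfl⟩
      · exact ⟨i - 1, by simp [Sym2.eq_swap]⟩
  have hne : ∀ i : ZMod n, p (i + 1) ≠ p (i - 1) := by
    intro i e
    have := hp e
    apply h20
    linear_combination this
  obtain ⟨i, rfl⟩ : ∃ i, v = p i := by
    obtain ⟨j, hj⟩ := hu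
    simp only [Sym2.eq_iff] at hj
    rcases hj with ⟨e1, -⟩ | ⟨-, e2⟩
    · exact ⟨j, e1.symm⟩
    · exact ⟨j + 1, e2.symm⟩
  rcases (key i u).1 hu with rfl | rfl
  · exact ⟨p (i - 1), (hne i).symm, (key i _).2 (Or.inr rfl), fun x hx => (key i x).1 hx⟩
  · exact ⟨p (i + 1), hne i, (key i _).2 (Or.inl rfl), fun x hx => ((key i x).1 hx).symm⟩

/-- Polygons are connected. -/
theorem IsPolygon.induction {F : Set (Sym2 E3)} (h : IsPolygon F) {S : E3 → Prop}
    (hS : ∀ x y, s(x, y) ∈ F → S x → S y) {v u x y : E3} (hv : S v) (hvu : s(v, u) ∈ F)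
    (hxy : s(x, y) ∈ F) : S x := by
  obtain ⟨n, h1, h2, p, hp, rfl⟩ := h.exists_param
  have hmem : ∀ v u, s(v, u) ∈ (range fun i : ZMod n => s(p i, p (i + 1))) → ∃ i, v = p i := by
    rintro v u ⟨j, hj⟩
    simp only [Sym2.eq_iff] at hj
    rcases hj with ⟨e1, -⟩ | ⟨-, e2⟩
    · exact ⟨j, e1.symm⟩
    · exact ⟨j + 1, e2.symm⟩
  obtain ⟨i, rfl⟩ := hmem _ _ hvu
  obtain ⟨j, rfl⟩ := hmem _ _ hxy
  have key : ∀ k : ℤ, S (p (i + k)) := by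
    intro k
    induction k using Int.induction_on with
    | zero => simpa using hv
    | succ k ih =>
      refine hS _ _ ⟨i + (k : ℤ), ?_⟩ ih
      push_cast
      rw [add_assoc]
    | pred k ih =>
      refine hS _ _ ⟨i + ((-(k : ℤ) - 1 : ℤ) : ZMod n), ?_⟩ ih
      rw [Sym2.eq_swap]
      push_cast
      congr 2
      ring_nf
  obtain ⟨k, hk⟩ := ZMod.intCast_surjective (j - i)
  have := key k
  rwa [hk, add_sub_cancel] at this

/-- A map fixing an edge of a polygon with its end points and preserving the polygon fixes all
vertices. -/
theorem IsPolygon.fixes {F : Set (Sym2 E3)} (h : IsPolygon F) {g : E3 → E3}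
    (hg : Function.Injective g) (hgF : ∀ e ∈ F, Sym2.map g e ∈ F) {v u x y : E3}
    (hvu : s(v, u) ∈ F) (hv : g v = v) (hu : g u = u) (hxy : s(x, y) ∈ F) : g x = x := by
  have other : ∀ x y, s(x, y) ∈ F → g x = x → g y = y → ∀ z, s(x, z) ∈ F → g z = z := by
    intro x y hxy hx hy z hz
    by_cases e : z = y
    · rw [e, hy]
    obtain ⟨w, hw, hw', hall⟩ := h.exists_other hxy
    have hz' := (hall z hz).resolve_left e
    have h1 : s(x, g z) ∈ F := by
      have := hgF _ hz
      rwa [Sym2.map_mk, hx] at this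
    rcases hall _ h1 with h2 | h2
    · exact absurd (hg (h2.trans hy.symm)) e
    · rw [h2, hz']
  refine (h.induction (S := fun x => g x = x ∧ ∀ z, s(x, z) ∈ F → g z = z) ?_
    ⟨hv, other v u hvu hv hu⟩ hvu hxy).1
  rintro x y hxy ⟨hx, hall⟩
  have hy := hall y hxy
  exact ⟨hy, other y x (by rwa [Sym2.eq_swap]) hy hx⟩

/-- By polarization the inner product with `p - v` is an affine function of squared distances to `v`
and `p`, so points at equal distances have equal inner products. -/
theorem inner_sub_eq_of_dist {x y v p : E3} (h1 : dist x v = dist y v) (h2 : dist x p = dist y p) :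
    inner ℝ (x - y) (p - v) = 0 := by
  have key : ∀ z : E3, inner ℝ (z - v) (p - v) =
      (dist z v ^ 2 + dist p v ^ 2 - dist z p ^ 2) / 2 := by
    intro z
    have h := norm_sub_sq_real (z - v) (p - v)
    rw [sub_sub_sub_cancel_right] at h
    simp only [dist_eq_norm]
    linarith
  have e : x - y = (x - v) - (y - v) := by abel
  rw [e, inner_sub_left, key, key, h1, h2, sub_self]

/-- Points are determined by their distances from a spanning set. -/
theorem eq_of_dist_eq {A : Set E3} {x y v : E3}
    (hx : x - v ∈ Submodule.span ℝ ((fun p => p - v) '' A))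
    (hy : y - v ∈ Submodule.span ℝ ((fun p => p - v) '' A)) (hv : dist x v = dist y v)
    (hA : ∀ p ∈ A, dist x p = dist y p) : x = y := by
  have h1 : x - y ∈ Submodule.span ℝ ((fun p => p - v) '' A) := by
    have := Submodule.sub_mem _ hx hy
    rwa [sub_sub_sub_cancel_right] at this
  have h2 : x - y ∈ (Submodule.span ℝ ((fun p => p - v) '' A))ᗮ := by
    rw [Submodule.mem_orthogonal']
    intro u hu
    induction hu using Submodule.span_induction with
    | mem u hu =>
      obtain ⟨p, hp, rfl⟩ := hu
      exact inner_sub_eq_of_dist hv (hA p hp)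
    | zero => simp
    | add u w _ _ hu hw => rw [inner_add_right, hu, hw, add_zero]
    | smul c u _ hu => rw [inner_smul_right, hu, mul_zero]
  have h3 := Submodule.inner_right_of_mem_orthogonal h1 h2
  exact sub_eq_zero.1 (inner_self_eq_zero.1 h3)

/-! ### Corners, and induction over the edge graph and vertex-figures -/

namespace CellData

/-- A corner: a vertex of a face with its two neighbours. -/
structure Corner (K : CellData) (F : Set (Sym2 E3)) (v u w : E3) : Prop where
  face : F ∈ K.faces
  left : s(v, u) ∈ F
  right : s(v, w) ∈ F
  ne : u ≠ w

variable {K : CellData}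

theorem Corner.symm {F : Set (Sym2 E3)} {v u w : E3} (h : K.Corner F v u w) : K.Corner F v w u :=
  ⟨h.face, h.right, h.left, h.ne.symm⟩

theorem Corner.mem_verts (hK : K.IsPolygonalComplex) {F : Set (Sym2 E3)} {v u w : E3}
    (h : K.Corner F v u w) : v ∈ K.verts ∧ u ∈ K.verts ∧ w ∈ K.verts := by
  have h1 := hK.mem_edges F h.face h.left
  have h2 := hK.mem_edges F h.face h.right
  exact ⟨hK.mem_verts _ h1 v (by simp), hK.mem_verts _ h1 u (by simp),
    hK.mem_verts _ h2 w (by simp)⟩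

theorem Corner.ne_left (hK : K.IsPolygonalComplex) {F : Set (Sym2 E3)} {v u w : E3}
    (h : K.Corner F v u w) : v ≠ u := by
  have := hK.not_isDiag _ (hK.mem_edges F h.face h.left)
  simpa using this

theorem exists_corner_of_face (hK : K.IsPolygonalComplex) {F : Set (Sym2 E3)} (hF : F ∈ K.faces)
    {v u : E3} (h : s(v, u) ∈ F) : ∃ w, K.Corner F v u w := by
  obtain ⟨w, hw, hw', -⟩ := (hK.isPolygon F hF).exists_other h
  exact ⟨w, hF, h, hw', hw.symm⟩

theorem exists_corner_of_edge (hK : K.IsPolygonalComplex) {v u : E3} (h : s(v, u) ∈ K.edges) :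
    ∃ F w, K.Corner F v u w := by
  obtain ⟨r, hr, hcard⟩ := hK.faces_on_edge
  have h1 : {F | F ∈ K.faces ∧ s(v, u) ∈ F}.Nonempty := by
    rw [← encard_ne_zero, hcard _ h]
    exact_mod_cast (by omega : r ≠ 0)
  obtain ⟨F, hF, hm⟩ := h1
  obtain ⟨w, hw⟩ := exists_corner_of_face hK hF hm
  exact ⟨F, w, hw⟩

theorem Corner.eq_right (hK : K.IsPolygonalComplex) {F : Set (Sym2 E3)} {v u w w' : E3}
    (h : K.Corner F v u w) (h' : s(v, w') ∈ F) (hne : w' ≠ u) : w' = w := by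
  obtain ⟨x, -, -, hall⟩ := (hK.isPolygon F h.face).exists_other h.left
  rw [(hall w' h').resolve_left hne, (hall w h.right).resolve_left h.ne.symm]

theorem exists_edge_of_vert (hK : K.IsPolygonalComplex) {v : E3} (hv : v ∈ K.verts) :
    ∃ u, s(v, u) ∈ K.edges := by
  obtain ⟨⟨u, hu⟩⟩ := (hK.vertexFigure_connected v hv).nonempty
  exact ⟨u, by rwa [Sym2.eq_swap]⟩

/-- Induction over the edge graph. -/
theorem verts_induction (hK : K.IsPolygonalComplex) {S : E3 → Prop} {v : E3} (hv : v ∈ K.verts)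
    (h0 : S v) (hS : ∀ x y, s(x, y) ∈ K.edges → S x → S y) {x : E3} (hx : x ∈ K.verts) : S x := by
  obtain ⟨p⟩ := hK.connected.preconnected ⟨v, hv⟩ ⟨x, hx⟩
  have key : ∀ (a b : K.verts) (p : K.edgeGraph.Walk a b), S a → S b := by
    intro a b p
    induction p with
    | nil => exact id
    | cons h _ ih => exact fun ha => ih (hS _ _ h.2 ha)
  exact key _ _ p h0

/-- Induction over the vertex-figure. -/
theorem nbrs_induction (hK : K.IsPolygonalComplex) {v : E3} (hv : v ∈ K.verts) {S : E3 → Prop}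
    {u : E3} (hu : s(v, u) ∈ K.edges) (h0 : S u)
    (hS : ∀ F x y, K.Corner F v x y → S x → S y) {x : E3} (hx : s(v, x) ∈ K.edges) : S x := by
  obtain ⟨p⟩ := (hK.vertexFigure_connected v hv).preconnected
    ⟨u, by rwa [Sym2.eq_swap]⟩ ⟨x, by rwa [Sym2.eq_swap]⟩
  have key : ∀ (a b : {u : E3 // s(u, v) ∈ K.edges}) (p : (K.vertexFigure v).Walk a b),
      S a → S b := by
    intro a b p
    induction p with
    | nil => exact id
    | @cons a c b h _ ih =>
      obtain ⟨hne, F, hF, h1, h2⟩ := h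
      refine fun ha => ih (hS F a c ⟨hF, ?_, h2, fun e => hne (Subtype.ext e)⟩ ha)
      rwa [Sym2.eq_swap]
  exact key _ _ p h0

theorem map_verts {g : E3 → E3} (hg : K.map g = K) {v : E3} (hv : v ∈ K.verts) :
    g v ∈ K.verts := by
  have : g v ∈ (K.map g).verts := ⟨v, hv, rfl⟩
  rwa [hg] at this

theorem map_edges {g : E3 → E3} (hg : K.map g = K) {v u : E3} (h : s(v, u) ∈ K.edges) :
    s(g v, g u) ∈ K.edges := by
  have : s(g v, g u) ∈ (K.map g).edges := ⟨s(v, u), h, rfl⟩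
  rwa [hg] at this

theorem map_faces {g : E3 → E3} (hg : K.map g = K) {F : Set (Sym2 E3)} (h : F ∈ K.faces) :
    Sym2.map g '' F ∈ K.faces := by
  have : Sym2.map g '' F ∈ (K.map g).faces := ⟨F, h, rfl⟩
  rwa [hg] at this

theorem Corner.map {g : E3 → E3} (hg : K.map g = K) (hinj : Function.Injective g)
    {F : Set (Sym2 E3)} {v u w : E3} (h : K.Corner F v u w) :
    K.Corner (Sym2.map g '' F) (g v) (g u) (g w) :=
  ⟨map_faces hg h.face, ⟨_, h.left, rfl⟩, ⟨_, h.right, rfl⟩, fun e => h.ne (hinj e)⟩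

theorem Corner.isFlag (hK : K.IsPolygonalComplex) {F : Set (Sym2 E3)} {v u w : E3}
    (h : K.Corner F v u w) : K.IsFlag ⟨v, s(v, u), F⟩ :=
  ⟨(h.mem_verts hK).1, hK.mem_edges F h.face h.left, h.face, by simp, h.left⟩

/-- A map between flags maps the corners to each other. -/
theorem Corner.eq_of_map (hK : K.IsPolygonalComplex) {F F' : Set (Sym2 E3)} {v u w v' u' w' : E3}
    (h : K.Corner F v u w) (h' : K.Corner F' v' u' w') {g : E3 → E3}
    (hinj : Function.Injective g)
    (hg : Triple.map g ⟨v, s(v, u), F⟩ = ⟨v', s(v', u'), F'⟩) :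
    g v = v' ∧ g u = u' ∧ g w = w' ∧ Sym2.map g '' F = F' := by
  have e1 : g v = v' := congrArg Triple.vert hg
  have e2 : s(g v, g u) = s(v', u') := congrArg Triple.edge hg
  have e3 : Sym2.map g '' F = F' := congrArg Triple.face hg
  have e4 : g u = u' := by
    rw [e1, Sym2.eq_iff] at e2
    rcases e2 with ⟨-, e⟩ | ⟨e, -⟩
    · exact e
    · exact absurd e (h'.ne_left hK)
  refine ⟨e1, e4, ?_, e3⟩
  apply h'.eq_right hK
  · rw [← e3, ← e1]
    exact ⟨_, h.right, rfl⟩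
  · rw [← e4]
    exact fun e => h.ne (hinj e).symm

end CellData

/-! ### Non-trivial flag stabilizers: the complex spans space and has mirrors -/

namespace CellData

variable {K : CellData}

theorem mem_hull {x : E3} (hx : x ∈ K.verts) : x ∈ K.hull := subset_affineSpan ℝ _ hx

theorem hullAct_mem (g : K.hull ≃ᵢ K.hull) {x : E3} (hx : x ∈ K.hull) : K.hullAct g x ∈ K.hull := by
  rw [hullAct_apply K g hx]
  exact (g ⟨x, hx⟩).2

theorem dist_hullAct (g : K.hull ≃ᵢ K.hull) {x y : E3} (hx : x ∈ K.hull) (hy : y ∈ K.hull) :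
    dist (K.hullAct g x) (K.hullAct g y) = dist x y := by
  rw [hullAct_apply K g hx, hullAct_apply K g hy, ← Subtype.dist_eq, g.dist_eq, Subtype.dist_eq]

theorem IsRegularComplex.corner_trans (hK : K.IsRegularComplex) {F F' : Set (Sym2 E3)}
    {v u w v' u' w' : E3} (h : K.Corner F v u w) (h' : K.Corner F' v' u' w') :
    ∃ g ∈ K.symmetryGroup, K.hullAct g v = v' ∧ K.hullAct g u = u' ∧ K.hullAct g w = w' ∧
      Sym2.map (K.hullAct g) '' F = F' := by
  obtain ⟨g, hg, hm⟩ := hK.2 _ _ (h.isFlag hK.1) (h'.isFlag hK.1)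
  exact ⟨g, hg, h.eq_of_map hK.1 h' (K.hullAct g).injective hm⟩

/-- Corners are congruent. -/
theorem IsRegularComplex.corner_dist (hK : K.IsRegularComplex) {F F' : Set (Sym2 E3)}
    {v u w v' u' w' : E3} (h : K.Corner F v u w) (h' : K.Corner F' v' u' w') :
    dist v u = dist v' u' ∧ dist v w = dist v' w' ∧ dist u w = dist u' w' := by
  obtain ⟨g, -, rfl, rfl, rfl, -⟩ := hK.corner_trans h h'
  obtain ⟨hv, hu, hw⟩ := h.mem_verts hK.1
  exact ⟨(dist_hullAct g (mem_hull hv) (mem_hull hu)).symm,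
    (dist_hullAct g (mem_hull hv) (mem_hull hw)).symm,
    (dist_hullAct g (mem_hull hu) (mem_hull hw)).symm⟩

theorem sub_mem_of_hull {S : Submodule ℝ E3} {v : E3} (h : ∀ x ∈ K.verts, x - v ∈ S) {x : E3}
    (hx : x ∈ K.hull) : x - v ∈ S := by
  have h1 : K.hull ≤ AffineSubspace.mk' v S := by
    refine affineSpan_le.2 fun x hx => ?_
    exact AffineSubspace.mem_mk'.2 (h x hx)
  exact AffineSubspace.mem_mk'.1 (h1 hx)

/-- A symmetry fixing the base corner is trivial if the complex lies in the plane or line of this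
corner. -/
theorem not_forall_mem_span {g : K.hull ≃ᵢ K.hull} (hg : g ≠ 1) {v u w : E3}
    (hvK : v ∈ K.verts) (huK : u ∈ K.verts) (hwK : w ∈ K.verts) (hv : K.hullAct g v = v)
    (hu : K.hullAct g u = u) (hw : K.hullAct g w = w) :
    ¬ ∀ x ∈ K.verts, x - v ∈ Submodule.span ℝ ((fun p => p - v) '' {u, w}) := by
  intro h
  apply hg
  refine IsometryEquiv.ext fun x => Subtype.ext ?_
  rw [← hullAct_apply K g x.2]
  change _ = (x : E3)
  refine eq_of_dist_eq (sub_mem_of_hull h (hullAct_mem g x.2)) (sub_mem_of_hull h x.2) ?_ ?_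
  · have := dist_hullAct g x.2 (mem_hull hvK)
    rwa [hv] at this
  · rintro p (rfl | rfl)
    · have := dist_hullAct g x.2 (mem_hull huK)
      rwa [hu] at this
    · have := dist_hullAct g x.2 (mem_hull hwK)
      rwa [hw] at this

/-- Straightness is put in terms of distances, so that the congruence of all corners carries it from
one corner to every other. -/
theorem eq_neg_iff_dist {a b : E3} : b = -a ↔ dist a b ^ 2 = 2 * ‖a‖ ^ 2 + 2 * ‖b‖ ^ 2 := by
  have h := parallelogram_law_with_norm ℝ a b
  rw [dist_eq_norm]
  constructor
  · rintro rfl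
    simp only [add_neg_cancel, norm_zero] at h
    linarith
  · intro h'
    have : ‖a + b‖ * ‖a + b‖ = 0 := by nlinarith
    have h0 : a + b = 0 := norm_eq_zero.1 (mul_self_eq_zero.1 this)
    exact eq_neg_of_add_eq_zero_right h0

/-- The corners are not straight. -/
theorem corner_not_straight (hK : K.IsRegularComplex) (hs : K.HasNontrivialFlagStabilizer)
    {F : Set (Sym2 E3)} {v u w : E3} (h : K.Corner F v u w) : w - v ≠ -(u - v) := by
  intro h0
  have hall : ∀ F v u w, K.Corner F v u w → w - v = -(u - v) := by
    intro F' v' u' w' h'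
    obtain ⟨e1, e2, e3⟩ := hK.corner_dist h h'
    rw [eq_neg_iff_dist] at h0 ⊢
    rw [dist_sub_right, ← dist_eq_norm, ← dist_eq_norm] at h0 ⊢
    rw [dist_comm u v, dist_comm w v, e1, e2, e3] at h0
    rw [dist_comm u' v', dist_comm w' v', h0]
  obtain ⟨⟨v, e, F⟩, hΦ, g, hg, hg1, hfix⟩ := hs
  obtain ⟨u, rfl⟩ : ∃ u, e = s(v, u) := hΦ.vert_edge
  obtain ⟨w, hc⟩ := exists_corner_of_face hK.1 hΦ.face_mem hΦ.edge_face
  obtain ⟨hv, hu, hw, -⟩ := hc.eq_of_map hK.1 hc (K.hullAct g).injective hfix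
  obtain ⟨hvK, huK, hwK⟩ := hc.mem_verts hK.1
  refine not_forall_mem_span hg1 hvK huK hwK hv hu hw fun x hx => ?_
  -- If all corners are straight, this span absorbs every neighbour in turn: two of three
  -- consecutive vertices of a face determine the third by reflection in the middle one. A symmetry
  -- fixing the corner would then be trivial.
  set S := Submodule.span ℝ ((fun p => p - v) '' {u, w}) with hS
  have huS : u - v ∈ S := Submodule.subset_span ⟨u, by simp, rfl⟩
  have key : ∀ y z, s(y, z) ∈ K.edges → y - v ∈ S → z - v ∈ S →
      ∀ x, s(y, x) ∈ K.edges → x - v ∈ S := by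
    intro y z hyz hy hz x hyx
    refine nbrs_induction hK.1 (hK.1.mem_verts _ hyz y (by simp)) (S := fun x => x - v ∈ S) hyz hz
      ?_ hyx
    intro F p q hpq hp
    have h1 := hall F y p q hpq
    have h2 : q - v = (2 : ℝ) • (y - v) - (p - v) := by
      have : q = y + (q - y) := by abel
      rw [this, h1, two_smul]
      abel
    rw [h2]
    exact S.sub_mem (S.smul_mem _ hy) hp
  have hedge := hK.1.mem_edges F hc.face hc.left
  refine (verts_induction hK.1 (S := fun x => x - v ∈ S ∧ ∀ y, s(x, y) ∈ K.edges → y - v ∈ S) hvK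
    ⟨by simp, key v u hedge (by simp) huS⟩ ?_ hx).1
  rintro x y hxy ⟨hx, hxall⟩
  exact ⟨hxall y hxy, key y x (by rwa [Sym2.eq_swap]) (hxall y hxy) hx⟩

/-- The two edge vectors of a corner have equal length, so dependence would mean equal vectors
(excluded by `u ≠ w`) or opposite ones (a straight corner). -/
theorem corner_linearIndependent (hK : K.IsRegularComplex) (hs : K.HasNontrivialFlagStabilizer)
    {F : Set (Sym2 E3)} {v u w : E3} (h : K.Corner F v u w) :
    LinearIndependent ℝ ![u - v, w - v] := by
  have hn : ‖u - v‖ = ‖w - v‖ := by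
    rw [← dist_eq_norm, ← dist_eq_norm, dist_comm u, dist_comm w]
    exact (hK.corner_dist h h.symm).1
  have h1 := corner_not_straight hK hs h
  have h2 : u - v ≠ w - v := fun e => h.ne (sub_left_injective e)
  have h0 : u - v ≠ 0 := sub_ne_zero.2 (h.ne_left hK.1).symm
  rw [LinearIndependent.pair_iff' h0]
  intro t ht
  have h3 : ‖t‖ = 1 := by
    have := congrArg norm ht
    rw [norm_smul, ← hn] at this
    have hp : 0 < ‖u - v‖ := norm_pos_iff.2 h0
    exact mul_right_cancel₀ hp.ne' (this.trans (one_mul _).symm)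
  rw [Real.norm_eq_abs, abs_eq (by norm_num)] at h3
  rcases h3 with rfl | rfl
  · rw [one_smul] at ht; exact h2 ht
  · rw [neg_one_smul] at ht; exact h1 ht.symm

/-- The complex is not planar. -/
theorem hull_eq_top (hK : K.IsRegularComplex) (hs : K.HasNontrivialFlagStabilizer) :
    K.hull = ⊤ := by
  have hs' := hs
  obtain ⟨⟨v, e, F⟩, hΦ, g, hg, hg1, hfix⟩ := hs'
  obtain ⟨u, rfl⟩ : ∃ u, e = s(v, u) := hΦ.vert_edge
  obtain ⟨w, hc⟩ := exists_corner_of_face hK.1 hΦ.face_mem hΦ.edge_face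
  obtain ⟨hv, hu, hw, -⟩ := hc.eq_of_map hK.1 hc (K.hullAct g).injective hfix
  obtain ⟨hvK, huK, hwK⟩ := hc.mem_verts hK.1
  -- A non-trivial symmetry fixing the corner requires a vertex outside the plane of the corner; the
  -- hull then has dimension greater than two.
  have h1 := not_forall_mem_span hg1 hvK huK hwK hv hu hw
  push Not at h1
  obtain ⟨x, hx, hxS⟩ := h1
  have hli := corner_linearIndependent hK hs hc
  set S := Submodule.span ℝ ((fun p => p - v) '' {u, w}) with hS
  have hSr : S = Submodule.span ℝ (range ![u - v, w - v]) := by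
    rw [hS, image_pair, Matrix.range_cons, Matrix.range_cons, Matrix.range_empty, union_empty]
    rfl
  have hfr : Module.finrank ℝ S = 2 := by
    rw [hSr, finrank_span_eq_card hli]
    rfl
  have hle : S ≤ K.hull.direction := by
    refine Submodule.span_le.2 ?_
    rintro _ ⟨p, hp, rfl⟩
    refine AffineSubspace.vsub_mem_direction (mem_hull ?_) (mem_hull hvK)
    rcases hp with rfl | rfl
    · exact huK
    · exact hwK
  have hlt : S < K.hull.direction := by
    refine lt_of_le_of_ne hle fun e => hxS ?_
    rw [e]
    exact AffineSubspace.vsub_mem_direction (mem_hull hx) (mem_hull hvK)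
  have h3 := Submodule.finrank_lt_finrank_of_lt hlt
  have htop : K.hull.direction = ⊤ := by
    apply Submodule.eq_top_of_finrank_eq
    have h4 := Submodule.finrank_le K.hull.direction
    have h5 : Module.finrank ℝ E3 = 3 := by simp
    omega
  exact (AffineSubspace.direction_eq_top_iff_of_nonempty ⟨v, mem_hull hvK⟩).1 htop

/-- A symmetry of a complex with full hull, as an isometry of the space. -/
noncomputable def extendHull (h : K.hull = ⊤) (g : K.hull ≃ᵢ K.hull) : E3 ≃ᵢ E3 where
  toEquiv := K.hullAct g
  isometry_toFun := Isometry.of_dist_eq fun _ _ =>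
    dist_hullAct g (mem_hull_of_eq_top h _) (mem_hull_of_eq_top h _)

theorem extendHull_apply (h : K.hull = ⊤) (g : K.hull ≃ᵢ K.hull) :
    (extendHull h g : E3 → E3) = K.hullAct g := rfl

/-- The properties of the complexes to be classified, in terms of isometries of the space. -/
structure IsMirrored (K : CellData) : Prop where
  complex : K.IsPolygonalComplex
  nonempty : ∃ F v u w, K.Corner F v u w
  trans : ∀ {F v u w F' v' u' w'}, K.Corner F v u w → K.Corner F' v' u' w' →
    ∃ g : E3 ≃ᵢ E3, K.map g = K ∧ g v = v' ∧ g u = u' ∧ g w = w' ∧ Sym2.map g '' F = F'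
  mirror : ∀ {F v u w}, K.Corner F v u w →
    ∃ g : E3 ≃ᵢ E3, K.map g = K ∧ g ≠ 1 ∧ g v = v ∧ g u = u ∧ g w = w ∧ Sym2.map g '' F = F
  hull : K.hull = ⊤
  indep : ∀ {F v u w}, K.Corner F v u w → LinearIndependent ℝ ![u - v, w - v]

theorem map_mul {g h : E3 ≃ᵢ E3} (hg : K.map g = K) (hh : K.map h = K) :
    K.map (g * h : E3 ≃ᵢ E3) = K := by
  rw [IsometryEquiv.coe_mul, ← map_map, hh, hg]

theorem map_inv {g : E3 ≃ᵢ E3} (hg : K.map g = K) : K.map (g⁻¹ : E3 ≃ᵢ E3) = K := by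
  have hc : ((g⁻¹ : E3 ≃ᵢ E3) : E3 → E3) ∘ g = id := by
    funext x; exact g.symm_apply_apply x
  have : (K.map g).map (g⁻¹ : E3 ≃ᵢ E3) = K := by rw [map_map, hc, map_id]
  rwa [hg] at this

/-- By transitivity the one non-trivial flag symmetry can be conjugated to every corner. -/
theorem isMirrored (hK : K.IsRegularComplex) (hs : K.HasNontrivialFlagStabilizer) :
    K.IsMirrored := by
  have htop := hull_eq_top hK hs
  have htrans : ∀ {F v u w F' v' u' w'}, K.Corner F v u w → K.Corner F' v' u' w' →
      ∃ g : E3 ≃ᵢ E3, K.map g = K ∧ g v = v' ∧ g u = u' ∧ g w = w' ∧ Sym2.map g '' F = F' := by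
    intro F v u w F' v' u' w' h h'
    obtain ⟨g, hg, h1⟩ := hK.corner_trans h h'
    exact ⟨extendHull htop g, hg, h1⟩
  have hs' := hs
  obtain ⟨⟨v, e, F⟩, hΦ, g, hg, hg1, hfix⟩ := hs'
  obtain ⟨u, rfl⟩ : ∃ u, e = s(v, u) := hΦ.vert_edge
  obtain ⟨w, hc⟩ := exists_corner_of_face hK.1 hΦ.face_mem hΦ.edge_face
  obtain ⟨hv, hu, hw, hF⟩ := hc.eq_of_map hK.1 hc (K.hullAct g).injective hfix
  refine ⟨hK.1, ⟨F, v, u, w, hc⟩, htrans, ?_, htop, fun h => corner_linearIndependent hK hs h⟩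
  intro F' v' u' w' hc'
  obtain ⟨t, ht, t1, t2, t3, t4⟩ := htrans hc hc'
  refine ⟨t * extendHull htop g * t⁻¹, map_mul (map_mul ht hg) (map_inv ht), ?_, ?_, ?_, ?_, ?_⟩
  · intro e
    have e1 : extendHull htop g = 1 := by
      have := congrArg (fun z => t⁻¹ * z * t) e
      simpa [mul_assoc] using this
    apply hg1
    ext x
    rw [← hullAct_apply K g x.2, ← extendHull_apply htop, e1]
    rfl
  · rw [← t1]
    simp only [IsometryEquiv.mul_apply, IsometryEquiv.inv_apply_self]
    exact congrArg t hv
  · rw [← t2]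
    simp only [IsometryEquiv.mul_apply, IsometryEquiv.inv_apply_self]
    exact congrArg t hu
  · rw [← t3]
    simp only [IsometryEquiv.mul_apply, IsometryEquiv.inv_apply_self]
    exact congrArg t hw
  · have e1 : ∀ e, Sym2.map (t⁻¹ : E3 ≃ᵢ E3) (Sym2.map t e) = e := by
      intro e
      rw [Sym2.map_map]
      have : ((t⁻¹ : E3 ≃ᵢ E3) : E3 → E3) ∘ t = id := by funext x; exact t.symm_apply_apply x
      rw [this, Sym2.map_id]; rfl
    rw [← t4, IsometryEquiv.coe_mul, IsometryEquiv.coe_mul, Sym2.map_comp, Sym2.map_comp,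
      image_comp, image_comp]
    have e2 : Sym2.map (t⁻¹ : E3 ≃ᵢ E3) '' (Sym2.map t '' F) = F := by
      rw [image_image]
      simp only [e1, image_id']
    rw [e2]
    exact congrArg _ hF

end CellData

/-! ### Plane normals, linear reflections and linear parts of isometries -/

/-- `n` is a normal vector of the plane spanned by `a` and `b`. -/
structure PlaneNormal (a b n : E3) : Prop where
  ne_zero : n ≠ 0
  left : ⟪n, a⟫_ℝ = 0
  right : ⟪n, b⟫_ℝ = 0

theorem exists_normal (a b : E3) : ∃ n, PlaneNormal a b n := by
  have h1 : Module.finrank ℝ (Submodule.span ℝ (({a, b} : Finset E3) : Set E3)) ≤ 2 :=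
    (finrank_span_finset_le_card _).trans Finset.card_le_two
  have h2 := Submodule.finrank_add_finrank_orthogonal
    (Submodule.span ℝ (({a, b} : Finset E3) : Set E3))
  have h3 : Module.finrank ℝ E3 = 3 := by simp
  have h4 : (Submodule.span ℝ (({a, b} : Finset E3) : Set E3))ᗮ ≠ ⊥ := by
    intro h
    rw [h, finrank_bot] at h2
    omega
  obtain ⟨n, hn, hn0⟩ := Submodule.exists_mem_ne_zero_of_ne_bot h4
  rw [Submodule.mem_orthogonal'] at hn
  exact ⟨n, hn0, hn a (Submodule.subset_span (by simp)), hn b (Submodule.subset_span (by simp))⟩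

theorem PlaneNormal.decompose {a b n : E3} (h : PlaneNormal a b n) (hab : LinearIndependent ℝ ![a, b])
    (x : E3) : ∃ α β γ : ℝ, x = α • a + β • b + γ • n := by
  have hli : LinearIndependent ℝ ![a, b, n] := by
    rw [Fintype.linearIndependent_iff]
    intro g hg
    simp only [Fin.sum_univ_three, Matrix.cons_val] at hg
    have h1 : g 2 = 0 := by
      have h2 := congrArg (fun z => ⟪n, z⟫_ℝ) hg
      simp only [inner_add_right, inner_smul_right, h.left, h.right, inner_zero_right, mul_zero,
        zero_add] at h2
      exact (mul_eq_zero.1 h2).resolve_right (inner_self_ne_zero.2 h.ne_zero)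
    rw [h1, zero_smul, add_zero] at hg
    obtain ⟨h2, h3⟩ := LinearIndependent.pair_iff.1 hab _ _ hg
    intro i
    fin_cases i
    · exact h2
    · exact h3
    · exact h1
  have htop := hli.span_eq_top_of_card_eq_finrank' (by simp)
  have hx : x ∈ Submodule.span ℝ (range ![a, b, n]) := by rw [htop]; trivial
  obtain ⟨c, hc⟩ := (Submodule.mem_span_range_iff_exists_fun ℝ).1 hx
  simp only [Fin.sum_univ_three, Matrix.cons_val] at hc
  exact ⟨_, _, _, hc.symm⟩

theorem PlaneNormal.eq_zero {a b n : E3} (h : PlaneNormal a b n) (hab : LinearIndependent ℝ ![a, b]) {x : E3}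
    (h1 : ⟪x, a⟫_ℝ = 0) (h2 : ⟪x, b⟫_ℝ = 0) (h3 : ⟪x, n⟫_ℝ = 0) : x = 0 := by
  obtain ⟨α, β, γ, hx⟩ := h.decompose hab x
  have : ⟪x, x⟫_ℝ = 0 := by
    nth_rewrite 2 [hx]
    simp only [inner_add_right, inner_smul_right, h1, h2, h3, mul_zero, add_zero]
  exact inner_self_eq_zero.1 this

/-- Vectors perpendicular to the plane are multiples of the normal. -/
theorem PlaneNormal.eq_smul {a b n : E3} (h : PlaneNormal a b n) (hab : LinearIndependent ℝ ![a, b]) {x : E3}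
    (h1 : ⟪x, a⟫_ℝ = 0) (h2 : ⟪x, b⟫_ℝ = 0) : ∃ t : ℝ, x = t • n := by
  refine ⟨⟪x, n⟫_ℝ / ⟪n, n⟫_ℝ, ?_⟩
  rw [← sub_eq_zero]
  apply h.eq_zero hab
  · rw [inner_sub_left, inner_smul_left, h1, h.left, mul_zero, sub_zero]
  · rw [inner_sub_left, inner_smul_left, h2, h.right, mul_zero, sub_zero]
  · rw [inner_sub_left, inner_smul_left]
    have : ⟪n, n⟫_ℝ ≠ 0 := inner_self_ne_zero.2 h.ne_zero
    simp only [conj_trivial]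
    field_simp
    ring

/-- Vectors perpendicular to the normal lie in the plane. -/
theorem PlaneNormal.exists_of_perp {a b n : E3} (h : PlaneNormal a b n)
    (hab : LinearIndependent ℝ ![a, b]) {x : E3} (hx : ⟪n, x⟫_ℝ = 0) :
    ∃ α β : ℝ, x = α • a + β • b := by
  obtain ⟨α, β, γ, rfl⟩ := h.decompose hab x
  simp only [inner_add_right, inner_smul_right, h.left, h.right, mul_zero, zero_add] at hx
  have := (mul_eq_zero.1 hx).resolve_right (inner_self_ne_zero.2 h.ne_zero)
  exact ⟨α, β, by rw [this, zero_smul, add_zero]⟩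

/-- The linear reflection with root `n`. -/
noncomputable def mirrorMap (n : E3) : E3 ≃ₗᵢ[ℝ] E3 := (ℝ ∙ n)ᗮ.reflection

theorem mirrorMap_apply (n x : E3) : mirrorMap n x = x - (2 * ⟪n, x⟫_ℝ / ⟪n, n⟫_ℝ) • n := by
  rw [mirrorMap, Submodule.reflection_orthogonal_apply, Submodule.reflection_singleton_apply,
    real_inner_self_eq_norm_sq, ← Nat.cast_smul_eq_nsmul ℝ, smul_smul, neg_sub]
  simp [mul_div_assoc]

theorem mirrorMap_of_perp {n x : E3} (h : ⟪n, x⟫_ℝ = 0) : mirrorMap n x = x := by simp [mirrorMap_apply, h]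

theorem mirrorMap_self (n : E3) : mirrorMap n n = -n := by
  rw [mirrorMap, Submodule.reflection_orthogonalComplement_singleton_eq_neg]

theorem mirrorMap_sub {a b : E3} (h : ‖a‖ = ‖b‖) : mirrorMap (a - b) a = b := Submodule.reflection_sub h

theorem mirrorMap_mirrorMap (n x : E3) : mirrorMap n (mirrorMap n x) = x := Submodule.reflection_reflection _ x

theorem mirrorMap_sub' {a b : E3} (h : ‖a‖ = ‖b‖) : mirrorMap (a - b) b = a := by
  nth_rewrite 2 [← mirrorMap_sub h]
  rw [mirrorMap_mirrorMap]

/-- The image of the normal is again perpendicular to the plane and has the same length, so it is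
`n` or `-n`. -/
theorem PlaneNormal.eq_one_or_mirrorMap {a b n : E3} (h : PlaneNormal a b n)
    (hab : LinearIndependent ℝ ![a, b]) {A : E3 ≃ₗᵢ[ℝ] E3} (ha : A a = a) (hb : A b = b) :
    A = 1 ∨ A = mirrorMap n := by
  have h1 : ⟪A n, a⟫_ℝ = 0 := by
    have := A.inner_map_map n a
    rwa [ha, h.left] at this
  have h2 : ⟪A n, b⟫_ℝ = 0 := by
    have := A.inner_map_map n b
    rwa [hb, h.right] at this
  obtain ⟨t, ht⟩ := h.eq_smul hab h1 h2
  have ht1 : t = 1 ∨ t = -1 := by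
    have h3 : ‖A n‖ = ‖n‖ := A.norm_map n
    rw [ht, norm_smul, Real.norm_eq_abs] at h3
    have h4 : |t| = 1 := by
      have h5 : ‖n‖ ≠ 0 := norm_ne_zero_iff.2 h.ne_zero
      field_simp at h3
      exact h3
    exact (abs_eq zero_le_one).1 h4
  rcases ht1 with rfl | rfl
  · left
    refine LinearIsometryEquiv.ext fun x => ?_
    obtain ⟨α, β, γ, rfl⟩ := h.decompose hab x
    simp only [map_add, map_smul, ha, hb, ht, one_smul]
    rfl
  · right
    refine LinearIsometryEquiv.ext fun x => ?_
    obtain ⟨α, β, γ, rfl⟩ := h.decompose hab x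
    simp only [map_add, map_smul, ha, hb, ht, mirrorMap_of_perp h.left, mirrorMap_of_perp h.right, mirrorMap_self,
      neg_one_smul]

/-- The linear part of an isometry. -/
noncomputable def linPart (g : E3 ≃ᵢ E3) : E3 ≃ₗᵢ[ℝ] E3 :=
  g.toRealAffineIsometryEquiv.linearIsometryEquiv

theorem linPart_sub (g : E3 ≃ᵢ E3) (x y : E3) : linPart g (x - y) = g x - g y :=
  g.toRealAffineIsometryEquiv.map_vsub x y

/-- The isometry with linear part `A` that maps `v` to `v'`. -/
noncomputable def moveIso (A : E3 ≃ₗᵢ[ℝ] E3) (v v' : E3) : E3 ≃ᵢ E3 where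
  toFun x := v' + A (x - v)
  invFun y := v + A.symm (y - v')
  left_inv x := by simp
  right_inv x := by simp
  isometry_toFun := Isometry.of_dist_eq fun x y => by
    rw [dist_add_left, A.dist_map, dist_sub_right]

theorem moveIso_apply (A : E3 ≃ₗᵢ[ℝ] E3) (v v' x : E3) : moveIso A v v' x = v' + A (x - v) := rfl

theorem moveIso_linPart (g : E3 ≃ᵢ E3) (v : E3) : moveIso (linPart g) v (g v) = g := by
  refine IsometryEquiv.ext fun x => ?_
  rw [moveIso_apply, linPart_sub, add_sub_cancel]

theorem linPart_moveIso (A : E3 ≃ₗᵢ[ℝ] E3) (v v' : E3) : linPart (moveIso A v v') = A := by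
  refine LinearIsometryEquiv.ext fun x => ?_
  have := linPart_sub (moveIso A v v') (v + x) v
  rw [add_sub_cancel_left] at this
  rw [this, moveIso_apply, moveIso_apply]
  simp

theorem linPart_mul (g h : E3 ≃ᵢ E3) : linPart (g * h) = linPart g * linPart h := by
  refine LinearIsometryEquiv.ext fun x => ?_
  have h1 := linPart_sub (g * h) x 0
  rw [sub_zero] at h1
  rw [h1, IsometryEquiv.mul_apply, IsometryEquiv.mul_apply, ← linPart_sub, ← linPart_sub, sub_zero]
  rfl

theorem moveIso_mul (A B : E3 ≃ₗᵢ[ℝ] E3) (v v' v'' : E3) :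
    moveIso A v' v'' * moveIso B v v' = moveIso (A * B) v v'' := by
  refine IsometryEquiv.ext fun x => ?_
  simp [moveIso_apply]

/-! ### Symmetries between corners and planarity of faces -/

namespace CellData

variable {K : CellData}

theorem image_image_face {g h : E3 ≃ᵢ E3} {F F' F'' : Set (Sym2 E3)} (hg : Sym2.map g '' F' = F'')
    (hh : Sym2.map h '' F = F') : Sym2.map (g * h : E3 ≃ᵢ E3) '' F = F'' := by
  rw [IsometryEquiv.coe_mul, Sym2.map_comp, image_comp, hh, hg]

/-- Every linear isometry between two corners comes from a symmetry. -/
theorem IsMirrored.map_moveIso (H : K.IsMirrored) {F F' : Set (Sym2 E3)} {v u w v' u' w' : E3}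
    (h : K.Corner F v u w) (h' : K.Corner F' v' u' w') {A : E3 ≃ₗᵢ[ℝ] E3}
    (hu : A (u - v) = u' - v') (hw : A (w - v) = w' - v') :
    K.map (moveIso A v v') = K ∧ Sym2.map (moveIso A v v') '' F = F' := by
  obtain ⟨n, hn⟩ := exists_normal (u - v) (w - v)
  have hli := H.indep h
  obtain ⟨m, hm, hm1, mv, mu, mw, mF⟩ := H.mirror h
  -- The non-trivial symmetry fixing the corner can only be the reflection in its plane.
  have hm' : m = moveIso (mirrorMap n) v v := by
    have e := moveIso_linPart m v
    rw [mv] at e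
    rcases hn.eq_one_or_mirrorMap hli (A := linPart m) (by rw [linPart_sub, mu, mv])
      (by rw [linPart_sub, mw, mv]) with e1 | e1
    · exfalso
      apply hm1
      rw [← e, e1]
      refine IsometryEquiv.ext fun x => ?_
      simp [moveIso_apply]
    · rw [← e, e1]
  obtain ⟨g, hg, gv, gu, gw, gF⟩ := H.trans h h'
  have eg := moveIso_linPart g v
  rw [gv] at eg
  -- Some symmetry `g` matches the two corners, and `A` differs from its linear part at most by the
  -- reflection in the plane of the first corner, which is itself available as a symmetry.
  have hfix := hn.eq_one_or_mirrorMap hli (A := A⁻¹ * linPart g)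
    (by
      change A.symm (linPart g _) = _
      rw [linPart_sub, gu, gv, ← hu]
      exact A.symm_apply_apply _)
    (by
      change A.symm (linPart g _) = _
      rw [linPart_sub, gw, gv, ← hw]
      exact A.symm_apply_apply _)
  rcases hfix with e | e
  · have : linPart g = A := by rw [← mul_one A, ← e, mul_inv_cancel_left]
    rw [← this, eg]
    exact ⟨hg, gF⟩
  · have : linPart g * mirrorMap n = A := by
      have e2 : linPart g = A * mirrorMap n := by rw [← e, mul_inv_cancel_left]
      rw [e2, mul_assoc]
      have e3 : mirrorMap n * mirrorMap n = 1 := LinearIsometryEquiv.ext fun x => mirrorMap_mirrorMap n x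
      rw [e3, mul_one]
    rw [← this, ← moveIso_mul _ _ v v v', eg, ← hm']
    exact ⟨map_mul hg hm, image_image_face gF mF⟩

theorem IsMirrored.inner_eq (H : K.IsMirrored) {F F' : Set (Sym2 E3)} {v u w v' u' w' : E3}
    (h : K.Corner F v u w) (h' : K.Corner F' v' u' w') :
    ⟪u - v, w - v⟫_ℝ = ⟪u' - v', w' - v'⟫_ℝ := by
  obtain ⟨g, -, rfl, rfl, rfl, -⟩ := H.trans h h'
  rw [← linPart_sub, ← linPart_sub, LinearIsometryEquiv.inner_map_map]

theorem IsMirrored.norm_eq (H : K.IsMirrored) {F F' : Set (Sym2 E3)} {v u w v' u' w' : E3}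
    (h : K.Corner F v u w) (h' : K.Corner F' v' u' w') : ‖u - v‖ = ‖u' - v'‖ := by
  obtain ⟨g, -, rfl, rfl, rfl, -⟩ := H.trans h h'
  rw [← linPart_sub, LinearIsometryEquiv.norm_map]

/-- The faces are planar, and the mirror of a corner contains the face. -/
theorem IsMirrored.planar (H : K.IsMirrored) {F : Set (Sym2 E3)} {v u w : E3}
    (h : K.Corner F v u w) {n : E3} (hn : PlaneNormal (u - v) (w - v) n) {x y : E3}
    (hxy : s(x, y) ∈ F) : ⟪n, x - v⟫_ℝ = 0 := by
  obtain ⟨-, hF⟩ := H.map_moveIso h h (mirrorMap_of_perp hn.left) (mirrorMap_of_perp hn.right)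
  -- The reflection maps the face to itself and fixes an edge with its ends, so it fixes all
  -- vertices of the face; its fixed points are the mirror.
  have hx := (H.complex.isPolygon F h.face).fixes (g := moveIso (mirrorMap n) v v)
    (IsometryEquiv.injective _) (fun e he => hF.subset ⟨e, he, rfl⟩) h.left
    (by simp [moveIso_apply]) (by rw [moveIso_apply, mirrorMap_of_perp hn.left, add_sub_cancel]) hxy
  rw [moveIso_apply, mirrorMap_apply, add_sub, add_sub_cancel, sub_eq_self] at hx
  have h1 := (smul_eq_zero.1 hx).resolve_right hn.ne_zero
  have h2 : ⟪n, n⟫_ℝ ≠ 0 := inner_self_ne_zero.2 hn.ne_zero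
  rw [div_eq_zero_iff, or_iff_left h2] at h1
  linarith

end CellData

theorem linearIndependent_of_inner_eq_zero {a d : E3} (ha : a ≠ 0) (hd : d ≠ 0)
    (had : ⟪a, d⟫_ℝ = 0) : LinearIndependent ℝ ![a, d] := by
  rw [LinearIndependent.pair_iff]
  intro s t h
  have h1 := congrArg (fun z => ⟪a, z⟫_ℝ) h
  have h2 := congrArg (fun z => ⟪d, z⟫_ℝ) h
  have hda : ⟪d, a⟫_ℝ = 0 := by rw [real_inner_comm, had]
  simp only [inner_add_right, inner_smul_right, had, hda, inner_zero_right, mul_zero, add_zero,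
    zero_add] at h1 h2
  exact ⟨(mul_eq_zero.1 h1).resolve_right (inner_self_ne_zero.2 ha),
    (mul_eq_zero.1 h2).resolve_right (inner_self_ne_zero.2 hd)⟩

/-- In a plane, a vector is determined up to reflection by its length and its inner product with
a given vector. -/
theorem eq_neg_or_eq_mirrorMap {a b c n : E3} (ha : a ≠ 0) (hn : PlaneNormal a b n)
    (hnc : ⟪n, c⟫_ℝ = 0) (hnorm : ‖c‖ = ‖b‖) (hinner : ⟪a, c⟫_ℝ = -⟪a, b⟫_ℝ) :
    c = -b ∨ c = mirrorMap a b := by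
  by_cases hd : c + b = 0
  · exact Or.inl (eq_neg_of_add_eq_zero_left hd)
  right
  have had : ⟪a, c + b⟫_ℝ = 0 := by rw [inner_add_right, hinner]; ring
  have hli := linearIndependent_of_inner_eq_zero ha hd had
  have hN : PlaneNormal a (c + b) n :=
    ⟨hn.ne_zero, hn.left, by rw [inner_add_right, hnc, hn.right, add_zero]⟩
  have haa : ⟪a, a⟫_ℝ ≠ 0 := inner_self_ne_zero.2 ha
  rw [← sub_eq_zero, mirrorMap_apply]
  apply hN.eq_zero hli
  · rw [real_inner_comm, inner_sub_right, inner_sub_right, inner_smul_right, hinner]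
    field_simp
    ring
  · have h1 : ⟪c - b, c + b⟫_ℝ = 0 := by
      have := (real_inner_add_sub_eq_zero_iff c b).2 hnorm
      rwa [real_inner_comm]
    have e : c - (b - (2 * ⟪a, b⟫_ℝ / ⟪a, a⟫_ℝ) • a) =
        (c - b) + (2 * ⟪a, b⟫_ℝ / ⟪a, a⟫_ℝ) • a := by abel
    rw [e, inner_add_left, inner_smul_left, h1, had, mul_zero, add_zero]
  · rw [real_inner_comm, inner_sub_right, inner_sub_right, inner_smul_right, hnc, hn.left, hn.right,
      mul_zero, sub_zero, sub_zero]

/-! ### The two flip types, and the mirrors at a vertex -/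

namespace CellData

variable {K : CellData}

theorem Corner.mem_edges (hK : K.IsPolygonalComplex) {F : Set (Sym2 E3)} {v u w : E3}
    (h : K.Corner F v u w) : s(v, u) ∈ K.edges := hK.mem_edges F h.face h.left

theorem Corner.sub_ne_zero (hK : K.IsPolygonalComplex) {F : Set (Sym2 E3)} {v u w : E3}
    (h : K.Corner F v u w) : u - v ≠ 0 := _root_.sub_ne_zero.2 (h.ne_left hK).symm

theorem Corner.next (hK : K.IsPolygonalComplex) {F : Set (Sym2 E3)} {v u w : E3}
    (h : K.Corner F v u w) : ∃ w₁, K.Corner F u v w₁ :=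
  exists_corner_of_face hK h.face (by rw [Sym2.eq_swap]; exact h.left)

/-- The zigzag case: the inversion in the midpoint of an edge maps corners to corners. -/
def PointFlip (K : CellData) : Prop :=
  ∀ F v u w, K.Corner F v u w → K.Corner F u v (u - (w - v))

/-- The convex case: the reflection in the perpendicular bisector of an edge maps corners to
corners. -/
def MirrorFlip (K : CellData) : Prop :=
  ∀ F v u w, K.Corner F v u w → K.Corner F u v (u + mirrorMap (u - v) (w - v))

theorem map_mirrorMap (A : E3 ≃ₗᵢ[ℝ] E3) (n x : E3) :
    A (mirrorMap n x) = mirrorMap (A n) (A x) := by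
  simp only [mirrorMap_apply, map_sub, map_smul, A.inner_map_map]

/-- At the other end of an edge the next edge of the face has the same length, lies in the same
plane and forms the same angle with the edge. This leaves two positions, and transitivity on corners
makes the choice uniform. -/
theorem IsMirrored.flip_cases (H : K.IsMirrored) : K.PointFlip ∨ K.MirrorFlip := by
  obtain ⟨F, v, u, w, h⟩ := H.nonempty
  obtain ⟨w₁, h₁⟩ := h.next H.complex
  obtain ⟨n, hn⟩ := exists_normal (u - v) (w - v)
  have hp := H.planar h hn (x := w₁) (y := u) (by rw [Sym2.eq_swap]; exact h₁.right)
  have hcase : w₁ - u = -(w - v) ∨ w₁ - u = mirrorMap (u - v) (w - v) := by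
    refine eq_neg_or_eq_mirrorMap (h.sub_ne_zero H.complex) hn ?_ (H.norm_eq h₁.symm h.symm) ?_
    · have e : w₁ - u = (w₁ - v) - (u - v) := by abel
      rw [e, inner_sub_right, hp, hn.left, sub_zero]
    · rw [H.inner_eq h h₁, ← inner_neg_left, neg_sub]
  have transfer : ∀ F' v' u' w', K.Corner F' v' u' w' → ∃ g : E3 ≃ᵢ E3, g v = v' ∧ g u = u' ∧
      g w = w' ∧ K.Corner F' u' v' (u' + linPart g (w₁ - u)) := by
    intro F' v' u' w' h'
    obtain ⟨g, hg, rfl, rfl, rfl, rfl⟩ := H.trans h h'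
    refine ⟨g, rfl, rfl, rfl, ?_⟩
    rw [linPart_sub, add_sub_cancel]
    exact h₁.map hg g.injective
  rcases hcase with e | e
  · left
    intro F' v' u' w' h'
    obtain ⟨g, rfl, rfl, rfl, h2⟩ := transfer F' v' u' w' h'
    rw [e, map_neg, linPart_sub, ← sub_eq_add_neg] at h2
    exact h2
  · right
    intro F' v' u' w' h'
    obtain ⟨g, rfl, rfl, rfl, h2⟩ := transfer F' v' u' w' h'
    rwa [e, map_mirrorMap, linPart_sub, linPart_sub] at h2

theorem IsMirrored.map_pointFlip (H : K.IsMirrored) (hA : K.PointFlip) {F : Set (Sym2 E3)}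
    {v u w : E3} (h : K.Corner F v u w) :
    K.map (moveIso (LinearIsometryEquiv.neg ℝ) v u) = K ∧
      Sym2.map (moveIso (LinearIsometryEquiv.neg ℝ) v u) '' F = F :=
  H.map_moveIso h (hA F v u w h) (by simp) (by simp)

theorem IsMirrored.map_mirrorFlip (H : K.IsMirrored) (hB : K.MirrorFlip) {F : Set (Sym2 E3)}
    {v u w : E3} (h : K.Corner F v u w) :
    K.map (moveIso (mirrorMap (u - v)) v u) = K ∧
      Sym2.map (moveIso (mirrorMap (u - v)) v u) '' F = F :=
  H.map_moveIso h (hB F v u w h) (by rw [mirrorMap_self, neg_sub]) (by rw [add_sub_cancel_left])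

theorem exists_corner_of_vert (hK : K.IsPolygonalComplex) {v : E3} (hv : v ∈ K.verts) :
    ∃ F u w, K.Corner F v u w := by
  obtain ⟨u, hu⟩ := exists_edge_of_vert hK hv
  obtain ⟨F, w, h⟩ := exists_corner_of_edge hK hu
  exact ⟨F, u, w, h⟩

/-- The faces at an edge do not all lie in the same plane. -/
theorem IsMirrored.exists_corner_off (H : K.IsMirrored) {F : Set (Sym2 E3)} {v u w n : E3}
    (h : K.Corner F v u w) (hn : PlaneNormal (u - v) (w - v) n) :
    ∃ F' w', K.Corner F' v u w' ∧ ⟪n, w' - v⟫_ℝ ≠ 0 := by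
  by_contra! hcon
  -- If all faces at one edge lie in one plane, the same holds at every edge by transitivity. The
  -- plane then spreads over vertex-figures and along edges to the whole complex, which contradicts
  -- the full hull.
  have hall : ∀ {F₁ v₁ u₁ w₁ n₁}, K.Corner F₁ v₁ u₁ w₁ → PlaneNormal (u₁ - v₁) (w₁ - v₁) n₁ →
      ∀ {F' w'}, K.Corner F' v₁ u₁ w' → ⟪n₁, w' - v₁⟫_ℝ = 0 := by
    intro F₁ v₁ u₁ w₁ n₁ h₁ hn₁ F' w' h'
    obtain ⟨g, hg, rfl, rfl, rfl, rfl⟩ := H.trans h₁ h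
    have hN : PlaneNormal (g u₁ - g v₁) (g w₁ - g v₁) (linPart g n₁) := by
      refine ⟨fun e => hn₁.ne_zero ((map_eq_zero_iff _ (linPart g).injective).1 e), ?_, ?_⟩
      · rw [← linPart_sub, LinearIsometryEquiv.inner_map_map, hn₁.left]
      · rw [← linPart_sub, LinearIsometryEquiv.inner_map_map, hn₁.right]
    obtain ⟨t, ht⟩ := hn.eq_smul (H.indep h) hN.left hN.right
    have h2 := hcon _ _ (h'.map hg g.injective)
    rw [← (linPart g).inner_map_map, ht, linPart_sub, inner_smul_left, h2, mul_zero]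
  have shift : ∀ {x y}, ⟪n, x - v⟫_ℝ = 0 → ⟪n, y - v⟫_ℝ = 0 → ⟪n, x - y⟫_ℝ = 0 := by
    intro x y hx hy
    rw [← sub_sub_sub_cancel_right x y v, inner_sub_right, hx, hy, sub_zero]
  have shift' : ∀ {x y}, ⟪n, x - y⟫_ℝ = 0 → ⟪n, y - v⟫_ℝ = 0 → ⟪n, x - v⟫_ℝ = 0 := by
    intro x y hx hy
    rw [← sub_add_sub_cancel x y v, inner_add_right, hx, hy, add_zero]
  have key : ∀ F₁ y p q, K.Corner F₁ y p q → ⟪n, y - v⟫_ℝ = 0 → ⟪n, p - v⟫_ℝ = 0 →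
      ⟪n, q - v⟫_ℝ = 0 → ∀ x, s(y, x) ∈ K.edges → ⟪n, x - v⟫_ℝ = 0 := by
    intro F₁ y p q h₁ hy hp hq x hx
    refine (nbrs_induction H.complex (h₁.mem_verts H.complex).1 (S := fun x => ⟪n, x - v⟫_ℝ = 0 ∧
      ∃ F₂ z, K.Corner F₂ y x z ∧ ⟪n, z - v⟫_ℝ = 0) (h₁.mem_edges H.complex) ⟨hp, F₁, q, h₁, hq⟩
      ?_ hx).1
    rintro F₃ x z h₃ ⟨hx, F₂, z', h₂, hz'⟩
    exact ⟨shift' (hall h₂ ⟨hn.ne_zero, shift hx hy, shift hz' hy⟩ h₃) hy, F₃, x, h₃.symm, hx⟩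
  have hverts : ∀ x ∈ K.verts, ⟪n, x - v⟫_ℝ = 0 := by
    intro x hx
    refine (verts_induction H.complex (h.mem_verts H.complex).1 (S := fun x => ⟪n, x - v⟫_ℝ = 0 ∧
      ∀ y, s(x, y) ∈ K.edges → ⟪n, y - v⟫_ℝ = 0)
      ⟨by simp, key F v u w h (by simp) hn.left hn.right⟩ ?_ hx).1
    rintro x y hxy ⟨hx, hxall⟩
    have hy := hxall y hxy
    obtain ⟨F₁, q, h₁⟩ := exists_corner_of_edge H.complex hxy
    obtain ⟨q₁, h₂⟩ := h₁.next H.complex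
    have hq := hxall q (h₁.symm.mem_edges H.complex)
    refine ⟨hy, key F₁ y x q₁ h₂ hy hx (shift' (H.planar h₁ ⟨hn.ne_zero, shift hy hx, shift hq hx⟩
      (y := y) (by rw [Sym2.eq_swap]; exact h₂.right)) hx)⟩
  have hmem : v + n ∈ K.hull := by rw [H.hull]; trivial
  have h3 := sub_mem_of_hull (S := (ℝ ∙ n)ᗮ) (v := v) (fun x hx =>
    (Submodule.mem_orthogonal_singleton_iff_inner_right).2 (hverts x hx)) hmem
  rw [add_sub_cancel_left, Submodule.mem_orthogonal_singleton_iff_inner_right] at h3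
  exact hn.ne_zero (inner_self_eq_zero.1 h3)

/-- No line lies in the planes of all corners at a vertex. -/
theorem IsMirrored.eq_zero_of_planes (H : K.IsMirrored) {v : E3} (hv : v ∈ K.verts) {x : E3}
    (hx : ∀ F u w n, K.Corner F v u w → PlaneNormal (u - v) (w - v) n → ⟪n, x⟫_ℝ = 0) :
    x = 0 := by
  -- Two faces at the edge `vu` have different planes, which meet in the line of that edge. The same
  -- applies to `vw`, and the two lines meet only in `v`.
  have key : ∀ {F u w}, K.Corner F v u w → ∃ α : ℝ, x = α • (u - v) := by
    intro F u w h
    obtain ⟨n, hn⟩ := exists_normal (u - v) (w - v)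
    obtain ⟨F', w', h', hoff⟩ := H.exists_corner_off h hn
    obtain ⟨n', hn'⟩ := exists_normal (u - v) (w' - v)
    obtain ⟨α, β, e⟩ := hn.exists_of_perp (H.indep h) (hx F u w n h hn)
    have h1 := hx F' u w' n' h' hn'
    rw [e, inner_add_right, inner_smul_right, inner_smul_right, hn'.left, mul_zero, zero_add,
      mul_eq_zero] at h1
    rcases h1 with rfl | h1
    · exact ⟨α, by rw [e, zero_smul, add_zero]⟩
    · exfalso
      obtain ⟨t, ht⟩ := hn.eq_smul (H.indep h) hn'.left h1
      have h2 := hn'.right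
      rw [ht, inner_smul_left, mul_eq_zero, or_iff_left hoff] at h2
      apply hn'.ne_zero
      rw [ht, show t = 0 from h2, zero_smul]
  obtain ⟨F, u, w, h⟩ := exists_corner_of_vert H.complex hv
  obtain ⟨α, e1⟩ := key h
  obtain ⟨β, e2⟩ := key h.symm
  have := LinearIndependent.pair_iff.1 (H.indep h) α (-β) (by rw [neg_smul, ← e1, ← e2]; abel)
  rw [e1, this.1, zero_smul]

/-- Every vertex lies on an edge of some face. Only finitely many faces meet `C`, and on each of
them only finitely many edges do. -/
theorem verts_finite (hK : K.IsPolygonalComplex) {C : Set E3} (hC : IsCompact C) :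
    (K.verts ∩ C).Finite := by
  have hedge : ∀ F ∈ K.faces, {e | e ∈ F ∧ (edgeSegment e ∩ C).Nonempty}.Finite := by
    intro F hF
    rcases hK.isPolygon F hF with ⟨n, hn, v, -, rfl⟩ | ⟨v, -, -, hfin⟩
    · have : NeZero n := ⟨by omega⟩
      exact (finite_range _).subset fun e he => he.1
    · exact hfin C hC
  have hfin := (hK.discrete C hC).biUnion (t := fun F => ⋃ e ∈ {e | e ∈ F ∧
    (edgeSegment e ∩ C).Nonempty}, {v | v ∈ e}) (fun F hF => (hedge F hF.1).biUnion fun e _ => by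
      induction e using Sym2.ind with
      | _ x y => exact (toFinite {x, y}).subset fun v hv => by simpa using hv)
  refine hfin.subset ?_
  rintro v ⟨hv, hvC⟩
  obtain ⟨F, u, w, h⟩ := exists_corner_of_vert hK hv
  have hseg : v ∈ edgeSegment s(v, u) := left_mem_segment ℝ v u
  simp only [mem_iUnion]
  exact ⟨F, ⟨h.face, v, mem_biUnion h.left hseg, hvC⟩, s(v, u), ⟨h.left, v, hseg, hvC⟩, by simp⟩

end CellData

/-! ### The vertex set is relatively dense and uniformly separated -/

namespace CellData

variable {K : CellData}

theorem IsMirrored.vert_trans (H : K.IsMirrored) {v v' : E3} (hv : v ∈ K.verts)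
    (hv' : v' ∈ K.verts) : ∃ g : E3 ≃ᵢ E3, K.map g = K ∧ g v = v' := by
  obtain ⟨F, u, w, h⟩ := exists_corner_of_vert H.complex hv
  obtain ⟨F', u', w', h'⟩ := exists_corner_of_vert H.complex hv'
  obtain ⟨g, hg, hgv, -⟩ := H.trans h h'
  exact ⟨g, hg, hgv⟩

theorem IsMirrored.edge_norm_eq (H : K.IsMirrored) {v u v' u' : E3} (h : s(v, u) ∈ K.edges)
    (h' : s(v', u') ∈ K.edges) : ‖u - v‖ = ‖u' - v'‖ := by
  obtain ⟨F, w, hc⟩ := exists_corner_of_edge H.complex h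
  obtain ⟨F', w', hc'⟩ := exists_corner_of_edge H.complex h'
  exact H.norm_eq hc hc'

theorem IsMirrored.nbrs_finite (H : K.IsMirrored) (v : E3) : {u | s(v, u) ∈ K.edges}.Finite := by
  by_cases h : ∃ u, s(v, u) ∈ K.edges
  · obtain ⟨u₀, h₀⟩ := h
    refine (verts_finite H.complex (isCompact_closedBall v ‖u₀ - v‖)).subset fun u hu => ⟨?_, ?_⟩
    · exact H.complex.mem_verts _ hu u (by simp)
    · rw [Metric.mem_closedBall, dist_eq_norm, H.edge_norm_eq hu h₀]
  · convert finite_empty (α := E3)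
    exact eq_empty_of_forall_notMem fun u hu => h ⟨u, hu⟩

/-- A symmetry fixing a vertex and its neighbours is trivial. -/
theorem IsMirrored.eq_one (H : K.IsMirrored) {v : E3} (hv : v ∈ K.verts) {A : E3 ≃ₗᵢ[ℝ] E3}
    (hA : ∀ u, s(v, u) ∈ K.edges → A (u - v) = u - v) : A = 1 := by
  obtain ⟨F, u, w, h⟩ := exists_corner_of_vert H.complex hv
  obtain ⟨n, hn⟩ := exists_normal (u - v) (w - v)
  obtain ⟨F', w', h', hoff⟩ := H.exists_corner_off h hn
  refine (hn.eq_one_or_mirrorMap (H.indep h) (hA u (h.mem_edges H.complex))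
    (hA w (h.symm.mem_edges H.complex))).resolve_right fun e => hoff ?_
  have h1 := hA w' (h'.symm.mem_edges H.complex)
  rw [e, mirrorMap_apply, sub_eq_self] at h1
  have h2 := (smul_eq_zero.1 h1).resolve_right hn.ne_zero
  rw [div_eq_zero_iff, or_iff_left (inner_self_ne_zero.2 hn.ne_zero)] at h2
  linarith

/-- The edges at a vertex are balanced. -/
theorem IsMirrored.sum_nbrs (H : K.IsMirrored) {v : E3} (hv : v ∈ K.verts) :
    ∑ u ∈ (H.nbrs_finite v).toFinset, (u - v) = 0 := by
  apply H.eq_zero_of_planes hv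
  intro F u w n h hn
  obtain ⟨hm, -⟩ := H.map_moveIso h h (mirrorMap_of_perp hn.left) (mirrorMap_of_perp hn.right)
  set S := ∑ u ∈ (H.nbrs_finite v).toFinset, (u - v) with hS
  -- Each mirror at `v` permutes the neighbours, so the sum lies in all mirrors at once, and these
  -- have only the zero vector in common.
  have hfix : mirrorMap n S = S := by
    rw [hS, map_sum]
    refine Finset.sum_bij' (fun x _ => moveIso (mirrorMap n) v v x)
      (fun x _ => moveIso (mirrorMap n) v v x) ?_ ?_ ?_ ?_ ?_
    · intro x hx
      have := map_edges hm ((H.nbrs_finite v).mem_toFinset.1 hx)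
      rw [Finite.mem_toFinset]
      simpa [moveIso_apply] using this
    · intro x hx
      have := map_edges hm ((H.nbrs_finite v).mem_toFinset.1 hx)
      rw [Finite.mem_toFinset]
      simpa [moveIso_apply] using this
    · intro x hx
      simp [moveIso_apply, mirrorMap_mirrorMap]
    · intro x hx
      simp [moveIso_apply, mirrorMap_mirrorMap]
    · intro x hx
      simp [moveIso_apply]
  have h1 : ⟪n, S⟫_ℝ = -⟪n, S⟫_ℝ := by
    rw [← inner_neg_left, ← mirrorMap_self, ← (mirrorMap n).inner_map_map, hfix, mirrorMap_self]
  linarith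

/-- As the edge vectors add up to zero, inner products that are never positive must all vanish; all
edges at `v` would then lie in the plane perpendicular to `x`, which `exists_corner_off` excludes.
-/
theorem IsMirrored.exists_inner_pos (H : K.IsMirrored) {v : E3} (hv : v ∈ K.verts) {x : E3}
    (hx : x ≠ 0) : ∃ u, s(v, u) ∈ K.edges ∧ 0 < ⟪u - v, x⟫_ℝ := by
  by_contra! hcon
  have h0 : ∑ u ∈ (H.nbrs_finite v).toFinset, ⟪u - v, x⟫_ℝ = 0 := by
    rw [← sum_inner, H.sum_nbrs hv, inner_zero_left]
  have h1 : ∀ u, s(v, u) ∈ K.edges → ⟪x, u - v⟫_ℝ = 0 := by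
    intro u hu
    rw [real_inner_comm]
    exact (Finset.sum_eq_zero_iff_of_nonpos fun u hu => hcon u
      ((H.nbrs_finite v).mem_toFinset.1 hu)).1 h0 u ((H.nbrs_finite v).mem_toFinset.2 hu)
  obtain ⟨F, u, w, h⟩ := exists_corner_of_vert H.complex hv
  obtain ⟨F', w', h', hoff⟩ := H.exists_corner_off (n := x) h
    ⟨hx, h1 u (h.mem_edges H.complex), h1 w (h.symm.mem_edges H.complex)⟩
  exact hoff (h1 w' (h'.symm.mem_edges H.complex))

/-- In every direction there is an edge, uniformly. -/
theorem IsMirrored.exists_inner_ge (H : K.IsMirrored) :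
    ∃ ε : ℝ, 0 < ε ∧ ∀ v ∈ K.verts, ∀ x : E3, ∃ u, s(v, u) ∈ K.edges ∧
      ε * ‖x‖ ≤ ⟪u - v, x⟫_ℝ := by
  obtain ⟨F, o, p, q, h⟩ := H.nonempty
  have ho := (h.mem_verts H.complex).1
  set N := (H.nbrs_finite o).toFinset with hN
  have hmemN : ∀ {u}, u ∈ N ↔ s(o, u) ∈ K.edges := fun {u} => (H.nbrs_finite o).mem_toFinset
  have hNne : N.Nonempty := ⟨p, hmemN.2 (h.mem_edges H.complex)⟩
  -- The sum of the positive parts is continuous and positive on the unit sphere, so it has a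
  -- positive minimum `m`; some neighbour contributes at least `m` divided by the number of
  -- neighbours.
  have hcont : Continuous fun x : E3 => ∑ u ∈ N, max ⟪u - o, x⟫_ℝ 0 := by fun_prop
  have hne : (Metric.sphere (0 : E3) 1).Nonempty := NormedSpace.sphere_nonempty.2 zero_le_one
  obtain ⟨x₀, hx₀, hmin⟩ := (isCompact_sphere (0 : E3) 1).exists_isMinOn hne hcont.continuousOn
  set m := ∑ u ∈ N, max ⟪u - o, x₀⟫_ℝ 0 with hm
  have hmpos : 0 < m := by
    have hx0 : x₀ ≠ 0 := by
      rintro rfl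
      simp at hx₀
    obtain ⟨u, hu, hpos⟩ := H.exists_inner_pos ho hx0
    exact Finset.sum_pos' (fun _ _ => le_max_right _ _) ⟨u, hmemN.2 hu, lt_max_of_lt_left hpos⟩
  have hcard : (0 : ℝ) < N.card := by exact_mod_cast hNne.card_pos
  have hbase : ∀ x : E3, ∃ u, s(o, u) ∈ K.edges ∧ m / N.card * ‖x‖ ≤ ⟪u - o, x⟫_ℝ := by
    intro x
    by_cases hx : x = 0
    · exact ⟨p, h.mem_edges H.complex, by simp [hx]⟩
    have hxn : 0 < ‖x‖ := norm_pos_iff.2 hx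
    have hy : ‖x‖⁻¹ • x ∈ Metric.sphere (0 : E3) 1 := by
      rw [mem_sphere_zero_iff_norm, norm_smul, norm_inv, norm_norm, inv_mul_cancel₀ hxn.ne']
    have h1 : m ≤ ∑ u ∈ N, max ⟪u - o, ‖x‖⁻¹ • x⟫_ℝ 0 := hmin hy
    obtain ⟨u, hu, h2⟩ := Finset.exists_le_of_sum_le (f := fun _ => m / N.card)
      (g := fun u => max ⟪u - o, ‖x‖⁻¹ • x⟫_ℝ 0) hNne (by
      rw [Finset.sum_const, nsmul_eq_mul, mul_div_cancel₀ _ hcard.ne']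
      exact h1)
    refine ⟨u, hmemN.1 hu, ?_⟩
    have h3 : m / N.card ≤ ⟪u - o, ‖x‖⁻¹ • x⟫_ℝ :=
      (le_max_iff.1 h2).resolve_right (not_le.2 (div_pos hmpos hcard))
    rw [inner_smul_right, ← div_eq_inv_mul, le_div_iff₀ hxn] at h3
    exact h3
  refine ⟨m / N.card, div_pos hmpos hcard, fun v hv x => ?_⟩
  obtain ⟨g, hg, rfl⟩ := H.vert_trans ho hv
  obtain ⟨u, hu, h1⟩ := hbase ((linPart g).symm x)
  refine ⟨g u, map_edges hg hu, ?_⟩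
  rw [LinearIsometryEquiv.norm_map] at h1
  rwa [← linPart_sub, ← (linPart g).symm.inner_map_map, LinearIsometryEquiv.symm_apply_apply]

/-- The vertices are relatively dense. -/
theorem IsMirrored.exists_vert_near (H : K.IsMirrored) :
    ∃ D : ℝ, 0 < D ∧ ∀ x : E3, ∃ v ∈ K.verts, dist v x ≤ D := by
  obtain ⟨ε, hε, hdir⟩ := H.exists_inner_ge
  obtain ⟨F, o, p, q, h⟩ := H.nonempty
  have ho := (h.mem_verts H.complex).1
  have hl : 0 < ‖p - o‖ := norm_pos_iff.2 (h.sub_ne_zero H.complex)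
  -- For a vertex `v` nearest to `x`, an edge of length `l` leaning towards `x` may not lead closer:
  -- `l² - 2⟪u - v, x - v⟫ ≥ 0`. With the uniform bound `ε` this gives `2ε‖x - v‖ ≤ l²`.
  refine ⟨‖p - o‖ ^ 2 / (2 * ε), by positivity, fun x => ?_⟩
  have hfin := verts_finite H.complex (isCompact_closedBall x (dist o x))
  obtain ⟨v, ⟨hv, hvx⟩, hmin⟩ := Set.exists_min_image _ (fun v => dist v x) hfin
    ⟨o, ho, Metric.mem_closedBall.2 le_rfl⟩
  have hmin' : ∀ w ∈ K.verts, dist v x ≤ dist w x := by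
    intro w hw
    by_cases hwx : dist w x ≤ dist o x
    · exact hmin w ⟨hw, hwx⟩
    · exact (Metric.mem_closedBall.1 hvx).trans (not_le.1 hwx).le
  refine ⟨v, hv, ?_⟩
  obtain ⟨u, hu, hin⟩ := hdir v hv (x - v)
  have h1 := hmin' u (H.complex.mem_verts _ hu u (by simp))
  rw [dist_comm v, dist_comm u, dist_eq_norm, dist_eq_norm] at h1
  have e : x - u = (x - v) - (u - v) := by abel
  have h2 := norm_sub_sq_real (x - v) (u - v)
  rw [← e, H.edge_norm_eq hu (h.mem_edges H.complex), real_inner_comm] at h2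
  rw [dist_comm v, dist_eq_norm, le_div_iff₀ (by positivity)]
  by_cases hz : ‖x - v‖ = 0
  · rw [hz, zero_mul]; positivity
  have h3 : ‖x - v‖ ^ 2 ≤ ‖x - u‖ ^ 2 := by gcongr
  nlinarith

/-- The vertices are uniformly separated. -/
theorem IsMirrored.exists_separation (H : K.IsMirrored) :
    ∃ δ : ℝ, 0 < δ ∧ ∀ v ∈ K.verts, ∀ w ∈ K.verts, dist v w < δ → v = w := by
  obtain ⟨F, o, p, q, h⟩ := H.nonempty
  have ho := (h.mem_verts H.complex).1
  have hp := (h.mem_verts H.complex).2.1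
  have hfin : ((K.verts ∩ Metric.closedBall o (dist p o)) \ {o}).Finite :=
    (verts_finite H.complex (isCompact_closedBall o (dist p o))).sdiff
  obtain ⟨z, ⟨⟨hz, hzo⟩, hne⟩, hmin⟩ := Set.exists_min_image _ (fun v => dist v o) hfin
    ⟨p, ⟨hp, Metric.mem_closedBall.2 le_rfl⟩, (h.ne_left H.complex).symm⟩
  refine ⟨dist z o, dist_pos.2 hne, fun v hv w hw hvw => ?_⟩
  obtain ⟨g, hg, rfl⟩ := H.vert_trans hw ho
  by_contra hne'
  rw [← g.dist_eq] at hvw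
  exact absurd hvw (not_lt.2 (hmin (g v) ⟨⟨map_verts hg hv, Metric.mem_closedBall.2
    (hvw.le.trans (Metric.mem_closedBall.1 hzo))⟩, fun e => hne' (g.injective e)⟩))

end CellData

/-! ### Existence of a translation -/

theorem norm_mirrorMap_sub_le {a b : E3} {l : ℝ} (hl : 0 < l) (ha : ‖a‖ = l) (hb : ‖b‖ = l)
    (y : E3) : ‖mirrorMap a (mirrorMap b y) - y‖ ≤ 4 / l * ‖a - b‖ * ‖y‖ := by
  have h1 : ‖mirrorMap a (mirrorMap b y) - y‖ = ‖mirrorMap b y - mirrorMap a y‖ := by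
    nth_rewrite 2 [← mirrorMap_mirrorMap a y]
    rw [← map_sub, LinearIsometryEquiv.norm_map]
  -- Each term carries a factor `a - b`, so the displacement under the product of the reflections
  -- tends to zero with the distance of the roots.
  have h2 : mirrorMap b y - mirrorMap a y =
      (2 / l ^ 2) • (⟪a - b, y⟫_ℝ • a + ⟪b, y⟫_ℝ • (a - b)) := by
    rw [mirrorMap_apply, mirrorMap_apply, real_inner_self_eq_norm_sq, real_inner_self_eq_norm_sq,
      ha, hb, inner_sub_left]
    module
  have h3 : ‖⟪a - b, y⟫_ℝ • a + ⟪b, y⟫_ℝ • (a - b)‖ ≤ 2 * l * ‖a - b‖ * ‖y‖ := by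
    refine (norm_add_le _ _).trans ?_
    rw [norm_smul, norm_smul, ha]
    have e1 : ‖⟪a - b, y⟫_ℝ‖ ≤ ‖a - b‖ * ‖y‖ := norm_inner_le_norm _ _
    have e2 : ‖⟪b, y⟫_ℝ‖ ≤ l * ‖y‖ := hb ▸ norm_inner_le_norm _ _
    calc _ ≤ ‖a - b‖ * ‖y‖ * l + l * ‖y‖ * ‖a - b‖ := by gcongr
      _ = _ := by ring
  rw [h1, h2, norm_smul, Real.norm_eq_abs, abs_of_pos (by positivity)]
  calc _ ≤ 2 / l ^ 2 * (2 * l * ‖a - b‖ * ‖y‖) := by gcongr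
    _ = _ := by field_simp; ring

/-- Two non-parallel planes meet. -/
theorem exists_inner_eq {a b : E3} {l : ℝ} (ha : ⟪a, a⟫_ℝ = l) (hb : ⟪b, b⟫_ℝ = l)
    (hab : l * l - ⟪a, b⟫_ℝ * ⟪a, b⟫_ℝ ≠ 0) (s t : ℝ) : ∃ p, ⟪a, p⟫_ℝ = s ∧ ⟪b, p⟫_ℝ = t := by
  set g := ⟪a, b⟫_ℝ with hg
  have hg' : ⟪b, a⟫_ℝ = g := by rw [real_inner_comm]
  refine ⟨((s * l - t * g) / (l * l - g * g)) • a + ((t * l - s * g) / (l * l - g * g)) • b,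
    ?_, ?_⟩
  · rw [inner_add_right, inner_smul_right, inner_smul_right, ha, ← hg, div_mul_eq_mul_div,
      div_mul_eq_mul_div, ← add_div, div_eq_iff hab]
    ring
  · rw [inner_add_right, inner_smul_right, inner_smul_right, hb, hg', div_mul_eq_mul_div,
      div_mul_eq_mul_div, ← add_div, div_eq_iff hab]
    ring

/-- The reflection in the perpendicular bisector of the segment from `v` to `u`. -/
theorem moveIso_mirrorMap_apply (v u x : E3) :
    moveIso (mirrorMap (u - v)) v u x =
      x + (1 - 2 * ⟪u - v, x - v⟫_ℝ / ⟪u - v, u - v⟫_ℝ) • (u - v) := by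
  rw [moveIso_apply, mirrorMap_apply]
  module

namespace CellData

variable {K : CellData}

/-- Translation by `t` is a symmetry. -/
def IsPeriod (K : CellData) (t : E3) : Prop := K.map (fun x => t + x) = K

/-- The product of the inversions in the midpoints of the two edges of a corner is the translation
by `u - w`. -/
theorem IsMirrored.exists_period_of_pointFlip (H : K.IsMirrored) (hA : K.PointFlip) :
    ∃ t, t ≠ 0 ∧ K.IsPeriod t := by
  obtain ⟨F, v, u, w, h⟩ := H.nonempty
  refine ⟨u - w, sub_ne_zero.2 h.ne, ?_⟩
  have h1 := map_mul (H.map_pointFlip hA h).1 (H.map_pointFlip hA h.symm).1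
  have e : ((moveIso (LinearIsometryEquiv.neg ℝ) v u * moveIso (LinearIsometryEquiv.neg ℝ) v w :
      E3 ≃ᵢ E3) : E3 → E3) = fun x => u - w + x := by
    funext x
    simp only [IsometryEquiv.mul_apply, moveIso_apply, LinearIsometryEquiv.coe_neg]
    abel
  rwa [e] at h1

/-- Two edges with nearly parallel directions and different bisectors. -/
theorem IsMirrored.exists_close_edges (H : K.IsMirrored) {η : ℝ} (hη : 0 < η) :
    ∃ v u v' u', s(v, u) ∈ K.edges ∧ s(v', u') ∈ K.edges ∧ ‖(u - v) - (u' - v')‖ < η ∧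
      (u - v = u' - v' → ⟪u - v, v⟫_ℝ ≠ ⟪u' - v', v'⟫_ℝ) := by
  obtain ⟨ε, hε, hdir⟩ := H.exists_inner_ge
  obtain ⟨D, hD, hnear⟩ := H.exists_vert_near
  obtain ⟨F, o, p, q, h⟩ := H.nonempty
  obtain ⟨d, hd⟩ : ∃ d : E3, ‖d‖ = 1 := exists_norm_eq E3 zero_le_one
  -- Vertices near `k • d` with edges leaning towards `d`: the offsets `⟪u - v, v⟫` of the bisectors
  -- grow at least linearly in `k`, while the edge vectors stay in a compact ball.
  choose v hv hvD using fun k : ℕ => hnear ((k : ℝ) • d)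
  choose u hu hin using fun k : ℕ => hdir (v k) (hv k) d
  set l := ‖p - o‖ with hl
  have hnorm : ∀ k, ‖u k - v k‖ = l := fun k => H.edge_norm_eq (hu k) (h.mem_edges H.complex)
  have hoff : ∀ k : ℕ, k * ε - l * D ≤ ⟪u k - v k, v k⟫_ℝ := by
    intro k
    have e : v k = (k : ℝ) • d + (v k - (k : ℝ) • d) := by abel
    have h1 : ⟪u k - v k, v k⟫_ℝ = k * ⟪u k - v k, d⟫_ℝ + ⟪u k - v k, v k - (k : ℝ) • d⟫_ℝ := by
      nth_rewrite 2 [e]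
      rw [inner_add_right, inner_smul_right]
    have h2 : -(l * D) ≤ ⟪u k - v k, v k - (k : ℝ) • d⟫_ℝ := by
      have h3 := abs_real_inner_le_norm (u k - v k) (v k - (k : ℝ) • d)
      have h4 := hvD k
      rw [dist_eq_norm] at h4
      rw [hnorm] at h3
      have h5 : l * ‖v k - (k : ℝ) • d‖ ≤ l * D := by gcongr
      linarith [neg_abs_le ⟪u k - v k, v k - (k : ℝ) • d⟫_ℝ]
    have h6 := hin k
    rw [hd, mul_one] at h6
    have h7 : (k : ℝ) * ε ≤ k * ⟪u k - v k, d⟫_ℝ := by gcongr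
    rw [h1]
    linarith
  have hbdd : ∀ k, u k - v k ∈ Metric.closedBall (0 : E3) l := by
    intro k
    rw [mem_closedBall_zero_iff, hnorm]
  obtain ⟨a, -, φ, hφ, hlim⟩ := (isCompact_closedBall (0 : E3) l).tendsto_subseq hbdd
  obtain ⟨k₀, hk₀⟩ := Metric.tendsto_atTop.1 hlim (η / 2) (by positivity)
  -- Beyond this index the offset exceeds that of the edge number `φ k₀`.
  obtain ⟨m, hm⟩ := exists_nat_gt ((⟪u (φ k₀) - v (φ k₀), v (φ k₀)⟫_ℝ + l * D) / ε)
  set j := φ (max k₀ m) with hj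
  have hjm : (m : ℝ) ≤ j := by
    exact_mod_cast (le_max_right k₀ m).trans (hφ.id_le _)
  refine ⟨v (φ k₀), u (φ k₀), v j, u j, hu _, hu _, ?_, fun _ => ?_⟩
  · have h1 := hk₀ k₀ le_rfl
    have h2 := hk₀ (max k₀ m) (le_max_left _ _)
    simp only [Function.comp_apply] at h1 h2
    rw [← dist_eq_norm]
    linarith [dist_triangle_right (u (φ k₀) - v (φ k₀)) (u j - v j) a]
  · rw [div_lt_iff₀ hε] at hm
    have h1 := hoff j
    have h2 : (m : ℝ) * ε ≤ j * ε := by gcongr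
    exact ne_of_lt (by linarith)

/-- Two parallel but distinct bisectors give a translation. Otherwise their product is a rotation
about an axis, so slow that it fixes all vertices close to a point of the axis, hence a vertex with
all its neighbours; it would be the identity. -/
theorem IsMirrored.exists_period_of_mirrorFlip (H : K.IsMirrored) (hB : K.MirrorFlip) :
    ∃ t, t ≠ 0 ∧ K.IsPeriod t := by
  obtain ⟨D, hD, hnear⟩ := H.exists_vert_near
  obtain ⟨δ, hδ, hsep⟩ := H.exists_separation
  obtain ⟨F, o, p, q, h⟩ := H.nonempty
  set l := ‖p - o‖ with hl
  have hlpos : 0 < l := norm_pos_iff.2 (h.sub_ne_zero H.complex)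
  have hnorm : ∀ {v u}, s(v, u) ∈ K.edges → ‖u - v‖ = l :=
    fun hu => H.edge_norm_eq hu (h.mem_edges H.complex)
  -- The bound `l` keeps the edge vectors from being opposite. The second bound makes the
  -- displacement of any point within `D + l` of the axis point smaller than `δ`, by
  -- `norm_mirrorMap_sub_le`.
  obtain ⟨v, u, v', u', hvu, hvu', hclose, hoff⟩ := H.exists_close_edges
    (η := min l (δ * l / (4 * (D + l)))) (by positivity)
  have hsymm : ∀ {v u}, s(v, u) ∈ K.edges → K.map (moveIso (mirrorMap (u - v)) v u) = K := by
    intro v u hu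
    obtain ⟨F, w, hc⟩ := exists_corner_of_edge H.complex hu
    exact (H.map_mirrorFlip hB hc).1
  have hne : ∀ {v u}, s(v, u) ∈ K.edges → u - v ≠ 0 := by
    intro v u hu
    exact norm_pos_iff.1 (by rw [hnorm hu]; exact hlpos)
  have hg := map_mul (hsymm hvu) (hsymm hvu')
  set g := moveIso (mirrorMap (u - v)) v u * moveIso (mirrorMap (u' - v')) v' u' with hgdef
  have hself : ∀ {v u}, s(v, u) ∈ K.edges → ⟪u - v, u - v⟫_ℝ = l ^ 2 := by
    intro v u hu
    rw [real_inner_self_eq_norm_sq, hnorm hu]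
  by_cases hpar : u - v = u' - v'
  · have hl2 : l ^ 2 ≠ 0 := by positivity
    refine ⟨(2 * (⟪u - v, v⟫_ℝ - ⟪u' - v', v'⟫_ℝ) / l ^ 2) • (u - v), ?_, ?_⟩
    · refine smul_ne_zero ?_ (hne hvu)
      have := sub_ne_zero.2 (hoff hpar)
      positivity
    · have e : (g : E3 → E3) = fun x =>
          (2 * (⟪u - v, v⟫_ℝ - ⟪u' - v', v'⟫_ℝ) / l ^ 2) • (u - v) + x := by
        funext x
        rw [hgdef, IsometryEquiv.mul_apply, moveIso_mirrorMap_apply,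
          moveIso_mirrorMap_apply, ← hpar, hself hvu]
        have e1 : ∀ τ : ℝ, ⟪u - v, x + τ • (u - v) - v⟫_ℝ =
            ⟪u - v, x⟫_ℝ + τ * l ^ 2 - ⟪u - v, v⟫_ℝ := by
          intro τ
          rw [inner_sub_right, inner_add_right, inner_smul_right, hself hvu]
        rw [e1, inner_sub_right]
        match_scalars
        · ring
        all_goals
          field_simp
          ring
      rwa [e] at hg
  · exfalso
    set a := u - v with ha
    set b := u' - v' with hb
    have hab : 0 < l ^ 2 * l ^ 2 - ⟪a, b⟫_ℝ * ⟪a, b⟫_ℝ := by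
      have h1 : 0 < ‖a - b‖ := norm_pos_iff.2 (sub_ne_zero.2 hpar)
      have h2 : ‖a - b‖ < l := hclose.trans_le (min_le_left _ _)
      have h3 := norm_sub_sq_real a b
      rw [hnorm hvu, hnorm hvu'] at h3
      have h4 : ‖a - b‖ ^ 2 < l ^ 2 := by gcongr
      have h5 : 0 < ‖a - b‖ ^ 2 := by positivity
      have h6 : 0 < (l ^ 2 - ⟪a, b⟫_ℝ) * (l ^ 2 + ⟪a, b⟫_ℝ) :=
        mul_pos (by linarith) (by nlinarith)
      nlinarith
    -- A point common to both bisectors: the bisector of the edge from `v` to `u` is given by `⟪a,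
    -- x⟫ = ⟪a, v⟫ + l² / 2`.
    obtain ⟨c, hc1, hc2⟩ := exists_inner_eq (hself hvu) (hself hvu') hab.ne'
      (⟪a, v⟫_ℝ + l ^ 2 / 2) (⟪b, v'⟫_ℝ + l ^ 2 / 2)
    have hl2 : l ^ 2 ≠ 0 := by positivity
    have hfix' : ∀ {v u}, s(v, u) ∈ K.edges → ⟪u - v, c⟫_ℝ = ⟪u - v, v⟫_ℝ + l ^ 2 / 2 →
        moveIso (mirrorMap (u - v)) v u c = c := by
      intro v u hu hc
      rw [moveIso_mirrorMap_apply, hself hu, inner_sub_right, hc, add_sub_cancel_left,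
        mul_div_cancel₀ _ two_ne_zero, div_self hl2, sub_self, zero_smul, add_zero]
    have hfix : g c = c :=
      (congrArg (moveIso (mirrorMap (u - v)) v u) (hfix' hvu' hc2)).trans (hfix' hvu hc1)
    have hlin : ∀ x, linPart g x = mirrorMap a (mirrorMap b x) := by
      intro x
      rw [hgdef, linPart_mul, linPart_moveIso, linPart_moveIso]
      rfl
    have hmove : ∀ x ∈ K.verts, dist x c ≤ D + l → g x = x := by
      intro x hx hxc
      refine hsep _ (map_verts hg hx) _ hx ?_
      have e : g x - x = mirrorMap a (mirrorMap b (x - c)) - (x - c) := by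
        rw [← hlin, linPart_sub, hfix]
        abel
      rw [dist_eq_norm] at hxc ⊢
      rw [e]
      have h1 : ‖a - b‖ < δ * l / (4 * (D + l)) := hclose.trans_le (min_le_right _ _)
      calc _ ≤ 4 / l * ‖a - b‖ * ‖x - c‖ := norm_mirrorMap_sub_le hlpos (hnorm hvu) (hnorm hvu') _
        _ ≤ 4 / l * ‖a - b‖ * (D + l) := by gcongr
        _ < 4 / l * (δ * l / (4 * (D + l))) * (D + l) := by gcongr
        _ = δ := by field_simp
    obtain ⟨y, hy, hyc⟩ := hnear c
    have hgy := hmove y hy (by linarith)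
    have hone : linPart g = 1 := by
      apply H.eq_one hy
      intro z hz
      have hzc : dist z c ≤ D + l := by
        have h1 : dist z y = l := by rw [dist_eq_norm, hnorm hz]
        linarith [dist_triangle z y c]
      rw [linPart_sub, hmove z (H.complex.mem_verts _ hz z (by simp)) hzc, hgy]
    -- If the product of the reflections is trivial, applying it to `b` makes `b` a multiple of `a`,
    -- contrary to `hab`.
    have h1 := hlin b
    rw [hone, mirrorMap_self, map_neg, mirrorMap_apply, hself hvu] at h1
    have h2 : b = b - ((2 : ℝ) • b - (2 * ⟪a, b⟫_ℝ / l ^ 2) • a) := by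
      nth_rewrite 1 [show b = (1 : E3 ≃ₗᵢ[ℝ] E3) b from rfl, h1]
      module
    have h3 : (2 : ℝ) • b - (2 * ⟪a, b⟫_ℝ / l ^ 2) • a = 0 := by
      rw [← sub_eq_self (a := b)]
      exact h2.symm
    have h4 := congrArg (fun z => ⟪b, z⟫_ℝ) h3
    have hbb : ⟪b, b⟫_ℝ = l ^ 2 := hself hvu'
    have hba : ⟪b, a⟫_ℝ = ⟪a, b⟫_ℝ := real_inner_comm _ _
    simp only [inner_sub_right, inner_smul_right, inner_zero_right, hbb, hba] at h4
    field_simp at h4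
    nlinarith

theorem IsMirrored.exists_period (H : K.IsMirrored) : ∃ t, t ≠ 0 ∧ K.IsPeriod t :=
  H.flip_cases.elim H.exists_period_of_pointFlip H.exists_period_of_mirrorFlip

end CellData

/-! ### The translation lattice and the crystallographic restriction -/

theorem trace_mirrorMap_mul {a b : E3} (ha : a ≠ 0) (hb : b ≠ 0) :
    LinearMap.trace ℝ E3 (mirrorMap a * mirrorMap b).toLinearEquiv.toLinearMap =
      -1 + 4 * ⟪a, b⟫_ℝ ^ 2 / (⟪a, a⟫_ℝ * ⟪b, b⟫_ℝ) := by
  have haa : ⟪a, a⟫_ℝ ≠ 0 := inner_self_ne_zero.2 ha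
  have hbb : ⟪b, b⟫_ℝ ≠ 0 := inner_self_ne_zero.2 hb
  -- The product is the rotation through twice the angle `θ` of the roots, with trace `1 + 2 cos 2θ
  -- = -1 + 4 cos² θ`. The value is obtained by summing over an orthonormal basis with Parseval's
  -- identity.
  have happ : ∀ x, (mirrorMap a * mirrorMap b).toLinearEquiv.toLinearMap x =
      x - (2 * ⟪b, x⟫_ℝ / ⟪b, b⟫_ℝ) • b - (2 * ⟪a, x⟫_ℝ / ⟪a, a⟫_ℝ) • a +
        (4 * ⟪a, b⟫_ℝ * ⟪b, x⟫_ℝ / (⟪a, a⟫_ℝ * ⟪b, b⟫_ℝ)) • a := by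
    intro x
    change mirrorMap a (mirrorMap b x) = _
    rw [mirrorMap_apply, mirrorMap_apply, inner_sub_right, inner_smul_right]
    match_scalars <;> field_simp
    ring
  set e := EuclideanSpace.basisFun (Fin 3) ℝ with he
  have hsum : ∀ x y : E3, ∑ i, ⟪x, e i⟫_ℝ * ⟪e i, y⟫_ℝ = ⟪x, y⟫_ℝ :=
    fun x y => e.sum_inner_mul_inner x y
  have hterm : ∀ i, ⟪e i, (mirrorMap a * mirrorMap b).toLinearEquiv.toLinearMap (e i)⟫_ℝ =
      1 - 2 / ⟪b, b⟫_ℝ * (⟪b, e i⟫_ℝ * ⟪e i, b⟫_ℝ) - 2 / ⟪a, a⟫_ℝ * (⟪a, e i⟫_ℝ * ⟪e i, a⟫_ℝ) +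
        4 * ⟪a, b⟫_ℝ / (⟪a, a⟫_ℝ * ⟪b, b⟫_ℝ) * (⟪b, e i⟫_ℝ * ⟪e i, a⟫_ℝ) := by
    intro i
    have h1 : ⟪e i, e i⟫_ℝ = 1 := by rw [real_inner_self_eq_norm_sq, e.norm_eq_one, one_pow]
    rw [happ, inner_add_right, inner_sub_right, inner_sub_right, inner_smul_right, inner_smul_right,
      inner_smul_right, h1]
    ring
  rw [LinearMap.trace_eq_sum_inner _ e, Finset.sum_congr rfl fun i _ => hterm i,
    Finset.sum_add_distrib, Finset.sum_sub_distrib, Finset.sum_sub_distrib, ← Finset.mul_sum,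
    ← Finset.mul_sum, ← Finset.mul_sum, hsum, hsum, hsum, real_inner_comm b a]
  simp only [Finset.sum_const, Finset.card_univ, Fintype.card_fin]
  field_simp
  norm_num

namespace CellData

variable {K : CellData}

/-- The group of translations. -/
def periods (K : CellData) : AddSubgroup E3 where
  carrier := {t | K.IsPeriod t}
  zero_mem' := by
    change K.map (fun x => 0 + x) = K
    simp only [zero_add]
    exact K.map_id
  add_mem' := by
    intro s t hs ht
    change K.map (fun x => s + t + x) = K
    have e : (fun x => s + t + x) = (fun x : E3 => s + x) ∘ fun x => t + x := by
      funext x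
      simp [add_assoc]
    change K.map (fun x => s + x) = K at hs
    change K.map (fun x => t + x) = K at ht
    rw [e, ← map_map, ht, hs]
  neg_mem' := by
    intro t ht
    change K.map (fun x => -t + x) = K
    change K.map (fun x => t + x) = K at ht
    have e : (fun x : E3 => -t + x) ∘ (fun x => t + x) = id := by
      funext x
      simp
    have h : (K.map fun x => t + x).map (fun x => -t + x) = K := by rw [map_map, e, map_id]
    rwa [ht] at h

theorem IsPeriod.linPart {t : E3} (ht : K.IsPeriod t) {g : E3 ≃ᵢ E3} (hg : K.map g = K) :
    K.IsPeriod (linPart g t) := by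
  have e : (fun x => _root_.linPart g t + x) =
      g ∘ (fun x => t + x) ∘ (g⁻¹ : E3 ≃ᵢ E3) := by
    funext x
    have h1 := linPart_sub g (t + (g⁻¹ : E3 ≃ᵢ E3) x) ((g⁻¹ : E3 ≃ᵢ E3) x)
    rw [add_sub_cancel_right, IsometryEquiv.apply_inv_self] at h1
    simp [h1]
  change K.map (fun x => _root_.linPart g t + x) = K
  change K.map (fun x => t + x) = K at ht
  rw [e, ← map_map, ← map_map, map_inv hg, ht, hg]

/-- A period shorter than the separation of the vertices leaves a vertex in place, so it is zero. -/
theorem IsMirrored.discreteTopology_periods (H : K.IsMirrored) :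
    DiscreteTopology K.periods := by
  obtain ⟨δ, hδ, hsep⟩ := H.exists_separation
  obtain ⟨F, o, p, q, h⟩ := H.nonempty
  have ho := (h.mem_verts H.complex).1
  rw [discreteTopology_iff_isOpen_singleton_zero, Metric.isOpen_singleton_iff]
  refine ⟨δ, hδ, fun t ht => Subtype.ext ?_⟩
  have h1 : (t : E3) + o ∈ K.verts := map_verts (g := fun x => (t : E3) + x) t.2 ho
  have h2 := hsep _ h1 _ ho (by
    rw [dist_eq_norm, add_sub_cancel_right]
    rwa [dist_eq_norm, sub_zero] at ht)
  simpa using h2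

/-- Some mirror at `o` does not contain the given period `t`; the difference of `t` and its image is
a multiple of the normal, which therefore lies in the span. Symmetries carry it to the normals of
all corners at `o`, and only the zero vector is perpendicular to all of these. -/
theorem IsMirrored.span_periods (H : K.IsMirrored) :
    Submodule.span ℝ (K.periods : Set E3) = ⊤ := by
  obtain ⟨F, o, p, q, h⟩ := H.nonempty
  have ho := (h.mem_verts H.complex).1
  obtain ⟨t, ht0, ht⟩ := H.exists_period
  set W := Submodule.span ℝ (K.periods : Set E3) with hW
  have hinv : ∀ g : E3 ≃ᵢ E3, K.map g = K → ∀ x ∈ W, linPart g x ∈ W := by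
    intro g hg x hx
    induction hx using Submodule.span_induction with
    | mem x hx => exact Submodule.subset_span (IsPeriod.linPart hx hg)
    | zero => rw [map_zero]; exact W.zero_mem
    | add x y _ _ hx hy => rw [map_add]; exact W.add_mem hx hy
    | smul c x _ hx => rw [map_smul]; exact W.smul_mem c hx
  have htW : t ∈ W := Submodule.subset_span ht
  obtain ⟨F₁, u, w, n, h₁, hn, hnt⟩ : ∃ F u w n, K.Corner F o u w ∧ PlaneNormal (u - o) (w - o) n ∧
      ⟪n, t⟫_ℝ ≠ 0 := by
    by_contra! hcon
    exact ht0 (H.eq_zero_of_planes ho fun F u w n h hn => hcon F u w n h hn)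
  have hnW : n ∈ W := by
    have h1 := hinv _ (H.map_moveIso h₁ h₁ (mirrorMap_of_perp hn.left)
      (mirrorMap_of_perp hn.right)).1 t htW
    rw [linPart_moveIso, mirrorMap_apply] at h1
    have h2 := W.sub_mem htW h1
    rw [sub_sub_cancel] at h2
    refine (W.smul_mem_iff ?_).1 h2
    have : ⟪n, n⟫_ℝ ≠ 0 := inner_self_ne_zero.2 hn.ne_zero
    positivity
  rw [← Submodule.orthogonal_eq_bot_iff, Submodule.eq_bot_iff]
  intro x hx
  apply H.eq_zero_of_planes ho
  intro F' u' w' n' h' hn'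
  obtain ⟨g, hg, g1, g2, g3, -⟩ := H.trans h₁ h'
  have hN : PlaneNormal (u' - o) (w' - o) (linPart g n) := by
    refine ⟨fun e => hn.ne_zero ((map_eq_zero_iff _ (linPart g).injective).1 e), ?_, ?_⟩
    · nth_rewrite 1 [← g2, ← g1]
      rw [← linPart_sub, LinearIsometryEquiv.inner_map_map, hn.left]
    · nth_rewrite 1 [← g3, ← g1]
      rw [← linPart_sub, LinearIsometryEquiv.inner_map_map, hn.right]
  obtain ⟨c, rfl⟩ := hN.eq_smul (H.indep h') hn'.left hn'.right
  exact Submodule.inner_right_of_mem_orthogonal (W.smul_mem c (hinv g hg n hnW)) hx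

/-- Linear parts preserve the lattice of periods, so their matrix in a lattice basis is integral. -/
theorem IsMirrored.trace_int (H : K.IsMirrored) {g : E3 ≃ᵢ E3} (hg : K.map g = K) :
    ∃ m : ℤ, LinearMap.trace ℝ E3 (linPart g).toLinearEquiv.toLinearMap = m := by
  set L := AddSubgroup.toIntSubmodule K.periods with hL
  have : DiscreteTopology L := H.discreteTopology_periods
  have : IsZLattice ℝ L := ⟨H.span_periods⟩
  have : Module.Free ℤ L := ZLattice.module_free ℝ L
  have : Module.Finite ℤ L := ZLattice.module_finite ℝ L
  set b := Module.Free.chooseBasis ℤ L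
  set B := b.ofZLatticeBasis ℝ L
  rw [LinearMap.trace_eq_matrix_trace ℝ B, Matrix.trace]
  have hentry : ∀ i, ∃ m : ℤ, Matrix.diag (LinearMap.toMatrix B B
      (linPart g).toLinearEquiv.toLinearMap) i = m := by
    intro i
    have hmem : linPart g (b i : E3) ∈ L := IsPeriod.linPart (b i).2 hg
    refine ⟨b.repr ⟨_, hmem⟩ i, ?_⟩
    rw [Matrix.diag_apply, LinearMap.toMatrix_apply, ← Module.Basis.ofZLatticeBasis_repr_apply ℝ L b]
    rw [Module.Basis.ofZLatticeBasis_apply]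
    rfl
  choose m hm using hentry
  refine ⟨∑ i, m i, ?_⟩
  rw [Finset.sum_congr rfl fun i _ => hm i]
  push_cast
  rfl

/-- `a` is the root of a reflection that is the linear part of a symmetry. -/
structure IsRoot (K : CellData) (a : E3) : Prop where
  ne_zero : a ≠ 0
  exists_symm : ∃ g : E3 ≃ᵢ E3, K.map g = K ∧ linPart g = mirrorMap a

/-- The crystallographic restriction for a pair of roots. -/
theorem IsMirrored.four_cos_sq (H : K.IsMirrored) {a b : E3} (ha : K.IsRoot a) (hb : K.IsRoot b) :
    ∃ m : ℤ, 4 * ⟪a, b⟫_ℝ ^ 2 = m * (⟪a, a⟫_ℝ * ⟪b, b⟫_ℝ) := by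
  obtain ⟨g, hg, eg⟩ := ha.exists_symm
  obtain ⟨g', hg', eg'⟩ := hb.exists_symm
  obtain ⟨m, hm⟩ := H.trace_int (map_mul hg hg')
  rw [linPart_mul, eg, eg', trace_mirrorMap_mul ha.ne_zero hb.ne_zero] at hm
  refine ⟨m + 1, ?_⟩
  have haa : ⟪a, a⟫_ℝ ≠ 0 := inner_self_ne_zero.2 ha.ne_zero
  have hbb : ⟪b, b⟫_ℝ ≠ 0 := inner_self_ne_zero.2 hb.ne_zero
  have : 4 * ⟪a, b⟫_ℝ ^ 2 / (⟪a, a⟫_ℝ * ⟪b, b⟫_ℝ) = m + 1 := by linarith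
  rw [div_eq_iff (mul_ne_zero haa hbb)] at this
  rw [this]
  push_cast
  ring

end CellData

/-! ### The angles and the star of a vertex -/

/-- For unit vectors `b' = x a + k b + z n`, `c` is the cosine between `a` and either of `b`, `b'`,
`q` that between `b` and `b'`, and `Z = z²‖n‖²`; `h1`, `h2`, `h3` are the products of `b'` with `a`,
`b`, `b'`. Elimination gives `m = 2(1 + k)` and `m' = (1 + c)(1 - k)`, whence `0 < m < 4` and `0 <
m' < 4 - m`: only the pairs (1,1), (1,2) and (2,1) remain. -/
theorem star_numbers {c q x k Z : ℝ} {m m' : ℤ} (hc : c ^ 2 < 1) (h1 : c = x + k * c)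
    (h2 : q = x * c + k) (h3 : 1 = x * c + k * q + Z) (hZ : 0 < Z) (h4 : 2 * Z = m * (1 - q))
    (h5 : 1 - q = m' * (1 - c)) :
    (c = 0 ∧ q = 0) ∨ (c = 1 / 3 ∧ q = -1 / 3) ∨ (c = -1 / 3 ∧ q = -1 / 3) := by
  have hx : x = c * (1 - k) := by linarith
  have hq : 1 - q = (1 - c ^ 2) * (1 - k) := by rw [h2, hx]; ring
  have hZ' : Z = (1 - c ^ 2) * (1 - k ^ 2) := by
    have : q = 1 - (1 - c ^ 2) * (1 - k) := by linarith
    rw [this, hx] at h3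
    linear_combination -h3
  have hc1 : 0 < 1 - c ^ 2 := by linarith
  have hk : k ^ 2 < 1 := by
    rw [hZ'] at hZ
    have := pos_of_mul_pos_right hZ hc1.le
    linarith
  have hk1 : -1 < k ∧ k < 1 := abs_lt.1 ((sq_lt_one_iff_abs_lt_one k).1 hk)
  have hc2 : -1 < c ∧ c < 1 := abs_lt.1 ((sq_lt_one_iff_abs_lt_one c).1 hc)
  have hm : 2 * (1 + k) = m := by
    have h : (1 - c ^ 2) * (1 - k) ≠ 0 := mul_ne_zero hc1.ne' (by linarith)
    apply mul_right_cancel₀ h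
    rw [← hq, ← h4, hZ', hq]
    ring
  have hm' : (1 + c) * (1 - k) = m' := by
    have h : 1 - c ≠ 0 := by linarith
    apply mul_right_cancel₀ h
    rw [← h5, hq]
    ring
  have b1 : 0 < m := by
    have : (0 : ℝ) < m := by linarith
    exact_mod_cast this
  have b2 : m < 4 := by
    have : (m : ℝ) < 4 := by linarith
    exact_mod_cast this
  have b3 : 0 < m' := by
    have : (0 : ℝ) < m' := by rw [← hm']; exact mul_pos (by linarith) (by linarith)
    exact_mod_cast this
  have hm2 : (m' : ℝ) = (1 + c) * (2 - m / 2) := by rw [← hm, ← hm']; ring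
  have b4 : (m' : ℝ) < 2 * (2 - m / 2) := by
    rw [hm2]
    exact mul_lt_mul_of_pos_right (by linarith) (by linarith)
  have b5 : m' < 4 - m := by
    have : (m' : ℝ) < ((4 - m : ℤ) : ℝ) := by push_cast; linarith
    exact_mod_cast this
  have hq2 : 1 - q = m' * (1 - c) := h5
  interval_cases m
  · have hk' : k = -1 / 2 := by push_cast at hm; linarith
    interval_cases m'
    · right; right
      push_cast at hm2 h5
      constructor <;> linarith
    · right; left
      push_cast at hm2 h5
      constructor <;> linarith
  · have : m' = 1 := by omega
    subst this
    left
    push_cast at hm2 h5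
    constructor <;> linarith
  · omega

namespace CellData

variable {K : CellData}

/-- The edges from `o` in the directions `a` and `b` are adjacent edges of a face. -/
def Angle (K : CellData) (o a b : E3) : Prop := ∃ F, K.Corner F o (o + a) (o + b)

theorem Angle.symm {o a b : E3} (h : K.Angle o a b) : K.Angle o b a :=
  let ⟨F, h⟩ := h; ⟨F, Corner.symm h⟩

theorem Corner.angle {F : Set (Sym2 E3)} {v u w : E3} (h : K.Corner F v u w) :
    K.Angle v (u - v) (w - v) := ⟨F, by simpa using h⟩

theorem Angle.map {o a b : E3} (h : K.Angle o a b) {A : E3 ≃ₗᵢ[ℝ] E3}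
    (hA : K.map (moveIso A o o) = K) : K.Angle o (A a) (A b) := by
  obtain ⟨F, h⟩ := h
  have := h.map hA (IsometryEquiv.injective _)
  simp only [moveIso_apply, add_sub_cancel_left, sub_self, map_zero, add_zero] at this
  exact ⟨_, this⟩

theorem IsMirrored.angle_indep (H : K.IsMirrored) {o a b : E3} (h : K.Angle o a b) : LinearIndependent ℝ ![a, b] := by
  obtain ⟨F, h⟩ := h
  simpa using H.indep h

theorem IsMirrored.angle_norm (H : K.IsMirrored) {o o' a b a' b' : E3} (h : K.Angle o a b) (h' : K.Angle o' a' b') :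
    ‖a‖ = ‖a'‖ := by
  obtain ⟨F, h⟩ := h
  obtain ⟨F', h'⟩ := h'
  simpa using H.norm_eq h h'

theorem IsMirrored.angle_inner (H : K.IsMirrored) {o o' a b a' b' : E3} (h : K.Angle o a b) (h' : K.Angle o' a' b') :
    ⟪a, b⟫_ℝ = ⟪a', b'⟫_ℝ := by
  obtain ⟨F, h⟩ := h
  obtain ⟨F', h'⟩ := h'
  simpa using H.inner_eq h h'

theorem IsMirrored.angle_self (H : K.IsMirrored) {o o' a b a' b' : E3} (h : K.Angle o a b) (h' : K.Angle o' a' b') :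
    ⟪a, a⟫_ℝ = ⟪a', a'⟫_ℝ := by
  rw [real_inner_self_eq_norm_sq, real_inner_self_eq_norm_sq, H.angle_norm h h']

theorem IsMirrored.angle_move (H : K.IsMirrored) {o a b a' b' : E3} (h : K.Angle o a b) (h' : K.Angle o a' b')
    {A : E3 ≃ₗᵢ[ℝ] E3} (ha : A a = a') (hb : A b = b') : K.map (moveIso A o o) = K := by
  obtain ⟨F, h⟩ := h
  obtain ⟨F', h'⟩ := h'
  exact (H.map_moveIso h h' (by simpa using ha) (by simpa using hb)).1

theorem IsMirrored.map_normal (H : K.IsMirrored) {o a b n : E3} (h : K.Angle o a b) (hn : PlaneNormal a b n) :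
    K.map (moveIso (mirrorMap n) o o) = K :=
  H.angle_move h h (mirrorMap_of_perp hn.left) (mirrorMap_of_perp hn.right)

theorem IsMirrored.map_sub_right (H : K.IsMirrored) {o a b b' : E3} (h : K.Angle o a b) (h' : K.Angle o a b') :
    K.map (moveIso (mirrorMap (b - b')) o o) = K := by
  refine H.angle_move h h' (mirrorMap_of_perp ?_) (mirrorMap_sub (H.angle_norm h.symm h'.symm))
  rw [inner_sub_left, H.angle_inner h.symm h'.symm, sub_self]

theorem IsMirrored.map_sub_left (H : K.IsMirrored) {o a b : E3} (h : K.Angle o a b) :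
    K.map (moveIso (mirrorMap (a - b)) o o) = K :=
  H.angle_move h h.symm (mirrorMap_sub (H.angle_norm h h.symm))
    (mirrorMap_sub' (H.angle_norm h h.symm))

theorem Angle.ne {o a b : E3} (h : K.Angle o a b) : a ≠ b := by
  obtain ⟨F, h⟩ := h
  intro e
  exact h.ne (by rw [e])

theorem IsMirrored.exists_angle_off (H : K.IsMirrored) {o a b n : E3} (h : K.Angle o a b) (hn : PlaneNormal a b n) :
    ∃ b', K.Angle o a b' ∧ ⟪n, b'⟫_ℝ ≠ 0 := by
  obtain ⟨F, h⟩ := h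
  obtain ⟨F', w', h', hoff⟩ := H.exists_corner_off h (by simpa using hn)
  exact ⟨w' - o, ⟨F', by simpa using h'⟩, hoff⟩

theorem isRoot_of_map {o n : E3} (hn : n ≠ 0) (h : K.map (moveIso (mirrorMap n) o o) = K) :
    K.IsRoot n := ⟨hn, _, h, linPart_moveIso _ _ _⟩

theorem IsMirrored.angle_self_pos (H : K.IsMirrored) {o a b : E3} (h : K.Angle o a b) : 0 < ⟪a, a⟫_ℝ := by
  have h1 := (H.angle_indep h).ne_zero 0
  exact real_inner_self_pos.2 h1

theorem IsMirrored.angle_sq_lt (H : K.IsMirrored) {o a b : E3} (h : K.Angle o a b) : ⟪a, b⟫_ℝ ^ 2 < ⟪a, a⟫_ℝ ^ 2 := by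
  have hbb := H.angle_self h.symm h
  have hpos := H.angle_self_pos h
  have h1 : 0 < ⟪a - b, a - b⟫_ℝ := real_inner_self_pos.2 (sub_ne_zero.2 h.ne)
  have h2 : 0 < ⟪a + b, a + b⟫_ℝ := by
    refine real_inner_self_pos.2 fun e => ?_
    have := LinearIndependent.pair_iff.1 (H.angle_indep h) 1 1 (by simpa using e)
    exact one_ne_zero this.1
  rw [real_inner_sub_sub_self, hbb] at h1
  rw [real_inner_add_add_self, hbb] at h2
  nlinarith

/-- The possible angles between the edges at a vertex. -/
theorem IsMirrored.angle_cases (H : K.IsMirrored) {o a b b' n : E3} (h : K.Angle o a b) (h' : K.Angle o a b')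
    (hn : PlaneNormal a b n) (hoff : ⟪n, b'⟫_ℝ ≠ 0) :
    (⟪a, b⟫_ℝ = 0 ∧ ⟪b, b'⟫_ℝ = 0) ∨
      ((3 * ⟪a, b⟫_ℝ = ⟪a, a⟫_ℝ ∨ 3 * ⟪a, b⟫_ℝ = -⟪a, a⟫_ℝ) ∧ 3 * ⟪b, b'⟫_ℝ = -⟪a, a⟫_ℝ) := by
  have hne : b ≠ b' := by
    rintro rfl
    exact hoff hn.right
  have hL := H.angle_self_pos h
  have hab' := H.angle_inner h' h
  have hbb := H.angle_self h.symm h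
  have hbb' := H.angle_self h'.symm h
  have hnn : 0 < ⟪n, n⟫_ℝ := real_inner_self_pos.2 hn.ne_zero
  -- Three reflections are used: in the plane of `a`, `b` (root `n`), the exchange of `b` and `b'`
  -- fixing `a` (root `b - b'`), and the exchange of `a` and `b` (root `a - b`).
  obtain ⟨m, hm⟩ := H.four_cos_sq (isRoot_of_map hn.ne_zero (H.map_normal h hn))
    (isRoot_of_map (sub_ne_zero.2 hne) (H.map_sub_right h h'))
  obtain ⟨m', hm'⟩ := H.four_cos_sq (isRoot_of_map (sub_ne_zero.2 h.ne) (H.map_sub_left h))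
    (isRoot_of_map (sub_ne_zero.2 hne) (H.map_sub_right h h'))
  have hsq := H.angle_sq_lt h
  obtain ⟨x, k, z, e⟩ := hn.decompose (H.angle_indep h) b'
  have i1 : ⟪a, b⟫_ℝ = x * ⟪a, a⟫_ℝ + k * ⟪a, b⟫_ℝ := by
    rw [← hab']
    nth_rewrite 1 [e]
    rw [inner_add_right, inner_add_right, inner_smul_right, inner_smul_right, inner_smul_right,
      real_inner_comm n a, hn.left, hab']
    ring
  have i2 : ⟪b, b'⟫_ℝ = x * ⟪a, b⟫_ℝ + k * ⟪a, a⟫_ℝ := by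
    nth_rewrite 1 [e]
    rw [inner_add_right, inner_add_right, inner_smul_right, inner_smul_right, inner_smul_right,
      real_inner_comm n b, hn.right, hbb, real_inner_comm a b]
    ring
  have i3 : ⟪n, b'⟫_ℝ = z * ⟪n, n⟫_ℝ := by
    nth_rewrite 1 [e]
    rw [inner_add_right, inner_add_right, inner_smul_right, inner_smul_right, inner_smul_right,
      hn.left, hn.right]
    ring
  have i4 : ⟪a, a⟫_ℝ = x * ⟪a, b⟫_ℝ + k * ⟪b, b'⟫_ℝ + z ^ 2 * ⟪n, n⟫_ℝ := by
    rw [← hbb']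
    nth_rewrite 1 [e]
    rw [inner_add_left, inner_add_left, inner_smul_left, inner_smul_left, inner_smul_left, hab', i3]
    simp only [conj_trivial]
    ring
  have hd : ⟪b - b', b - b'⟫_ℝ = 2 * (⟪a, a⟫_ℝ - ⟪b, b'⟫_ℝ) := by
    rw [real_inner_sub_sub_self, hbb, hbb']
    ring
  have hd' : ⟪a - b, a - b⟫_ℝ = 2 * (⟪a, a⟫_ℝ - ⟪a, b⟫_ℝ) := by
    rw [real_inner_sub_sub_self, hbb]
    ring
  have hpos : 0 < ⟪a, a⟫_ℝ - ⟪b, b'⟫_ℝ := by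
    have : 0 < ⟪b - b', b - b'⟫_ℝ := real_inner_self_pos.2 (sub_ne_zero.2 hne)
    linarith
  have hdd : ⟪a - b, b - b'⟫_ℝ = -(⟪a, a⟫_ℝ - ⟪b, b'⟫_ℝ) := by
    rw [inner_sub_left, inner_sub_right, inner_sub_right, hab', hbb]
    ring
  rw [inner_sub_right, hn.right, i3, hd] at hm
  rw [hdd, hd, hd'] at hm'
  have hz : z ≠ 0 := by
    rintro rfl
    rw [zero_mul] at i3
    exact hoff i3
  set L := ⟪a, a⟫_ℝ with hLdef
  have h5 : L - ⟪b, b'⟫_ℝ = m' * (L - ⟪a, b⟫_ℝ) := by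
    apply mul_right_cancel₀ hpos.ne'
    linear_combination hm' / 4
  have h4 : 2 * (z ^ 2 * ⟪n, n⟫_ℝ) = m * (L - ⟪b, b'⟫_ℝ) := by
    apply mul_right_cancel₀ hnn.ne'
    linear_combination hm / 2
  have key := star_numbers (c := ⟪a, b⟫_ℝ / L) (q := ⟪b, b'⟫_ℝ / L) (x := x) (k := k)
    (Z := z ^ 2 * ⟪n, n⟫_ℝ / L) (m := m) (m' := m')
    (by rw [div_pow, div_lt_one (by positivity)]; exact hsq)
    (by field_simp; linarith) (by field_simp; linarith) (by field_simp; linarith)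
    (by positivity) (by field_simp; linarith) (by field_simp; linarith)
  rcases key with ⟨e1, e2⟩ | ⟨e1, e2⟩ | ⟨e1, e2⟩
  · left
    rw [div_eq_zero_iff, or_iff_left hL.ne'] at e1 e2
    exact ⟨e1, e2⟩
  · right
    rw [div_eq_iff hL.ne'] at e1 e2
    exact ⟨Or.inl (by linarith), by linarith⟩
  · right
    rw [div_eq_iff hL.ne'] at e1 e2
    exact ⟨Or.inr (by linarith), by linarith⟩

theorem IsMirrored.eq_or_eq_neg (H : K.IsMirrored) {o a d e : E3} {t : ℝ} (hd : K.Angle o a d)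
    (he : K.Angle o a e) (ht : d = t • e) : d = e ∨ d = -e := by
  have h1 := H.angle_norm hd.symm he.symm
  have h2 : 0 < ‖e‖ := norm_pos_iff.2 ((H.angle_indep he).ne_zero 1)
  rw [ht, norm_smul, Real.norm_eq_abs] at h1
  have h3 : |t| = 1 := by
    apply mul_right_cancel₀ h2.ne'
    rw [h1, one_mul]
  rcases (abs_eq zero_le_one).1 h3 with rfl | rfl
  · left; simpa using ht
  · right; simpa using ht

/-- The edges adjacent to a given edge, for right angles. -/
theorem IsMirrored.star_of_perp (H : K.IsMirrored) {o a b : E3} (h : K.Angle o a b) (h0 : ⟪a, b⟫_ℝ = 0) :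
    ∃ b', K.Angle o a b' ∧ ⟪a, b'⟫_ℝ = 0 ∧ ⟪b, b'⟫_ℝ = 0 ∧
      ∀ d, K.Angle o a d ↔ d = b ∨ d = -b ∨ d = b' ∨ d = -b' := by
  have hL := H.angle_self_pos h
  have perp : ∀ {b d n}, K.Angle o a b → K.Angle o a d → PlaneNormal a b n → ⟪n, d⟫_ℝ ≠ 0 →
      ⟪b, d⟫_ℝ = 0 := by
    intro b₁ d n h₁ hd hn hoff
    rcases H.angle_cases h₁ hd hn hoff with ⟨-, e⟩ | ⟨e | e, -⟩
    · exact e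
    · rw [H.angle_inner h₁ h, h0] at e
      linarith
    · rw [H.angle_inner h₁ h, h0] at e
      linarith
  obtain ⟨n, hn⟩ := exists_normal a b
  obtain ⟨b', h', hoff⟩ := H.exists_angle_off h hn
  have hab' : ⟪a, b'⟫_ℝ = 0 := by rw [H.angle_inner h' h, h0]
  have hbb' := perp h h' hn hoff
  have hN : PlaneNormal a b b' := ⟨(H.angle_indep h').ne_zero 1, by rw [real_inner_comm, hab'],
    by rw [real_inner_comm, hbb']⟩
  have hN' : PlaneNormal a b' b := ⟨(H.angle_indep h).ne_zero 1, by rw [real_inner_comm, h0], hbb'⟩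
  refine ⟨b', h', hab', hbb', fun d => ⟨fun hd => ?_, ?_⟩⟩
  · have had : ⟪d, a⟫_ℝ = 0 := by rw [H.angle_inner hd.symm h, h0]
    -- If `d` is perpendicular to `b'` as well as to `a`, it is a multiple of `b`. Otherwise it is
    -- off the plane of `a`, `b`, hence perpendicular to `b`, and a multiple of `b'`.
    by_cases hz : ⟪b', d⟫_ℝ = 0
    · obtain ⟨t, ht⟩ := hN'.eq_smul (H.angle_indep h') had (by rw [real_inner_comm, hz])
      rcases H.eq_or_eq_neg hd h ht with e | e
      · exact Or.inl e
      · exact Or.inr (Or.inl e)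
    · have hbd := perp h hd hN hz
      obtain ⟨t, ht⟩ := hN.eq_smul (H.angle_indep h) had (by rw [real_inner_comm, hbd])
      exact Or.inr (Or.inr (H.eq_or_eq_neg hd h' ht))
  · rintro (rfl | rfl | rfl | rfl)
    · exact h
    · have := h.map (H.map_normal h' hN')
      rwa [mirrorMap_self, mirrorMap_of_perp hN'.left] at this
    · exact h'
    · have := h'.map (H.map_normal h hN)
      rwa [mirrorMap_self, mirrorMap_of_perp hN.left] at this

/-- The edges adjacent to a given edge, for the angles of the tetrahedral and cubical type. -/
theorem IsMirrored.star_of_third (H : K.IsMirrored) {o a b : E3} (h : K.Angle o a b) {ε : ℝ} (hε : ε * ε = 1)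
    (h0 : 3 * ⟪a, b⟫_ℝ = ε * ⟪a, a⟫_ℝ) :
    ∃ b' b'', b + b' + b'' = ε • a ∧ 3 * ⟪b, b'⟫_ℝ = -⟪a, a⟫_ℝ ∧ 3 * ⟪b, b''⟫_ℝ = -⟪a, a⟫_ℝ ∧
      3 * ⟪b', b''⟫_ℝ = -⟪a, a⟫_ℝ ∧ ∀ d, K.Angle o a d ↔ d = b ∨ d = b' ∨ d = b'' := by
  have hL := H.angle_self_pos h
  have hε0 : ε ≠ 0 := by
    rintro rfl
    norm_num at hε
  have off : ∀ {b d n}, K.Angle o a b → K.Angle o a d → PlaneNormal a b n → ⟪n, d⟫_ℝ ≠ 0 →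
      3 * ⟪b, d⟫_ℝ = -⟪a, a⟫_ℝ := by
    intro b₁ d n h₁ hd hn hoff
    rcases H.angle_cases h₁ hd hn hoff with ⟨e, -⟩ | ⟨-, e⟩
    · rw [H.angle_inner h₁ h] at e
      rw [e, mul_zero, eq_comm, mul_eq_zero] at h0
      exact (h0.elim hε0 hL.ne').elim
    · exact e
  have hin : ∀ {d}, K.Angle o a d → 3 * ⟪a, d⟫_ℝ = ε * ⟪a, a⟫_ℝ := by
    intro d hd
    rw [H.angle_inner hd h, h0]
  have distinct : ∀ {d d'}, K.Angle o a d → K.Angle o a d' → d ≠ d' →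
      3 * ⟪d, d'⟫_ℝ = -⟪a, a⟫_ℝ := by
    intro d d' hd hd' hne
    obtain ⟨n, hn⟩ := exists_normal a d
    -- Two different neighbours coplanar with `a` would be mirror images in the line of `a`, so that
    -- `d' = (2ε/3) a - d`. A neighbour `b'` off the plane has product `-L/3` with both, where `L =
    -- ⟪a, a⟫`, but the formula for `d'` yields `5L/9`.
    by_cases hz : ⟪n, d'⟫_ℝ = 0
    · exfalso
      have hcase := eq_neg_or_eq_mirrorMap (a := a) (c := -d') ((H.angle_indep h).ne_zero 0) hn
        (by rw [inner_neg_right, hz, neg_zero]) (by rw [norm_neg, H.angle_norm hd'.symm hd.symm])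
        (by rw [inner_neg_right, H.angle_inner hd' hd])
      rcases hcase with e | e
      · exact hne (neg_injective e).symm
      obtain ⟨b', h', hoff⟩ := H.exists_angle_off hd hn
      have e1 := off hd h' hn hoff
      have e2 := off hd' h' ⟨hn.ne_zero, hn.left, hz⟩ hoff
      have e3 : d' = -(d - (2 * ⟪a, d⟫_ℝ / ⟪a, a⟫_ℝ) • a) := by
        rw [← mirrorMap_apply, ← e, neg_neg]
      rw [e3, inner_neg_left, inner_sub_left, inner_smul_left] at e2
      simp only [conj_trivial] at e2
      have e4 := hin hd
      have e5 := hin h'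
      have e6 : 2 * ⟪a, d⟫_ℝ / ⟪a, a⟫_ℝ = 2 * ε / 3 := by
        field_simp
        linarith
      have e7 : ε * ⟪a, b'⟫_ℝ * 3 = ⟪a, a⟫_ℝ := by linear_combination ε * e5 + ⟪a, a⟫_ℝ * hε
      rw [e6] at e2
      linarith
    · exact off hd hd' hn hz
  obtain ⟨n, hn⟩ := exists_normal a b
  obtain ⟨b', h', hoff⟩ := H.exists_angle_off h hn
  -- The third neighbour is the mirror image of `b'` in the plane of `a` and `b`.
  have hmap := H.map_normal h hn
  have h'' := h'.map hmap
  rw [mirrorMap_of_perp hn.left] at h''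
  set b'' := mirrorMap n b' with hb''
  have hne : b ≠ b' := by
    rintro rfl
    exact hoff hn.right
  have hnb'' : ⟪n, b''⟫_ℝ = -⟪n, b'⟫_ℝ := by
    rw [← inner_neg_left, ← mirrorMap_self, ← (mirrorMap n).inner_map_map, hb'', mirrorMap_mirrorMap]
  have hne2 : b ≠ b'' := by
    intro e
    rw [← e, hn.right] at hnb''
    exact hoff (by linarith)
  have hne3 : b' ≠ b'' := by
    intro e
    rw [← e] at hnb''
    exact hoff (by linarith)
  have hsum : b + b' + b'' = ε • a := by
    rw [← sub_eq_zero]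
    have q1 := hin h
    have q2 := hin h'
    have q3 := hin h''
    have q4 := distinct h h' hne
    have q5 := distinct h h'' hne2
    have q6 := H.angle_self h.symm h
    apply hn.eq_zero (H.angle_indep h)
    · rw [real_inner_comm, inner_sub_right, inner_add_right, inner_add_right, inner_smul_right]
      linarith
    · rw [real_inner_comm, inner_sub_right, inner_add_right, inner_add_right, inner_smul_right, q6,
        real_inner_comm a b]
      have q7 : ε * ⟪a, b⟫_ℝ * 3 = ⟪a, a⟫_ℝ := by linear_combination ε * q1 + ⟪a, a⟫_ℝ * hε
      linarith
    · rw [real_inner_comm, inner_sub_right, inner_add_right, inner_add_right, inner_smul_right,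
        hnb'', hn.right, hn.left]
      ring
  refine ⟨b', b'', hsum, distinct h h' hne, distinct h h'' hne2, distinct h' h'' hne3,
    fun d => ⟨fun hd => ?_, ?_⟩⟩
  -- A fourth neighbour would have product `-L` with the sum of the other three (`L = ⟪a, a⟫`),
  -- whereas its product with `ε • a` is `L/3`.
  · by_contra! hcon
    obtain ⟨c1, c2, c3⟩ := hcon
    have q1 := distinct hd h c1
    have q2 := distinct hd h' c2
    have q3 := distinct hd h'' c3
    have q4 := congrArg (fun z => ⟪d, z⟫_ℝ) hsum
    simp only [inner_add_right, inner_smul_right] at q4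
    have q5 := hin hd
    rw [real_inner_comm] at q5
    have q6 : ε * ⟪d, a⟫_ℝ * 3 = ⟪a, a⟫_ℝ := by linear_combination ε * q5 + ⟪a, a⟫_ℝ * hε
    linarith
  · rintro (rfl | rfl | rfl)
    · exact h
    · exact h'
    · exact h''

/-- Here the edge vectors are roots, so `4 cos²` of their angle is an integer. The cosines `±1/3`
would give `4/9`. -/
theorem IsMirrored.perp_of_mirrorFlip (H : K.IsMirrored) (hB : K.MirrorFlip) {o a b : E3} (h : K.Angle o a b) :
    ⟪a, b⟫_ℝ = 0 := by
  have root : ∀ {a b}, K.Angle o a b → K.IsRoot a := by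
    intro a b h
    refine ⟨(H.angle_indep h).ne_zero 0, ?_⟩
    obtain ⟨F, h⟩ := h
    refine ⟨_, (H.map_mirrorFlip hB h).1, ?_⟩
    rw [linPart_moveIso, add_sub_cancel_left]
  obtain ⟨m, hm⟩ := H.four_cos_sq (root h) (root h.symm)
  obtain ⟨n, hn⟩ := exists_normal a b
  obtain ⟨b', h', hoff⟩ := H.exists_angle_off h hn
  have hL := H.angle_self_pos h
  rw [H.angle_self h.symm h] at hm
  rcases H.angle_cases h h' hn hoff with ⟨e, -⟩ | ⟨e, -⟩
  · exact e
  · exfalso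
    have h9 : 9 * ⟪a, b⟫_ℝ ^ 2 = ⟪a, a⟫_ℝ * ⟪a, a⟫_ℝ := by
      rcases e with e | e
      · linear_combination (3 * ⟪a, b⟫_ℝ + ⟪a, a⟫_ℝ) * e
      · linear_combination (3 * ⟪a, b⟫_ℝ - ⟪a, a⟫_ℝ) * e
    have h10 : (4 : ℝ) = m * 9 := by
      have hne : ⟪a, a⟫_ℝ * ⟪a, a⟫_ℝ ≠ 0 := by positivity
      apply mul_right_cancel₀ hne
      linear_combination 9 * hm - 4 * h9
    have h11 : (4 : ℤ) = m * 9 := by exact_mod_cast h10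
    omega


end CellData

/-! ### From the star of one vertex to the whole complex -/

theorem IsPolygon.exists_mem {F : Set (Sym2 E3)} (h : IsPolygon F) : ∃ v u, s(v, u) ∈ F := by
  obtain ⟨n, -, -, v, -, rfl⟩ := h.exists_param
  exact ⟨v 0, v (0 + 1), 0, rfl⟩

/-- A complex that looks like the pattern `P` at one vertex, and whose edges are flipped as in `P`,
is the complex of the pattern. -/
theorem Pattern.eq_complex {n : ℕ} (P : Pattern n) {pos : Z3 → E3} (hpos : Function.Injective pos)
    {K : CellData} (hK : K.IsPolygonalComplex) (h0 : pos 0 ∈ K.verts)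
    (hnbr : ∀ u, s(pos 0, u) ∈ K.edges ↔ ∃ a, u = pos (P.dir a))
    (hcorner : ∀ a b, (∃ F, K.Corner F (pos 0) (pos (P.dir a)) (pos (P.dir b))) ↔ P.X a b)
    (hflip : ∀ a, ∃ g : E3 ≃ᵢ E3, K.map g = K ∧
      (∀ y, g (pos y) = pos (P.dir a + P.s (P.dir a) * y)) ∧
      ∀ F ∈ K.faces, s(pos 0, pos (P.dir a)) ∈ F → Sym2.map g '' F = F) :
    K = P.complex pos := by
  choose f hf hfpos hfF using hflip
  -- Composing the flips along a path of colours from the origin to `x` produces the symmetry `y ↦ x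
  -- + s x * y`, which transports the known star to `x`.
  have hiso : ∀ x, P.V x → ∃ g : E3 ≃ᵢ E3, K.map g = K ∧ ∀ y, g (pos y) = pos (x + P.s x * y) := by
    intro x hx
    induction hx with
    | refl => exact ⟨1, K.map_id, fun y => by rw [P.s_zero, one_mul, zero_add]; rfl⟩
    | tail _ h ih =>
      obtain ⟨a, -, rfl⟩ := h
      obtain ⟨g, hg, hgpos⟩ := ih
      refine ⟨g * f a, CellData.map_mul hg (hf a), fun y => ?_⟩
      rw [IsometryEquiv.mul_apply, hfpos, hgpos, P.s_step, Pattern.step]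
      congr 1
      ring
  have hedge : ∀ {x}, P.V x → ∀ u, s(pos x, u) ∈ K.edges ↔ ∃ a, u = pos (P.step x a) := by
    intro x hx u
    obtain ⟨g, hg, hgpos⟩ := hiso x hx
    have e0 : g (pos 0) = pos x := by rw [hgpos, mul_zero, add_zero]
    constructor
    · intro h
      obtain ⟨u, rfl⟩ := g.surjective u
      have h1 := CellData.map_edges (CellData.map_inv hg) h
      rw [← e0, IsometryEquiv.inv_apply_self, IsometryEquiv.inv_apply_self] at h1
      obtain ⟨a, rfl⟩ := (hnbr u).1 h1
      exact ⟨a, hgpos _⟩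
    · rintro ⟨a, rfl⟩
      have h1 := CellData.map_edges hg ((hnbr _).2 ⟨a, rfl⟩)
      rwa [e0, hgpos] at h1
  have hcor : ∀ {x}, P.V x → ∀ a b, (∃ F, K.Corner F (pos x) (pos (P.step x a))
      (pos (P.step x b))) ↔ P.X a b := by
    intro x hx a b
    obtain ⟨g, hg, hgpos⟩ := hiso x hx
    have e0 : g (pos 0) = pos x := by rw [hgpos, mul_zero, add_zero]
    have e1 : ∀ a, g (pos (P.dir a)) = pos (P.step x a) := fun a => hgpos _
    rw [← hcorner]
    constructor
    · rintro ⟨F, h⟩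
      have h1 := h.map (CellData.map_inv hg) (IsometryEquiv.injective _)
      rw [← e0, ← e1, ← e1, IsometryEquiv.inv_apply_self, IsometryEquiv.inv_apply_self,
        IsometryEquiv.inv_apply_self] at h1
      exact ⟨_, h1⟩
    · rintro ⟨F, h⟩
      have h1 := h.map hg g.injective
      rw [e0, e1, e1] at h1
      exact ⟨_, h1⟩
  -- The flip over the edge of colour `a` preserves the faces through it, so a face with colours
  -- `a`, `b` at one end has colour `b` at the other end too; this forces the face to be the
  -- alternating walk.
  have hnext : ∀ {x}, P.V x → ∀ {F a b}, F ∈ K.faces → P.edgeAt pos x a ∈ F →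
      P.edgeAt pos x b ∈ F → P.edgeAt pos (P.step x a) b ∈ F := by
    intro x hx F a b hF ha hb
    obtain ⟨g, hg, hgpos⟩ := hiso x hx
    have e0 : g (pos 0) = pos x := by rw [hgpos, mul_zero, add_zero]
    have e1 : ∀ a, g (pos (P.dir a)) = pos (P.step x a) := fun a => hgpos _
    have h1 := CellData.map_faces (CellData.map_inv hg) hF
    have hpull : ∀ c, P.edgeAt pos x c ∈ F →
        s(pos 0, pos (P.dir c)) ∈ Sym2.map (g⁻¹ : E3 ≃ᵢ E3) '' F := by
      intro c hc
      refine ⟨_, hc, ?_⟩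
      rw [Pattern.edgeAt, Sym2.map_mk, ← e0, ← e1, IsometryEquiv.inv_apply_self,
        IsometryEquiv.inv_apply_self]
    have h2 : s(f a (pos 0), f a (pos (P.dir b))) ∈ Sym2.map (g⁻¹ : E3 ≃ᵢ E3) '' F := by
      rw [← hfF a _ h1 (hpull a ha)]
      exact ⟨_, hpull b hb, rfl⟩
    obtain ⟨e, he, h3⟩ := h2
    have h4 : e = Sym2.map g s(f a (pos 0), f a (pos (P.dir b))) := by
      rw [← h3, Sym2.map_map]
      have : (g : E3 → E3) ∘ (g⁻¹ : E3 ≃ᵢ E3) = id := by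
        funext z
        exact g.apply_symm_apply z
      rw [this, Sym2.map_id]
      rfl
    rw [h4, Sym2.map_mk, hfpos, hfpos, hgpos, hgpos, mul_zero, add_zero] at he
    have e2 : x + P.s x * (P.dir a + P.s (P.dir a) * P.dir b) = P.step (P.step x a) b := by
      rw [Pattern.step, P.s_step, Pattern.step]
      ring
    rwa [e2] at he
  have hface : ∀ {x}, P.V x → ∀ {F a b}, K.Corner F (pos x) (pos (P.step x a))
      (pos (P.step x b)) → F = P.faceAt pos x a b := by
    intro x hx F a b h
    have hreach : ∀ y, P.Reach (two a b) x y → P.edgeAt pos y a ∈ F ∧ P.edgeAt pos y b ∈ F := by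
      intro y hy
      induction hy with
      | refl => exact ⟨h.left, h.right⟩
      | tail hxy hc ih =>
        obtain ⟨c, hc, rfl⟩ := hc
        have hy := hx.reach hxy
        rcases hc with rfl | rfl
        · exact ⟨by rw [edgeAt_step]; exact ih.1, hnext hy h.face ih.1 ih.2⟩
        · exact ⟨hnext hy h.face ih.2 ih.1, by rw [edgeAt_step]; exact ih.2⟩
    have hab : a ≠ b := by
      rintro rfl
      exact h.ne rfl
    have hother : ∀ y, P.Reach (two a b) x y → ∀ z, s(pos y, z) ∈ F →
        ∃ c, two a b c ∧ z = pos (P.step y c) := by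
      intro y hy z hz
      have hc : K.Corner F (pos y) (pos (P.step y a)) (pos (P.step y b)) :=
        ⟨h.face, (hreach y hy).1, (hreach y hy).2, fun e => hab (P.step_inj (hpos e))⟩
      by_cases e : z = pos (P.step y a)
      · exact ⟨a, Or.inl rfl, e⟩
      · exact ⟨b, Or.inr rfl, hc.eq_right hK hz e⟩
    apply Subset.antisymm
    · intro e he
      induction e using Sym2.ind with
      | _ v z =>
      obtain ⟨y, hy, rfl⟩ := (hK.isPolygon F h.face).induction
        (S := fun v => ∃ y, P.Reach (two a b) x y ∧ v = pos y) (by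
          rintro v z hvz ⟨y, hy, rfl⟩
          obtain ⟨c, hc, rfl⟩ := hother y hy z hvz
          exact ⟨_, hy.step hc, rfl⟩) ⟨x, Reach.refl, rfl⟩ h.left he
      obtain ⟨c, hc, rfl⟩ := hother y hy z he
      exact ⟨y, c, hy, hc, rfl⟩
    · rintro _ ⟨y, c, hy, rfl | rfl, rfl⟩
      · exact (hreach y hy).1
      · exact (hreach y hy).2
  have hvert : ∀ v ∈ K.verts, ∃ x, P.V x ∧ v = pos x := by
    intro v hv
    refine CellData.verts_induction hK h0 (S := fun v => ∃ x, P.V x ∧ v = pos x)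
      ⟨0, V.zero, rfl⟩ ?_ hv
    rintro v u hvu ⟨x, hx, rfl⟩
    obtain ⟨a, rfl⟩ := (hedge hx u).1 hvu
    exact ⟨_, hx.step a, rfl⟩
  apply CellData.ext
  · ext v
    refine ⟨hvert v, ?_⟩
    rintro ⟨x, hx, rfl⟩
    obtain ⟨g, hg, hgpos⟩ := hiso x hx
    have := CellData.map_verts hg h0
    rwa [hgpos, mul_zero, add_zero] at this
  · ext e
    constructor
    · intro he
      induction e using Sym2.ind with
      | _ v u =>
      obtain ⟨x, hx, rfl⟩ := hvert v (hK.mem_verts _ he v (by simp))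
      obtain ⟨a, rfl⟩ := (hedge hx u).1 he
      exact ⟨x, a, hx, rfl⟩
    · rintro ⟨x, a, hx, rfl⟩
      exact (hedge hx _).2 ⟨a, rfl⟩
  · ext F
    constructor
    · intro hF
      obtain ⟨v, u, hvu⟩ := (hK.isPolygon F hF).exists_mem
      obtain ⟨w, hw⟩ := CellData.exists_corner_of_face hK hF hvu
      obtain ⟨x, hx, rfl⟩ := hvert v (hw.mem_verts hK).1
      obtain ⟨a, rfl⟩ := (hedge hx u).1 (hw.mem_edges hK)
      obtain ⟨b, rfl⟩ := (hedge hx w).1 (hw.symm.mem_edges hK)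
      exact ⟨x, a, b, hx, (hcor hx a b).1 ⟨F, hw⟩, hface hx hw⟩
    · rintro ⟨x, a, b, hx, hab, rfl⟩
      obtain ⟨F, hF⟩ := (hcor hx a b).2 hab
      rw [← hface hx hF]
      exact hF.face

/-! ### Frames and integer coordinates for the star -/

/-- Three orthogonal vectors of the same length `√q`. -/
structure IsFrame (e : Fin 3 → E3) (q : ℝ) : Prop where
  pos : 0 < q
  self : ∀ i, ⟪e i, e i⟫_ℝ = q
  perp : ∀ i j, i < j → ⟪e i, e j⟫_ℝ = 0

/-- The vector with integer coordinates `x` in a frame. -/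
noncomputable def vecOf (e : Fin 3 → E3) (x : Z3) : E3 :=
  (x 0 : ℝ) • e 0 + (x 1 : ℝ) • e 1 + (x 2 : ℝ) • e 2

theorem vecOf_zero (e : Fin 3 → E3) : vecOf e 0 = 0 := by simp [vecOf]

theorem vecOf_add (e : Fin 3 → E3) (x y : Z3) : vecOf e (x + y) = vecOf e x + vecOf e y := by
  simp only [vecOf, Pi.add_apply, Int.cast_add]
  module

theorem vecOf_sub (e : Fin 3 → E3) (x y : Z3) : vecOf e (x - y) = vecOf e x - vecOf e y := by
  simp only [vecOf, Pi.sub_apply, Int.cast_sub]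
  module

theorem vecOf_smul (e : Fin 3 → E3) (k : ℤ) (x : Z3) : vecOf e (k • x) = (k : ℝ) • vecOf e x := by
  simp only [vecOf, Pi.smul_apply, smul_eq_mul, Int.cast_mul]
  module

theorem vecOf_neg_one_mul (e : Fin 3 → E3) (x : Z3) : vecOf e (-1 * x) = -vecOf e x := by
  rw [neg_one_mul, ← zero_sub, vecOf_sub, vecOf_zero, zero_sub]

namespace IsFrame

variable {e : Fin 3 → E3} {q : ℝ}

theorem inner_vecOf (he : IsFrame e q) (x y : Z3) :
    ⟪vecOf e x, vecOf e y⟫_ℝ = q * dotZ x y := by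
  have h01 := he.perp 0 1 (by decide)
  have h02 := he.perp 0 2 (by decide)
  have h12 := he.perp 1 2 (by decide)
  have h10 : ⟪e 1, e 0⟫_ℝ = 0 := by rw [real_inner_comm, h01]
  have h20 : ⟪e 2, e 0⟫_ℝ = 0 := by rw [real_inner_comm, h02]
  have h21 : ⟪e 2, e 1⟫_ℝ = 0 := by rw [real_inner_comm, h12]
  simp only [vecOf, inner_add_left, inner_add_right, real_inner_smul_left, real_inner_smul_right,
    he.self, h01, h02, h12, h10, h20, h21, dotZ]
  push_cast
  ring

/-- A frame is an orthonormal basis scaled by `√q`, so its coordinate map is an orthogonal map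
followed by a homothety and a translation. -/
theorem exists_dilation (he : IsFrame e q) (o : E3) :
    ∃ f : E3 ≃ᵈ E3, ∀ x, posOf f x = o + vecOf e x := by
  obtain ⟨μ, hμ, hq⟩ : ∃ μ : ℝ, 0 < μ ∧ q = μ * μ :=
    ⟨√q, Real.sqrt_pos.2 he.pos, (Real.mul_self_sqrt he.pos.le).symm⟩
  have hon : Orthonormal ℝ fun i => μ⁻¹ • e i := by
    rw [orthonormal_iff_ite]
    intro i j
    rw [real_inner_smul_left, real_inner_smul_right]
    rcases lt_trichotomy i j with h | rfl | h
    · rw [he.perp i j h, if_neg h.ne]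
      simp
    · rw [he.self, if_pos rfl, hq]
      field_simp
    · rw [real_inner_comm, he.perp j i h, if_neg h.ne']
      simp
  have hspan : ⊤ ≤ Submodule.span ℝ (range fun i => μ⁻¹ • e i) :=
    (hon.linearIndependent.span_eq_top_of_card_eq_finrank' (by simp)).ge
  set b := OrthonormalBasis.mk hon hspan with hb
  refine ⟨(b.repr.symm.toIsometryEquiv.toDilationEquiv).trans
    (DilationEquiv.smulTorsor o hμ.ne'), fun x => ?_⟩
  have h1 : b.repr.symm (castE x) = ∑ i, (x i : ℝ) • μ⁻¹ • e i := by
    rw [← b.sum_repr_symm]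
    simp [castE, hb]
  change μ • b.repr.symm (castE x) + o = _
  rw [h1, Fin.sum_univ_three, vecOf]
  match_scalars <;> field_simp

theorem vecOf_injective (he : IsFrame e q) : Function.Injective (vecOf e) := by
  obtain ⟨f, hf⟩ := he.exists_dilation 0
  intro x y h
  apply posOf_injective f
  rw [hf, hf, h]

/-- The reflection formula with denominators cleared is an identity of integer vectors, which can be
checked on a finite star. -/
theorem mirrorMap_vecOf (he : IsFrame e q) {p x y : Z3} (hp : p ≠ 0)
    (h : dotZ p p • y = dotZ p p • x - (2 * dotZ p x) • p) :
    mirrorMap (vecOf e p) (vecOf e x) = vecOf e y := by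
  have hp' : vecOf e p ≠ 0 := by
    rw [← vecOf_zero e]
    exact fun h => hp (he.vecOf_injective h)
  have hpp := inner_self_ne_zero (𝕜 := ℝ).2 hp'
  rw [he.inner_vecOf] at hpp
  have hD : (dotZ p p : ℝ) ≠ 0 := right_ne_zero_of_mul hpp
  have hq := he.pos.ne'
  have h1 := congrArg (vecOf e) h
  rw [vecOf_smul, vecOf_sub, vecOf_smul, vecOf_smul] at h1
  have h2 : vecOf e y = (dotZ p p : ℝ)⁻¹ • (dotZ p p : ℝ) • vecOf e y := by
    rw [smul_smul, inv_mul_cancel₀ hD, one_smul]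
  rw [mirrorMap_apply, he.inner_vecOf, he.inner_vecOf, h2, h1]
  push_cast
  match_scalars <;> field_simp

end IsFrame

namespace CellData

variable {K : CellData}

/-- The reflection that interchanges two adjacent directions preserves the star. -/
def _root_.Pattern.MirrorStable {n : ℕ} (P : Pattern n) : Prop :=
  ∀ i j l, P.X i j → P.X i l → ∃ m, P.X j m ∧
    dotZ (P.dir i - P.dir j) (P.dir i - P.dir j) • P.dir m =
      dotZ (P.dir i - P.dir j) (P.dir i - P.dir j) • P.dir l -
        (2 * dotZ (P.dir i - P.dir j) (P.dir l)) • (P.dir i - P.dir j)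

/-- The neighbourhood of a vertex is determined by the neighbourhood of one edge. -/
theorem IsMirrored.star_all (H : K.IsMirrored) {o : E3} {e : Fin 3 → E3} {q : ℝ}
    (he : IsFrame e q) {n : ℕ} (P : Pattern n)
    (hS : P.MirrorStable)
    {i₀ : Fin n} (hbase : ∀ d, K.Angle o (vecOf e (P.dir i₀)) d ↔
      ∃ j, P.X i₀ j ∧ d = vecOf e (P.dir j)) (i : Fin n) (d : E3) :
    K.Angle o (vecOf e (P.dir i)) d ↔ ∃ j, P.X i j ∧ d = vecOf e (P.dir j) := by
  induction P.X_conn i₀ i generalizing d with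
  | refl => exact hbase d
  | @tail i j _ hij ih =>
    have hne : ∀ {i j}, P.X i j → P.dir i - P.dir j ≠ 0 := by
      intro i j hij e
      exact Pattern.X_ne hij (P.dir_inj (sub_eq_zero.1 e))
    have hang : K.Angle o (vecOf e (P.dir i)) (vecOf e (P.dir j)) := (ih _).2 ⟨j, hij, rfl⟩
    have hnorm := H.angle_norm hang hang.symm
    constructor
    · intro hd
      -- The reflection with root the difference of two adjacent directions exchanges them, so the
      -- directions adjacent to one determine those adjacent to the other; stability of the model
      -- star matches the result.
      have h1 := hd.map (H.map_sub_left hang)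
      rw [mirrorMap_sub' hnorm] at h1
      obtain ⟨l, hl, hdl⟩ := (ih _).1 h1
      obtain ⟨m, hm, hml⟩ := hS i j l hij hl
      refine ⟨m, hm, ?_⟩
      rw [← he.mirrorMap_vecOf (hne hij) hml, vecOf_sub, ← hdl, mirrorMap_mirrorMap]
    · rintro ⟨m, hm, rfl⟩
      obtain ⟨l, hl, hml⟩ := hS j i m (P.X_symm _ _ hij) hm
      have h1 := ((ih _).2 ⟨l, hl, rfl⟩).map (H.map_sub_left hang.symm)
      rw [mirrorMap_sub' hnorm.symm, ← he.mirrorMap_vecOf (hne (P.X_symm _ _ hij)) hml, vecOf_sub,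
        mirrorMap_mirrorMap] at h1
      exact h1

/-- The frame turns the star of `o` into that of the pattern and the flips into `y ↦ dir a + s (dir
a) * y`; these are the data from which `Pattern.eq_complex` rebuilds the complex. -/
theorem IsMirrored.eq_complex (H : K.IsMirrored) {o : E3} (ho : o ∈ K.verts) {e : Fin 3 → E3}
    {q : ℝ} (he : IsFrame e q) {n : ℕ} (P : Pattern n)
    (hS : P.MirrorStable)
    {i₀ : Fin n} (hbase : ∀ d, K.Angle o (vecOf e (P.dir i₀)) d ↔
      ∃ j, P.X i₀ j ∧ d = vecOf e (P.dir j))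
    (A : Fin n → (E3 ≃ₗᵢ[ℝ] E3))
    (hA : ∀ a y, A a (vecOf e y) = vecOf e (P.s (P.dir a) * y))
    (hflip : ∀ a F w, K.Corner F o (o + vecOf e (P.dir a)) w →
      K.map (moveIso (A a) o (o + vecOf e (P.dir a))) = K ∧
        Sym2.map (moveIso (A a) o (o + vecOf e (P.dir a))) '' F = F) :
    ∃ f : E3 ≃ᵈ E3, K = P.complex (posOf f) := by
  obtain ⟨f, hf⟩ := he.exists_dilation o
  have hall := H.star_all he P hS hbase
  have hf0 : posOf f 0 = o := by rw [hf, vecOf_zero, add_zero]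
  have hedge : ∀ a, s(o, o + vecOf e (P.dir a)) ∈ K.edges := by
    intro a
    obtain ⟨b, hb⟩ := P.X_exists a
    obtain ⟨F, h⟩ := (hall a _).2 ⟨b, hb, rfl⟩
    exact h.mem_edges H.complex
  refine ⟨f, P.eq_complex (posOf_injective f) H.complex (by rwa [hf0]) ?_ ?_ ?_⟩
  · intro u
    rw [hf0]
    constructor
    · intro hu
      refine nbrs_induction H.complex ho (S := fun u => ∃ a, u = posOf f (P.dir a)) (hedge i₀)
        ⟨i₀, (hf _).symm⟩ ?_ hu
      rintro F x y hc ⟨a, rfl⟩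
      rw [hf] at hc
      obtain ⟨b, -, hb⟩ := (hall a (y - o)).1 ⟨F, by simpa using hc⟩
      exact ⟨b, by rw [hf, ← hb, add_sub_cancel]⟩
    · rintro ⟨a, rfl⟩
      rw [hf]
      exact hedge a
  · intro a b
    rw [hf0, hf, hf]
    refine (hall a (vecOf e (P.dir b))).trans ⟨?_, fun h => ⟨b, h, rfl⟩⟩
    rintro ⟨j, hj, hb⟩
    rwa [P.dir_inj (he.vecOf_injective hb)]
  · intro a
    refine ⟨moveIso (A a) o (o + vecOf e (P.dir a)), ?_, ?_, ?_⟩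
    · obtain ⟨F, w, h⟩ := exists_corner_of_edge H.complex (hedge a)
      exact (hflip a F w h).1
    · intro y
      rw [hf, hf, moveIso_apply, add_sub_cancel_left, hA, vecOf_add, add_assoc]
    · intro F hF hm
      rw [hf0, hf] at hm
      obtain ⟨w, h⟩ := exists_corner_of_face H.complex hF hm
      exact (hflip a F w h).2

theorem IsMirrored.eq_complex_of_pointFlip (H : K.IsMirrored) (hA : K.PointFlip) {o : E3}
    (ho : o ∈ K.verts) {e : Fin 3 → E3} {q : ℝ} (he : IsFrame e q) {n : ℕ} (P : Pattern n)
    (hsign : ∀ a, P.s (P.dir a) = -1)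
    (hS : P.MirrorStable)
    {i₀ : Fin n} (hbase : ∀ d, K.Angle o (vecOf e (P.dir i₀)) d ↔
      ∃ j, P.X i₀ j ∧ d = vecOf e (P.dir j)) :
    ∃ f : E3 ≃ᵈ E3, K = P.complex (posOf f) :=
  H.eq_complex ho he P hS hbase (fun _ => LinearIsometryEquiv.neg ℝ)
    (fun a y => by rw [hsign, vecOf_neg_one_mul]; rfl) fun _ _ _ h => H.map_pointFlip hA h

/-- Every direction is plus or minus a coordinate vector and its sign vector changes just that
coordinate, so multiplication by it is the reflection with root `dir a`. -/
theorem square_mirror (a : Fin 6) (y : Z3) :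
    dotZ (squarePattern.dir a) (squarePattern.dir a) • (squarePattern.s (squarePattern.dir a) * y) =
      dotZ (squarePattern.dir a) (squarePattern.dir a) • y -
        (2 * dotZ (squarePattern.dir a) y) • squarePattern.dir a := by
  have hD : ∀ a, dotZ (squarePattern.dir a) (squarePattern.dir a) = 1 := by decide +kernel
  have hcases : ∀ a, ∃ i, ∀ j, (squarePattern.dir a j = if j = i then squarePattern.dir a i else 0) ∧
      squarePattern.s (squarePattern.dir a) j = (if j = i then -1 else 1) ∧
      squarePattern.dir a i * squarePattern.dir a i = 1 := by decide +kernel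
  obtain ⟨i, hi⟩ := hcases a
  have hdot : dotZ (squarePattern.dir a) y = squarePattern.dir a i * y i := by
    simp only [dotZ]
    rw [(hi 0).1, (hi 1).1, (hi 2).1]
    fin_cases i <;> simp
  funext j
  have h1 := (hi j).2.2
  rw [hD, one_smul, one_smul, hdot, Pi.mul_apply, Pi.sub_apply, Pi.smul_apply, smul_eq_mul,
    (hi j).2.1, (hi j).1]
  by_cases hj : j = i
  · subst hj
    simp only [if_true]
    linear_combination (2 * y j) * h1
  · simp [hj]

theorem IsMirrored.eq_complex_of_mirrorFlip (H : K.IsMirrored) (hB : K.MirrorFlip) {o : E3}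
    (ho : o ∈ K.verts) {e : Fin 3 → E3} {q : ℝ} (he : IsFrame e q)
    (hS : squarePattern.MirrorStable)
    {i₀ : Fin 6} (hbase : ∀ d, K.Angle o (vecOf e (squarePattern.dir i₀)) d ↔
      ∃ j, squarePattern.X i₀ j ∧ d = vecOf e (squarePattern.dir j)) :
    ∃ f : E3 ≃ᵈ E3, K = squarePattern.complex (posOf f) :=
  H.eq_complex ho he squarePattern hS hbase (fun a => mirrorMap (vecOf e (squarePattern.dir a)))
    (fun a y => he.mirrorMap_vecOf (squarePattern.dir_ne_zero a) (square_mirror a y))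
    fun a F w h => by
      have := H.map_mirrorFlip hB h
      rwa [add_sub_cancel_left] at this

end CellData

/-! ### Identification with the four models -/

theorem tetra_mirrorStable : tetraPattern.MirrorStable := by
  unfold Pattern.MirrorStable
  decide +kernel

theorem octa_mirrorStable : octaPattern.MirrorStable := by
  unfold Pattern.MirrorStable
  decide +kernel

theorem cube_mirrorStable : cubePattern.MirrorStable := by
  unfold Pattern.MirrorStable
  decide +kernel

theorem square_mirrorStable : squarePattern.MirrorStable := octa_mirrorStable

theorem tetra_star (e : Fin 3 → E3) (d : E3) :
    (∃ j, tetraPattern.X 0 j ∧ d = vecOf e (tetraPattern.dir j)) ↔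
      d = vecOf e ![1, -1, -1] ∨ d = vecOf e ![-1, 1, -1] ∨ d = vecOf e ![-1, -1, 1] := by
  have h : ∀ j, tetraPattern.X 0 j ↔ j = 1 ∨ j = 2 ∨ j = 3 := by decide +kernel
  simp only [h, or_and_right, exists_or, exists_eq_left]
  rfl

theorem cube_star (e : Fin 3 → E3) (d : E3) :
    (∃ j, cubePattern.X 0 j ∧ d = vecOf e (cubePattern.dir j)) ↔
      d = vecOf e ![-1, 1, 1] ∨ d = vecOf e ![1, -1, 1] ∨ d = vecOf e ![1, 1, -1] := by
  have h : ∀ j, cubePattern.X 0 j ↔ j = 1 ∨ j = 2 ∨ j = 3 := by decide +kernel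
  simp only [h, or_and_right, exists_or, exists_eq_left]
  rfl

theorem octa_star (e : Fin 3 → E3) (d : E3) :
    (∃ j, octaPattern.X 0 j ∧ d = vecOf e (octaPattern.dir j)) ↔
      d = vecOf e ![0, 1, 0] ∨ d = vecOf e ![0, -1, 0] ∨ d = vecOf e ![0, 0, 1] ∨
        d = vecOf e ![0, 0, -1] := by
  have h : ∀ j, octaPattern.X 0 j ↔ j = 2 ∨ j = 3 ∨ j = 4 ∨ j = 5 := by decide +kernel
  simp only [h, or_and_right, exists_or, exists_eq_left]
  rfl

/-- The frame for the tetrahedral and cubical types. -/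
theorem isFrame_half {a b b' b'' : E3} {L ε : ℝ} (hε : ε * ε = 1) (hL : 0 < L)
    (haa : ⟪a, a⟫_ℝ = L) (h1 : ⟪b, b⟫_ℝ = L) (h2 : ⟪b', b'⟫_ℝ = L) (h3 : ⟪b'', b''⟫_ℝ = L)
    (a1 : 3 * ⟪a, b⟫_ℝ = ε * L) (a2 : 3 * ⟪a, b'⟫_ℝ = ε * L) (a3 : 3 * ⟪a, b''⟫_ℝ = ε * L)
    (b1 : 3 * ⟪b, b'⟫_ℝ = -L) (b2 : 3 * ⟪b, b''⟫_ℝ = -L) (b3 : 3 * ⟪b', b''⟫_ℝ = -L) :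
    IsFrame ![(1 / 2 : ℝ) • (a - ε • b), (1 / 2 : ℝ) • (a - ε • b'), (1 / 2 : ℝ) • (a - ε • b'')]
      (L / 3) := by
  have key : ∀ x y : E3, 3 * ⟪a, x⟫_ℝ = ε * L → 3 * ⟪a, y⟫_ℝ = ε * L →
      ⟪(1 / 2 : ℝ) • (a - ε • x), (1 / 2 : ℝ) • (a - ε • y)⟫_ℝ = (L + 3 * ⟪x, y⟫_ℝ) / 12 := by
    intro x y hx hy
    have hx' : ⟪x, a⟫_ℝ = ⟪a, x⟫_ℝ := real_inner_comm _ _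
    simp only [real_inner_smul_left, real_inner_smul_right, inner_sub_left, inner_sub_right, haa,
      hx']
    linear_combination (-ε / 12) * hx + (-ε / 12) * hy + (⟪x, y⟫_ℝ / 4 - L / 6) * hε
  refine ⟨by positivity, ?_, ?_⟩
  · intro i
    fin_cases i
    · exact (key b b a1 a1).trans (by rw [h1]; ring)
    · exact (key b' b' a2 a2).trans (by rw [h2]; ring)
    · exact (key b'' b'' a3 a3).trans (by rw [h3]; ring)
  · intro i j hij
    fin_cases i <;> fin_cases j <;> first | exact absurd hij (by decide) | skip
    · exact (key b b' a1 a2).trans (by rw [b1]; ring)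
    · exact (key b b'' a1 a3).trans (by rw [b2]; ring)
    · exact (key b' b'' a2 a3).trans (by rw [b3]; ring)

namespace CellData

variable {K : CellData}

theorem IsMirrored.isStandard_of_perp (H : K.IsMirrored) {o a b : E3} (h : K.Angle o a b)
    (h0 : ⟪a, b⟫_ℝ = 0) : ∃ f, IsStandard K f := by
  obtain ⟨b', h', hab', hbb', hstar⟩ := H.star_of_perp h h0
  have ho : o ∈ K.verts := by
    obtain ⟨F, h⟩ := h
    exact (h.mem_verts H.complex).1
  have he : IsFrame ![a, b, b'] ⟪a, a⟫_ℝ := by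
    refine ⟨H.angle_self_pos h, ?_, ?_⟩
    · intro i
      fin_cases i
      · rfl
      · exact H.angle_self h.symm h
      · exact H.angle_self h'.symm h
    · intro i j hij
      fin_cases i <;> fin_cases j <;> first | exact absurd hij (by decide) | assumption
  have ha : vecOf ![a, b, b'] ![1, 0, 0] = a := by simp [vecOf]
  have hbase : ∀ d, K.Angle o (vecOf ![a, b, b'] ![1, 0, 0]) d ↔
      ∃ j, octaPattern.X 0 j ∧ d = vecOf ![a, b, b'] (octaPattern.dir j) := by
    intro d
    rw [octa_star, ha, hstar]
    simp [vecOf]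
  -- For right angles both flip types occur on the same octahedral star: zigzag faces in the first
  -- case, squares in the second.
  rcases H.flip_cases with hA | hB
  · obtain ⟨f, hf⟩ := H.eq_complex_of_pointFlip hA ho he octaPattern octa_sign octa_mirrorStable
      (i₀ := 0) hbase
    exact ⟨f, Or.inr (Or.inl hf)⟩
  · obtain ⟨f, hf⟩ := H.eq_complex_of_mirrorFlip hB ho he square_mirrorStable (i₀ := 0) hbase
    exact ⟨f, Or.inr (Or.inr (Or.inr hf))⟩

theorem IsMirrored.isStandard_of_third (H : K.IsMirrored) (hA : K.PointFlip) {o a b : E3}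
    (h : K.Angle o a b) {ε : ℝ} (hε : ε = 1 ∨ ε = -1) (h0 : 3 * ⟪a, b⟫_ℝ = ε * ⟪a, a⟫_ℝ) :
    ∃ f, IsStandard K f := by
  have hεε : ε * ε = 1 := by rcases hε with rfl | rfl <;> norm_num
  obtain ⟨b', b'', hsum, q1, q2, q3, hstar⟩ := H.star_of_third h hεε h0
  have ho : o ∈ K.verts := by
    obtain ⟨F, h⟩ := h
    exact (h.mem_verts H.complex).1
  have h' := (hstar b').2 (Or.inr (Or.inl rfl))
  have h'' := (hstar b'').2 (Or.inr (Or.inr rfl))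
  -- With `a = (1,1,1)`, its neighbours differ from `ε • a` in a single coordinate, so the vectors
  -- `(a - ε b) / 2` are the coordinate vectors.
  have he := isFrame_half hεε (H.angle_self_pos h) rfl (H.angle_self h.symm h)
    (H.angle_self h'.symm h) (H.angle_self h''.symm h) h0 (by rw [H.angle_inner h' h, h0])
    (by rw [H.angle_inner h'' h, h0]) q1 q2 q3
  have hb'' : b'' = ε • a - b - b' := by rw [← hsum]; abel
  rcases hε with rfl | rfl
  · obtain ⟨f, hf⟩ := H.eq_complex_of_pointFlip hA ho he cubePattern cube_sign cube_mirrorStable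
      (i₀ := 0) (by
        intro d
        have e0 : vecOf ![(1 / 2 : ℝ) • (a - (1 : ℝ) • b), (1 / 2 : ℝ) • (a - (1 : ℝ) • b'),
            (1 / 2 : ℝ) • (a - (1 : ℝ) • b'')] (cubePattern.dir 0) = a := by
          change vecOf _ ![1, 1, 1] = a
          simp only [vecOf, hb'', Matrix.cons_val]
          push_cast
          module
        rw [cube_star, e0, hstar]
        simp only [vecOf, hb'', Matrix.cons_val]
        push_cast
        have e1 : ∀ x y z w : E3, x = y → z = w → (x = z ↔ y = w) := by
          rintro x y z w rfl rfl
          rfl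
        refine or_congr (e1 _ _ _ _ rfl ?_) (or_congr (e1 _ _ _ _ rfl ?_) (e1 _ _ _ _ rfl ?_)) <;>
          module)
    exact ⟨f, Or.inr (Or.inr (Or.inl hf))⟩
  · obtain ⟨f, hf⟩ := H.eq_complex_of_pointFlip hA ho he tetraPattern tetra_sign tetra_mirrorStable
      (i₀ := 0) (by
        intro d
        have e0 : vecOf ![(1 / 2 : ℝ) • (a - (-1 : ℝ) • b), (1 / 2 : ℝ) • (a - (-1 : ℝ) • b'),
            (1 / 2 : ℝ) • (a - (-1 : ℝ) • b'')] (tetraPattern.dir 0) = a := by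
          change vecOf _ ![1, 1, 1] = a
          simp only [vecOf, hb'', Matrix.cons_val]
          push_cast
          module
        rw [tetra_star, e0, hstar]
        simp only [vecOf, hb'', Matrix.cons_val]
        push_cast
        have e1 : ∀ x y z w : E3, x = y → z = w → (x = z ↔ y = w) := by
          rintro x y z w rfl rfl
          rfl
        refine or_congr (e1 _ _ _ _ rfl ?_) (or_congr (e1 _ _ _ _ rfl ?_) (e1 _ _ _ _ rfl ?_)) <;>
          module)
    exact ⟨f, Or.inl hf⟩

/-- Point flips with cosine 0, 1/3, -1/3 lead to the zigzag complexes over octahedron, cube and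
tetrahedron; mirror flips force cosine 0 and give the squares. -/
theorem exists_isStandard (hK : K.IsRegularComplex) (hs : K.HasNontrivialFlagStabilizer) :
    ∃ f, IsStandard K f := by
  have H := isMirrored hK hs
  obtain ⟨F, o, u, w, hc⟩ := H.nonempty
  have h := hc.angle
  obtain ⟨n, hn⟩ := exists_normal (u - o) (w - o)
  obtain ⟨b', h', hoff⟩ := H.exists_angle_off h hn
  rcases H.flip_cases with hA | hB
  · rcases H.angle_cases h h' hn hoff with ⟨h0, -⟩ | ⟨h0 | h0, -⟩
    · exact H.isStandard_of_perp h h0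
    · exact H.isStandard_of_third hA h (Or.inl rfl) (by rw [one_mul, h0])
    · exact H.isStandard_of_third hA h (Or.inr rfl) (by rw [neg_one_mul, h0])
  · exact H.isStandard_of_perp h (H.perp_of_mirrorFlip hB h)

end CellData

theorem mainTheorem3 :
    (∃ K : Fin 4 → CellData,
      (∀ i, (K i).IsRegularComplex ∧ (K i).HasNontrivialFlagStabilizer) ∧
      (∀ i j, (K i).Similar (K j) → i = j) ∧
      ∀ L : CellData, L.IsRegularComplex → L.HasNontrivialFlagStabilizer →
        ∃ i, L.Similar (K i)) ∧
    ∀ K : CellData, K.IsRegularComplex → K.HasNontrivialFlagStabilizer →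
      ∃ P Q : RankFourData, P.IsRegularApeirotope ∧ Q.IsRegularApeirotope ∧ P ≠ Q ∧
        P.IsPetrieDual Q ∧ Q.IsPetrieDual P ∧ P.twoSkeleton = K ∧ Q.twoSkeleton = K := by
  refine ⟨⟨fourComplexes, fourComplexes_regular, fourComplexes_injective, fun L hL hs => ?_⟩,
    fun K hK hs => ?_⟩
  · obtain ⟨f, hf⟩ := CellData.exists_isStandard hL hs
    exact similar_of_isStandard hf
  · obtain ⟨f, hf⟩ := CellData.exists_isStandard hK hs
    exact petrie_of_isStandard hf
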